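/- Let $\Gamma_1=\{(t,0):t\le 1\}$, $\Gamma_0=\{(t,0):t\le 0\}$, $S_1=\{(t,0):0\le t\le 1\}$ in $\mathbb{R}^2$ and $D_r=\{x\in\mathbb{R}^2:|x|<r\}$. For a real-valued function $w$ that is $H^1$ on bounded parts of the upper and of the lower half-plane, let $\gamma_+(w)$ and $\gamma_-(w)$ be its traces on the $x_1$-axis from above and from below. Let $\widetilde X$ be the space of all real-valued $w\in L^1_{\mathrm{loc}}(\mathbb{R}^2)$ such that $w\in H^1(D_r\setminus\Gamma_1)$ for all $r>0$, $\nabla w\in L^2(\mathbb{R}^2\setminus\Gamma_1,\mathbb{R}^2)$ and $\gamma_+(w)+\gamma_-(w)=0$ on $\Gamma_0$. For an odd $k\in\mathbb{N}$ and $\zeta\in\mathbb{R}$ let $$G_k(\zeta)=\min\left\{\frac12\int_{\mathbb{R}^2\setminus\Gamma_1}|\nabla v|^2\,dx+k\cos\zeta\int_{S_1}|x|^{\frac k2-1}\gamma_+(v)\,dS-\cos\zeta\sin\zeta\ :\ v\in\widetilde X,\ \gamma_+(v)+\gamma_-(v)=2|x|^{\frac k2}\sin\zeta\ \text{on } S_1\right\}.$$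 Then, for every odd $k\in\mathbb{N}$, this minimum is attained for every $\zeta\in\mathbb{R}$, and $G=G_k$ has the following properties: (i) $G$ is continuous on $\mathbb{R}$; (ii) $G(0)<0$ and $G(\frac\pi2)>0$; (iii) $G(\zeta+\pi)=G(\zeta)$ for every $\zeta\in\mathbb{R}$; (iv) $G(\pi-\zeta)=G(\zeta)$ for every $\zeta\in\mathbb{R}$; (v) $G$ is strictly increasing in $(\frac\pi4,\frac\pi2)$; (vi) $G$ is strictly increasing in every interval $I\subset(0,\frac\pi2)$ such that $G>0$ in $I$. -/

import Mathlib

open scoped ContDiff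

namespace SlitPlane

/-! The plane is `ℝ × ℝ` with Lebesgue measure. Euclidean lengths are always written out in
coordinates, so the sup norm that Mathlib puts on `ℝ × ℝ` plays no role. -/

/-- Test functions `C_c^∞(U)`: smooth functions on the plane with compact support inside `U`. -/
def IsTestOn (U : Set (ℝ × ℝ)) (φ : ℝ × ℝ → ℝ) : Prop :=
  ContDiff ℝ ∞ φ ∧ HasCompactSupport φ ∧ tsupport φ ⊆ U

/-- The Euclidean scalar product of the plane. -/
def dot (a b : ℝ × ℝ) : ℝ := a.1 * b.1 + a.2 * b.2

/-- `g` is the weak (distributional) gradient of `w` in the open set `U`: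
`∫_U w ∂_e φ = - ∫_U (g · e) φ` for every `φ ∈ C_c^∞(U)` and every direction `e`. -/
def HasWeakGrad (U : Set (ℝ × ℝ)) (w : ℝ × ℝ → ℝ) (g : ℝ × ℝ → ℝ × ℝ) : Prop :=
  MeasureTheory.LocallyIntegrableOn w U ∧ MeasureTheory.LocallyIntegrableOn g U ∧
    ∀ φ : ℝ × ℝ → ℝ, IsTestOn U φ → ∀ e : ℝ × ℝ,
      ∫ x in U, w x * fderiv ℝ φ x e = - ∫ x in U, dot (g x) e * φ x

/-- `w ∈ H¹(U)`: both `w` and its weak gradient are square integrable on `U`. -/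
def MemH1 (U : Set (ℝ × ℝ)) (w : ℝ × ℝ → ℝ) : Prop :=
  MeasureTheory.MemLp w 2 (MeasureTheory.volume.restrict U) ∧
    ∃ g : ℝ × ℝ → ℝ × ℝ, HasWeakGrad U w g ∧
      MeasureTheory.MemLp g 2 (MeasureTheory.volume.restrict U)

/-- The open half-plane above the `x₁`-axis. -/
def upper : Set (ℝ × ℝ) := {x | 0 < x.2}

/-- The open half-plane below the `x₁`-axis. -/
def lower : Set (ℝ × ℝ) := {x | x.2 < 0}

/-- Traces on the `x₁`-axis, which is identified with `ℝ` through `t ↦ (t, 0)`.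
For `H` one of the half-planes `upper`, `lower`, with outer unit normal `n`, the locally integrable
function `p` is the trace of `w` from the side of `H`: `w` has in `H` a weak gradient `g`, both are
integrable on bounded parts of `H`, and Green's formula
`∫_H w ∂_e φ = - ∫_H (g · e) φ + (n · e) ∫_ℝ p(t) φ(t, 0) dt`
holds for all directions `e` and all `φ ∈ C_c^∞(ℝ²)`; these `φ` need not vanish on the axis.
This determines `p` almost everywhere. -/
def IsTrace (H : Set (ℝ × ℝ)) (n : ℝ × ℝ) (w : ℝ × ℝ → ℝ) (p : ℝ → ℝ) : Prop :=
  MeasureTheory.LocallyIntegrable p MeasureTheory.volume ∧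
  MeasureTheory.LocallyIntegrable w (MeasureTheory.volume.restrict H) ∧
    ∃ g : ℝ × ℝ → ℝ × ℝ,
      MeasureTheory.LocallyIntegrable g (MeasureTheory.volume.restrict H) ∧
      ∀ φ : ℝ × ℝ → ℝ, IsTestOn Set.univ φ → ∀ e : ℝ × ℝ,
        ∫ x in H, w x * fderiv ℝ φ x e =
          - (∫ x in H, dot (g x) e * φ x) + dot n e * ∫ t : ℝ, p t * φ (t, 0)

/-- `p = γ₊(w)`, the trace on the `x₁`-axis from above. -/
def IsUpperTrace (w : ℝ × ℝ → ℝ) (p : ℝ → ℝ) : Prop := IsTrace upper (0, -1) w p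

/-- `q = γ₋(w)`, the trace on the `x₁`-axis from below. -/
def IsLowerTrace (w : ℝ × ℝ → ℝ) (q : ℝ → ℝ) : Prop := IsTrace lower (0, 1) w q

/-- The crack `Γ₁ = {(t, 0) : t ≤ 1}`. -/
def crack : Set (ℝ × ℝ) := {x | x.1 ≤ 1 ∧ x.2 = 0}

/-- The open Euclidean disk `D_r` centred at the origin. -/
def disk (r : ℝ) : Set (ℝ × ℝ) := {x | x.1 ^ 2 + x.2 ^ 2 < r ^ 2}

/-- The space `X̃`: locally integrable `w` which belong to `H¹(D_r ∖ Γ₁)` for all `r > 0`, with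
weak gradient in `L²(ℝ² ∖ Γ₁)`, and with `γ₊(w) + γ₋(w) = 0` on `Γ₀ = {(t, 0) : t ≤ 0}`. -/
def XTilde : Set (ℝ × ℝ → ℝ) :=
  {w | MeasureTheory.LocallyIntegrable w MeasureTheory.volume ∧
    (∀ r : ℝ, 0 < r → MemH1 (disk r \ crack) w) ∧
    (∃ g : ℝ × ℝ → ℝ × ℝ, HasWeakGrad crackᶜ w g ∧
      MeasureTheory.MemLp g 2 (MeasureTheory.volume.restrict crackᶜ)) ∧
    ∃ p q : ℝ → ℝ, IsUpperTrace w p ∧ IsLowerTrace w q ∧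
      ∀ᵐ t ∂(MeasureTheory.volume.restrict (Set.Iic (0 : ℝ))), p t + q t = 0}

/-- The set of the values
`½ ∫_{ℝ² ∖ Γ₁} |∇v|² + k cos ζ ∫_{S₁} |x|^{k/2 - 1} γ₊(v) dS - cos ζ sin ζ`
over all `v ∈ X̃` with `γ₊(v) + γ₋(v) = 2 |x|^{k/2} sin ζ` on `S₁ = {(t, 0) : 0 ≤ t ≤ 1}`. -/
def energyValues (k : ℕ) (ζ : ℝ) : Set ℝ :=
  {E | ∃ v ∈ XTilde, ∃ (g : ℝ × ℝ → ℝ × ℝ) (p q : ℝ → ℝ),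
    HasWeakGrad crackᶜ v g ∧ IsUpperTrace v p ∧ IsLowerTrace v q ∧
    (∀ᵐ t ∂(MeasureTheory.volume.restrict (Set.Icc (0 : ℝ) 1)),
      p t + q t = 2 * t ^ ((k : ℝ) / 2) * Real.sin ζ) ∧
    E = (1 / 2 : ℝ) * (∫ x in crackᶜ, dot (g x) (g x))
      + (k : ℝ) * Real.cos ζ * (∫ t in Set.Icc (0 : ℝ) 1, t ^ ((k : ℝ) / 2 - 1) * p t)
      - Real.cos ζ * Real.sin ζ}

/-- The function `G_k`, the minimum of the values above. -/
noncomputable def G (k : ℕ) (ζ : ℝ) : ℝ := sInf (energyValues k ζ)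

end SlitPlane

namespace SlitPlane

open MeasureTheory Set Filter Topology

/-! ### Test functions and weak gradients -/

/-! The minimiser is explicit. Put k = 2m + 1 and E(z) = √z - √(z-1) with principal branches (`jk`),
so that 1/E = √z + √(z-1) and (E + 1/E)/2 = √z. Let L (`half`) be the odd real polynomial with L(X)
+ L(1/X) = 2((X + 1/X)/2)^k, and let F = L(E) (`hol`), which is holomorphic off the crack and
commutes with conjugation there. On the axis, approached from above, E is imaginary for t ≤ 0, lies
on the unit circle for 0 ≤ t ≤ 1 and is real for t ≥ 1. Hence Re F = 0, Re F = t^(k/2) and Im F = 0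
on these three pieces. Since Re F is even and Im F is odd under reflection in the axis, u = Re((sin
ζ - i cos ζ) F) = sin ζ Re F + cos ζ Im F is admissible.

The function u solves the Euler-Lagrange equation: if d is a difference of two competitors, so that
its traces add up to zero for t ≤ 1, then ∫ ∇d·∇u = -k cos ζ ∫ t^(k/2-1) γ₊(d) over S₁
(`integral_dot_gd`). So the energy of u + d is that of u plus ½∫|∇d|², and u is a minimiser. Let A =
½∫|F'|² (`dirichlet`). The same identity applied to Im F gives k ∫ t^(k/2-1) Im F = -2A, and the
minimum is A + cos ζ (sin ζ - 2A cos ζ) - cos ζ sin ζ = -A cos 2ζ. As A > 0, every listed property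
is one of -cos 2ζ.

The analytic work lies in the Euler-Lagrange identity, because traces are given only through Green's
formula and ∇u blows up like the inverse square root of the distance at 0 and 1. Now ∇u is the
rotated gradient of the conjugate harmonic function, and for a rotated gradient Green's formula
(`GreenOn.integral_dot_rot`) involves only the tangential derivative on the axis. It is tested with
the conjugate function, cut off and shifted upwards; then the shift tends to zero (`RotTrace.cut`)
and the cutoff is removed (`RotTrace.tendsto_cut`). The first limit needs the trace to be integrable
against |t - t₀|^(-1/2). This is `GreenOn.lintegral_trace_weight_lt_top`, proved by averaging over a
fan of lines through each point. -/

theorem IsTestOn.mono {U V : Set (ℝ × ℝ)} {φ : ℝ × ℝ → ℝ} (h : IsTestOn U φ) (hUV : U ⊆ V) :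
    IsTestOn V φ :=
  ⟨h.1, h.2.1, h.2.2.trans hUV⟩

theorem IsTestOn.continuous {U : Set (ℝ × ℝ)} {φ : ℝ × ℝ → ℝ} (h : IsTestOn U φ) :
    Continuous φ := h.1.continuous

theorem IsTestOn.differentiable {U : Set (ℝ × ℝ)} {φ : ℝ × ℝ → ℝ} (h : IsTestOn U φ) :
    Differentiable ℝ φ := h.1.differentiable (by simp)

theorem IsTestOn.fderiv {U : Set (ℝ × ℝ)} {φ : ℝ × ℝ → ℝ} (h : IsTestOn U φ) (e : ℝ × ℝ) :
    IsTestOn U (fun x => fderiv ℝ φ x e) := by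
  refine ⟨(h.1.fderiv_right (m := ∞) (by simp)).clm_apply contDiff_const,
    h.2.1.fderiv_apply (𝕜 := ℝ) e, ?_⟩
  exact (tsupport_fderiv_apply_subset ℝ e).trans h.2.2

theorem IsTestOn.bound {U : Set (ℝ × ℝ)} {φ : ℝ × ℝ → ℝ} (h : IsTestOn U φ) :
    ∃ C, ∀ x, ‖φ x‖ ≤ C := h.2.1.exists_bound_of_continuous h.continuous

theorem dot_sub_left (a b c : ℝ × ℝ) : dot (a - b) c = dot a c - dot b c := by
  simp [dot]; ring

theorem dot_comm (a b : ℝ × ℝ) : dot a b = dot b a := by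
  simp [dot]; ring

theorem abs_dot_le (a b : ℝ × ℝ) : |dot a b| ≤ 2 * (‖a‖ * ‖b‖) := by
  have h1 : |a.1| ≤ ‖a‖ := by simpa using norm_fst_le a
  have h2 : |a.2| ≤ ‖a‖ := by simpa using norm_snd_le a
  have h3 : |b.1| ≤ ‖b‖ := by simpa using norm_fst_le b
  have h4 : |b.2| ≤ ‖b‖ := by simpa using norm_snd_le b
  calc |dot a b| ≤ |a.1 * b.1| + |a.2 * b.2| := abs_add_le _ _
    _ = |a.1| * |b.1| + |a.2| * |b.2| := by rw [abs_mul, abs_mul]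
    _ ≤ ‖a‖ * ‖b‖ + ‖a‖ * ‖b‖ := by gcongr
    _ = _ := by ring

/-- The scalar product with a fixed vector as a continuous linear map. -/
noncomputable def dotL (e : ℝ × ℝ) : ℝ × ℝ →L[ℝ] ℝ :=
  e.1 • ContinuousLinearMap.fst ℝ ℝ ℝ + e.2 • ContinuousLinearMap.snd ℝ ℝ ℝ

theorem dotL_apply (e a : ℝ × ℝ) : dotL e a = dot a e := by
  simp [dotL, dot]; ring

theorem integrableOn_dot {g : ℝ × ℝ → ℝ × ℝ} {μ : Measure (ℝ × ℝ)} {s : Set (ℝ × ℝ)}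
    (h : IntegrableOn g s μ) (e : ℝ × ℝ) : IntegrableOn (fun x => dot (g x) e) s μ := by
  have := (dotL e).integrable_comp h
  simpa [IntegrableOn, Function.comp_def, dotL_apply] using this

theorem locallyIntegrableOn_dot {g : ℝ × ℝ → ℝ × ℝ} {U : Set (ℝ × ℝ)}
    (h : LocallyIntegrableOn g U) (e : ℝ × ℝ) :
    LocallyIntegrableOn (fun x => dot (g x) e) U := by
  intro x hx
  obtain ⟨s, hs, hi⟩ := h x hx
  exact ⟨s, hs, integrableOn_dot hi e⟩

theorem locallyIntegrable_dot {g : ℝ × ℝ → ℝ × ℝ} {μ : Measure (ℝ × ℝ)}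
    (h : LocallyIntegrable g μ) (e : ℝ × ℝ) :
    LocallyIntegrable (fun x => dot (g x) e) μ := by
  intro x
  obtain ⟨s, hs, hi⟩ := h x
  exact ⟨s, hs, integrableOn_dot hi e⟩

theorem locallyIntegrable_mul_test {f : ℝ × ℝ → ℝ} {μ : Measure (ℝ × ℝ)} {U : Set (ℝ × ℝ)}
    {φ : ℝ × ℝ → ℝ} (hf : LocallyIntegrable f μ) (hφ : IsTestOn U φ) :
    Integrable (fun x => f x * φ x) μ := by
  have := hf.integrable_smul_right_of_hasCompactSupport hφ.continuous hφ.2.1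
  simpa using this

/-- Products of a function integrable on compact subsets of `U` with a test function on `U`. -/
theorem locallyIntegrableOn_mul_test {f : ℝ × ℝ → ℝ} {U : Set (ℝ × ℝ)}
    {φ : ℝ × ℝ → ℝ} (hf : LocallyIntegrableOn f U) (hφ : IsTestOn U φ) :
    Integrable (fun x => f x * φ x) := by
  have hK : IntegrableOn f (tsupport φ) := hf.integrableOn_compact_subset hφ.2.2 hφ.2.1
  have h1 : IntegrableOn (fun x => f x * φ x) (tsupport φ) :=
    hK.mul_continuousOn hφ.continuous.continuousOn hφ.2.1
  rwa [integrableOn_iff_integrable_of_support_subset] at h1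
  intro x hx
  refine subset_tsupport φ ?_
  simp only [Function.mem_support] at hx ⊢
  exact right_ne_zero_of_mul hx

theorem setIntegral_mul_test (f : ℝ × ℝ → ℝ) {U : Set (ℝ × ℝ)} {φ : ℝ × ℝ → ℝ}
    (hφ : IsTestOn U φ) : ∫ x in U, f x * φ x = ∫ x, f x * φ x := by
  refine setIntegral_eq_integral_of_forall_compl_eq_zero fun x hx => ?_
  have : φ x = 0 := by
    by_contra h
    exact hx (hφ.2.2 (subset_tsupport φ h))
  rw [this, mul_zero]

theorem HasWeakGrad.mono {U V : Set (ℝ × ℝ)} {w : ℝ × ℝ → ℝ} {g : ℝ × ℝ → ℝ × ℝ}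
    (h : HasWeakGrad U w g) (hVU : V ⊆ U) : HasWeakGrad V w g := by
  refine ⟨h.1.mono_set hVU, h.2.1.mono_set hVU, fun φ hφ e => ?_⟩
  have := h.2.2 φ (hφ.mono hVU) e
  rwa [setIntegral_mul_test _ ((hφ.mono hVU).fderiv e), setIntegral_mul_test _ (hφ.mono hVU),
    ← setIntegral_mul_test _ (hφ.fderiv e), ← setIntegral_mul_test _ hφ] at this

theorem ae_eq_of_dot_test {U : Set (ℝ × ℝ)} (hU : IsOpen U) {g g' : ℝ × ℝ → ℝ × ℝ}
    (hg : LocallyIntegrableOn g U) (hg' : LocallyIntegrableOn g' U)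
    (h : ∀ φ, IsTestOn U φ → ∀ e, ∫ x, dot (g x) e * φ x = ∫ x, dot (g' x) e * φ x) :
    g =ᵐ[volume.restrict U] g' := by
  have key : ∀ e, ∀ᵐ x, x ∈ U → dot (g x - g' x) e = 0 := by
    intro e
    refine hU.ae_eq_zero_of_integral_contDiff_smul_eq_zero
      (locallyIntegrableOn_dot (hg.sub hg') e) fun φ h1 h2 h3 => ?_
    have hφ : IsTestOn U φ := ⟨h1, h2, h3⟩
    have := h φ hφ e
    rw [← sub_eq_zero, ← integral_sub (locallyIntegrableOn_mul_test (locallyIntegrableOn_dot hg e) hφ)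
      (locallyIntegrableOn_mul_test (locallyIntegrableOn_dot hg' e) hφ)] at this
    rw [← this]
    refine integral_congr_ae (Eventually.of_forall fun x => ?_)
    simp only [smul_eq_mul, dot_sub_left]
    ring
  rw [EventuallyEq, ae_restrict_iff' hU.measurableSet]
  filter_upwards [key (1, 0), key (0, 1)] with x h1 h2 hx
  have h1 := h1 hx
  have h2 := h2 hx
  simp only [dot, Prod.fst_sub, Prod.snd_sub] at h1 h2
  ext <;> linarith

theorem HasWeakGrad.ae_eq {U : Set (ℝ × ℝ)} (hU : IsOpen U) {w : ℝ × ℝ → ℝ}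
    {g g' : ℝ × ℝ → ℝ × ℝ} (h : HasWeakGrad U w g) (h' : HasWeakGrad U w g') :
    g =ᵐ[volume.restrict U] g' := by
  refine ae_eq_of_dot_test hU h.2.1 h'.2.1 fun φ hφ e => ?_
  rw [← setIntegral_mul_test _ hφ, ← setIntegral_mul_test _ hφ]
  have h1 := h.2.2 φ hφ e
  have h2 := h'.2.2 φ hφ e
  linarith

/-! ### Green's formula and traces -/

/-- Green's formula on `H` for `w` with gradient `g` and boundary values `p`. -/
structure GreenOn (H : Set (ℝ × ℝ)) (n : ℝ × ℝ) (w : ℝ × ℝ → ℝ) (g : ℝ × ℝ → ℝ × ℝ)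
    (p : ℝ → ℝ) : Prop where
  trace : LocallyIntegrable p volume
  fn : LocallyIntegrable w (volume.restrict H)
  grad : LocallyIntegrable g (volume.restrict H)
  green : ∀ φ : ℝ × ℝ → ℝ, IsTestOn Set.univ φ → ∀ e : ℝ × ℝ,
    ∫ x in H, w x * fderiv ℝ φ x e =
      - (∫ x in H, dot (g x) e * φ x) + dot n e * ∫ t : ℝ, p t * φ (t, 0)

theorem GreenOn.isTrace {H : Set (ℝ × ℝ)} {n : ℝ × ℝ} {w : ℝ × ℝ → ℝ} {g : ℝ × ℝ → ℝ × ℝ}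
    {p : ℝ → ℝ} (h : GreenOn H n w g p) : IsTrace H n w p :=
  ⟨h.trace, h.fn, g, h.grad, h.green⟩

theorem IsTrace.exists_greenOn {H : Set (ℝ × ℝ)} {n : ℝ × ℝ} {w : ℝ × ℝ → ℝ}
    {p : ℝ → ℝ} (h : IsTrace H n w p) : ∃ g, GreenOn H n w g p := by
  obtain ⟨h1, h2, g, h3, h4⟩ := h
  exact ⟨g, h1, h2, h3, h4⟩

theorem GreenOn.congr_grad {H : Set (ℝ × ℝ)} {n : ℝ × ℝ} {w : ℝ × ℝ → ℝ}
    {g g' : ℝ × ℝ → ℝ × ℝ} {p : ℝ → ℝ} (h : GreenOn H n w g p)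
    (hg : g =ᵐ[volume.restrict H] g') : GreenOn H n w g' p := by
  refine ⟨h.trace, h.fn, ?_, fun φ hφ e => ?_⟩
  · intro x
    obtain ⟨s, hs, hi⟩ := h.grad x
    exact ⟨s, hs, hi.congr_fun_ae (ae_restrict_of_ae hg)⟩
  · rw [h.green φ hφ e]
    congr 2
    refine integral_congr_ae ?_
    filter_upwards [hg] with x hx
    rw [hx]

theorem GreenOn.hasWeakGrad {H : Set (ℝ × ℝ)} {n : ℝ × ℝ} {w : ℝ × ℝ → ℝ}
    {g : ℝ × ℝ → ℝ × ℝ} {p : ℝ → ℝ} (hH : ∀ t : ℝ, (t, (0 : ℝ)) ∉ H)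
    (h : GreenOn H n w g p) : HasWeakGrad H w g := by
  refine ⟨locallyIntegrableOn_of_locallyIntegrable_restrict h.fn,
    locallyIntegrableOn_of_locallyIntegrable_restrict h.grad, fun φ hφ e => ?_⟩
  rw [h.green φ (hφ.mono (subset_univ _)) e]
  have : ∀ t : ℝ, φ (t, 0) = 0 := fun t => by
    by_contra h0
    exact hH t (hφ.2.2 (subset_tsupport φ h0))
  simp [this]

/-- The gradient inside `IsTrace` is existentially quantified. Test functions supported in H do not
see the axis, so it is a weak gradient on H and by uniqueness may be replaced by the global one. -/
theorem IsTrace.greenOn {H U : Set (ℝ × ℝ)} {n : ℝ × ℝ} {w : ℝ × ℝ → ℝ}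
    {g : ℝ × ℝ → ℝ × ℝ} {p : ℝ → ℝ} (hHo : IsOpen H) (hH : ∀ t : ℝ, (t, (0 : ℝ)) ∉ H)
    (hHU : H ⊆ U) (h : IsTrace H n w p) (hg : HasWeakGrad U w g) : GreenOn H n w g p := by
  obtain ⟨g', h'⟩ := h.exists_greenOn
  exact h'.congr_grad ((h'.hasWeakGrad hH).ae_eq hHo (hg.mono hHU))

theorem isOpen_upper : IsOpen upper := isOpen_lt continuous_const continuous_snd

theorem isOpen_lower : IsOpen lower := isOpen_lt continuous_snd continuous_const

theorem isClosed_crack : IsClosed crack :=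
  (isClosed_le continuous_fst continuous_const).inter
    (isClosed_eq continuous_snd continuous_const)

theorem axis_notMem_upper (t : ℝ) : (t, (0 : ℝ)) ∉ upper := by simp [upper]

theorem axis_notMem_lower (t : ℝ) : (t, (0 : ℝ)) ∉ lower := by simp [lower]

theorem upper_subset : upper ⊆ crackᶜ := by
  rintro x hx ⟨-, h⟩
  exact (ne_of_gt hx) h

theorem lower_subset : lower ⊆ crackᶜ := by
  rintro x hx ⟨-, h⟩
  exact (ne_of_lt hx) h

theorem volume_axis : volume {x : ℝ × ℝ | x.2 = 0} = 0 := by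
  have : {x : ℝ × ℝ | x.2 = 0} = univ ×ˢ {0} := by ext; simp
  rw [this, Measure.volume_eq_prod, Measure.prod_prod]
  simp

/-- The crack is a null set, so all integrals over its complement become integrals over the plane.
-/
theorem restrict_crack_compl : (volume : Measure (ℝ × ℝ)).restrict crackᶜ = volume := by
  refine Measure.restrict_eq_self_of_ae_mem ?_
  rw [ae_iff]
  refine measure_mono_null (fun x hx => ?_) volume_axis
  simp only [mem_compl_iff, not_not, mem_ofPred_eq] at hx
  exact hx.2

theorem volume_eq_upper_add_lower :
    (volume : Measure (ℝ × ℝ)) = volume.restrict upper + volume.restrict lower := by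
  have hd : Disjoint upper lower :=
    Set.disjoint_left.2 fun x (h : 0 < x.2) (h' : x.2 < 0) => lt_asymm h h'
  rw [← Measure.restrict_union hd isOpen_lower.measurableSet]
  symm
  refine Measure.restrict_eq_self_of_ae_mem ?_
  rw [ae_iff]
  refine measure_mono_null (fun x hx => ?_) volume_axis
  simp only [mem_union, upper, lower, mem_ofPred_eq, not_or, not_lt] at hx ⊢
  exact le_antisymm hx.1 hx.2

theorem integral_eq_upper_add_lower {f : ℝ × ℝ → ℝ} (hf : Integrable f) :
    ∫ x, f x = (∫ x in upper, f x) + ∫ x in lower, f x := by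
  rw [← integral_add_measure hf.restrict hf.restrict, ← volume_eq_upper_add_lower]

/-- A test function on the plane built from one on the line. -/
theorem exists_test_extension {a : ℝ → ℝ} (ha : ContDiff ℝ ∞ a) (hc : HasCompactSupport a) :
    ∃ φ : ℝ × ℝ → ℝ, IsTestOn univ φ ∧ (∀ t, φ (t, 0) = a t) ∧
      tsupport φ ⊆ {x | x.1 ∈ tsupport a} := by
  let b : ContDiffBump (0 : ℝ) := ⟨1, 2, by norm_num, by norm_num⟩
  refine ⟨fun x => a x.1 * b x.2, ⟨(ha.comp contDiff_fst).mul (b.contDiff.comp contDiff_snd),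
    ?_, subset_univ _⟩, fun t => ?_, ?_⟩
  · refine HasCompactSupport.intro (K := tsupport a ×ˢ tsupport b)
      (hc.isCompact.prod b.hasCompactSupport.isCompact) fun x hx => ?_
    rw [mem_prod, not_and_or] at hx
    rcases hx with h | h
    · rw [image_eq_zero_of_notMem_tsupport h, zero_mul]
    · rw [image_eq_zero_of_notMem_tsupport h, mul_zero]
  · have : b 0 = 1 := b.one_of_mem_closedBall (by simp [b])
    simp [this]
  · refine closure_minimal (fun x hx => ?_) ((isClosed_tsupport a).preimage continuous_fst)
    simp only [Function.mem_support] at hx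
    exact subset_tsupport a (left_ne_zero_of_mul hx)

theorem locallyIntegrable_mul_axis {p : ℝ → ℝ} (hp : LocallyIntegrable p) {a : ℝ → ℝ}
    (ha : Continuous a) (hc : HasCompactSupport a) : Integrable (fun t => p t * a t) := by
  simpa using hp.integrable_smul_right_of_hasCompactSupport ha hc

/-- Taking e = n and a test function with prescribed restriction to the axis isolates the boundary
integral. This is needed because membership in `XTilde` and in `energyValues` each bring their own
traces. -/
theorem GreenOn.trace_unique {H : Set (ℝ × ℝ)} {n : ℝ × ℝ} {w : ℝ × ℝ → ℝ}
    {g : ℝ × ℝ → ℝ × ℝ} {p p' : ℝ → ℝ} (hn : dot n n ≠ 0) (h : GreenOn H n w g p)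
    (h' : GreenOn H n w g p') : p =ᵐ[volume] p' := by
  have : ∀ᵐ t, p t - p' t = 0 := by
    refine ae_eq_zero_of_integral_contDiff_smul_eq_zero (h.trace.sub h'.trace) fun a ha hc => ?_
    obtain ⟨φ, hφ, hφa, -⟩ := exists_test_extension ha hc
    have h1 := h.green φ hφ n
    rw [h'.green φ hφ n] at h1
    simp only [hφa] at h1
    have h2 : (∫ t, p t * a t) - ∫ t, p' t * a t = 0 := by
      have : dot n n * ((∫ t, p t * a t) - ∫ t, p' t * a t) = 0 := by linarith
      exact (mul_eq_zero.1 this).resolve_left hn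
    rw [← integral_sub (locallyIntegrable_mul_axis h.trace ha.continuous hc)
      (locallyIntegrable_mul_axis h'.trace ha.continuous hc)] at h2
    rw [← h2]
    refine integral_congr_ae (Eventually.of_forall fun t => ?_)
    simp only [smul_eq_mul]
    ring
  filter_upwards [this] with t ht
  linarith

/-- Off the crack the traces from both sides agree. -/
theorem traces_agree {w : ℝ × ℝ → ℝ} {g : ℝ × ℝ → ℝ × ℝ} {p q : ℝ → ℝ}
    (hg : HasWeakGrad crackᶜ w g) (hp : GreenOn upper (0, -1) w g p)
    (hq : GreenOn lower (0, 1) w g q) : ∀ᵐ t : ℝ, 1 < t → p t = q t := by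
  have : ∀ᵐ t : ℝ, t ∈ Ioi (1 : ℝ) → (p - q) t = 0 := by
    refine isOpen_Ioi.ae_eq_zero_of_integral_contDiff_smul_eq_zero
      ((hp.trace.sub hq.trace).locallyIntegrableOn _) fun a ha hc hs => ?_
    obtain ⟨φ, hφ, hφa, hφs⟩ := exists_test_extension ha hc
    have hφ' : IsTestOn crackᶜ φ := by
      refine ⟨hφ.1, hφ.2.1, fun x hx hxc => ?_⟩
      have := hs (hφs hx)
      exact absurd hxc.1 (not_le.2 this)
    -- The two half-plane formulas add up to the weak gradient identity across the axis, where φ is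
    -- a legitimate test function. The normals are opposite, so the difference of the traces is all
    -- that is left.
    have h1 := hp.green φ hφ (0, 1)
    have h2 := hq.green φ hφ (0, 1)
    have h3 := hg.2.2 φ hφ' (0, 1)
    rw [restrict_crack_compl,
      integral_eq_upper_add_lower (locallyIntegrableOn_mul_test hg.1 (hφ'.fderiv _)),
      integral_eq_upper_add_lower
        (locallyIntegrableOn_mul_test (locallyIntegrableOn_dot hg.2.1 _) hφ')] at h3
    simp only [hφa, dot, mul_zero, zero_add, mul_one] at h1 h2 h3
    have h4 : (∫ t, p t * a t) - ∫ t, q t * a t = 0 := by linarith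
    rw [← integral_sub (locallyIntegrable_mul_axis hp.trace ha.continuous hc)
      (locallyIntegrable_mul_axis hq.trace ha.continuous hc)] at h4
    rw [← h4]
    refine integral_congr_ae (Eventually.of_forall fun t => ?_)
    simp only [smul_eq_mul, Pi.sub_apply]
    ring
  filter_upwards [this] with t ht h1
  have := ht h1
  simp only [Pi.sub_apply] at this
  linarith

/-! ### Reflection in the axis -/

/-- Reflection in the axis. -/
def refl (x : ℝ × ℝ) : ℝ × ℝ := (x.1, -x.2)

theorem refl_refl (x : ℝ × ℝ) : refl (refl x) = x := by simp [refl]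

theorem dot_refl_left (a b : ℝ × ℝ) : dot (refl a) b = dot a (refl b) := by
  simp [dot, refl]

/-- Reflection as a continuous linear equivalence. -/
noncomputable def reflL : (ℝ × ℝ) ≃L[ℝ] (ℝ × ℝ) :=
  (ContinuousLinearEquiv.refl ℝ ℝ).prodCongr (ContinuousLinearEquiv.neg ℝ)

theorem reflL_apply (x : ℝ × ℝ) : reflL x = refl x := by simp [reflL, refl]

theorem coe_reflL : ⇑reflL = refl := funext reflL_apply

theorem norm_refl (x : ℝ × ℝ) : ‖refl x‖ = ‖x‖ := by simp [refl, Prod.norm_def]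

theorem measurePreserving_refl : MeasurePreserving refl :=
  (MeasurePreserving.id volume).prod (Measure.measurePreserving_neg volume)

theorem measurableEmbedding_refl : MeasurableEmbedding refl := by
  rw [← coe_reflL]; exact reflL.toHomeomorph.measurableEmbedding

theorem setIntegral_refl (H : Set (ℝ × ℝ)) (f : ℝ × ℝ → ℝ) :
    ∫ x in refl ⁻¹' H, f (refl x) = ∫ x in H, f x :=
  measurePreserving_refl.setIntegral_preimage_emb measurableEmbedding_refl f H

theorem measurePreserving_refl_restrict (H : Set (ℝ × ℝ)) :
    MeasurePreserving refl (volume.restrict (refl ⁻¹' H)) (volume.restrict H) :=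
  measurePreserving_refl.restrict_preimage_emb measurableEmbedding_refl H

theorem locallyIntegrable_refl {E : Type*} [NormedAddCommGroup E] {f : ℝ × ℝ → E}
    {H : Set (ℝ × ℝ)} (hf : LocallyIntegrable f (volume.restrict H)) :
    LocallyIntegrable (fun x => f (refl x)) (volume.restrict (refl ⁻¹' H)) := by
  intro x
  obtain ⟨s, hs, hi⟩ := hf (refl x)
  refine ⟨refl ⁻¹' s, ?_, ?_⟩
  · refine ContinuousAt.preimage_mem_nhds ?_ hs
    rw [← coe_reflL]; exact reflL.continuous.continuousAt
  · exact ((measurePreserving_refl_restrict H).integrableOn_comp_preimage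
      measurableEmbedding_refl).2 hi

theorem IsTestOn.refl {φ : ℝ × ℝ → ℝ} (h : IsTestOn univ φ) :
    IsTestOn univ (fun x => φ (refl x)) := by
  rw [← coe_reflL]
  exact ⟨h.1.comp reflL.contDiff, h.2.1.comp_homeomorph reflL.toHomeomorph, subset_univ _⟩

theorem fderiv_refl (φ : ℝ × ℝ → ℝ) (x e : ℝ × ℝ) :
    fderiv ℝ (fun x => φ (refl x)) x e = fderiv ℝ φ (refl x) (refl e) := by
  have := reflL.comp_right_fderiv (f := φ) (x := x)
  have h2 : (φ ∘ reflL) = fun x => φ (refl x) := by ext; simp [reflL_apply]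
  rw [h2] at this
  rw [this]
  simp [reflL_apply]

/-- A linear change of variables under which gradient and normal are reflected too. It lets the
trace estimates be proved for the upper half-plane alone. -/
theorem GreenOn.refl {H : Set (ℝ × ℝ)} {n : ℝ × ℝ} {w : ℝ × ℝ → ℝ} {g : ℝ × ℝ → ℝ × ℝ}
    {p : ℝ → ℝ} (h : GreenOn H n w g p) :
    GreenOn (SlitPlane.refl ⁻¹' H) (SlitPlane.refl n) (fun x => w (SlitPlane.refl x))
      (fun x => SlitPlane.refl (g (SlitPlane.refl x))) p := by
  refine ⟨h.trace, locallyIntegrable_refl h.fn, ?_, fun φ hφ e => ?_⟩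
  · have := locallyIntegrable_refl h.grad
    intro x
    obtain ⟨s, hs, hi⟩ := this x
    refine ⟨s, hs, ?_⟩
    have := reflL.toContinuousLinearMap.integrable_comp hi
    simpa [IntegrableOn, Function.comp_def, reflL_apply] using this
  · have h1 := h.green _ hφ.refl (SlitPlane.refl e)
    rw [← setIntegral_refl, ← setIntegral_refl H] at h1
    simp only [fderiv_refl, refl_refl] at h1
    simp only [dot_refl_left]
    rw [h1]
    simp [SlitPlane.refl]

theorem refl_preimage_lower : SlitPlane.refl ⁻¹' lower = upper := by
  ext; simp [refl, lower, upper]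

theorem refl_preimage_upper : SlitPlane.refl ⁻¹' upper = lower := by
  ext; simp [refl, lower, upper]

theorem GreenOn.refl_lower {w : ℝ × ℝ → ℝ} {g : ℝ × ℝ → ℝ × ℝ}
    {p : ℝ → ℝ} (h : GreenOn lower (0, 1) w g p) :
    GreenOn upper (0, -1) (fun x => w (SlitPlane.refl x))
      (fun x => SlitPlane.refl (g (SlitPlane.refl x))) p := by
  have := h.refl
  rwa [refl_preimage_lower, show SlitPlane.refl (0, 1) = (0, -1) by simp [SlitPlane.refl]] at this

theorem GreenOn.refl_upper {w : ℝ × ℝ → ℝ} {g : ℝ × ℝ → ℝ × ℝ}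
    {p : ℝ → ℝ} (h : GreenOn upper (0, -1) w g p) :
    GreenOn lower (0, 1) (fun x => w (SlitPlane.refl x))
      (fun x => SlitPlane.refl (g (SlitPlane.refl x))) p := by
  have := h.refl
  rwa [refl_preimage_upper, show SlitPlane.refl (0, -1) = (0, 1) by simp [SlitPlane.refl]] at this

/-! ### Green's formula for rotated gradients -/

/-- The rotated gradient `(∂₂ψ, -∂₁ψ)`. -/
noncomputable def rot (ψ : ℝ × ℝ → ℝ) (x : ℝ × ℝ) : ℝ × ℝ :=
  (fderiv ℝ ψ x (0, 1), -fderiv ℝ ψ x (1, 0))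

/-- A rotated gradient is divergence free. Green's formula is used for ∂₂ψ in direction (1, 0) and
for ∂₁ψ in direction (0, 1); the volume terms agree by symmetry of second derivatives, and since the
normal is vertical only ∂₁ψ survives on the axis. -/
theorem GreenOn.integral_dot_rot {w : ℝ × ℝ → ℝ} {g : ℝ × ℝ → ℝ × ℝ} {p : ℝ → ℝ}
    (h : GreenOn upper (0, -1) w g p) {ψ : ℝ × ℝ → ℝ} (hψ : IsTestOn univ ψ) :
    ∫ x in upper, dot (g x) (rot ψ x) = ∫ t : ℝ, p t * fderiv ℝ ψ (t, 0) (1, 0) := by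
  have h1 := h.green _ (hψ.fderiv (0, 1)) (1, 0)
  have h2 := h.green _ (hψ.fderiv (1, 0)) (0, 1)
  have hsymm : ∀ x, fderiv ℝ (fun y => fderiv ℝ ψ y (0, 1)) x (1, 0)
      = fderiv ℝ (fun y => fderiv ℝ ψ y (1, 0)) x (0, 1) := by
    intro x
    have hd : DifferentiableAt ℝ (fderiv ℝ ψ) x :=
      ((hψ.1.fderiv_right (m := ∞) (by simp)).differentiable (by simp)).differentiableAt
    rw [fderiv_clm_apply hd (differentiableAt_const _), fderiv_clm_apply hd
      (differentiableAt_const _)]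
    simp only [fderiv_fun_const, Pi.zero_apply, ContinuousLinearMap.comp_zero, zero_add,
      ContinuousLinearMap.flip_apply]
    have h2 : ContDiff ℝ 2 ψ := contDiff_infty.1 hψ.1 2
    exact (h2.contDiffAt.isSymmSndFDerivAt (by simp)) _ _
  simp only [hsymm] at h1
  rw [h2] at h1
  simp only [dot, mul_zero, zero_mul, add_zero, mul_one, zero_add, neg_mul, one_mul] at h1
  have i1 := locallyIntegrable_mul_test (locallyIntegrable_dot h.grad (1, 0)) (hψ.fderiv (0, 1))
  have i2 := locallyIntegrable_mul_test (locallyIntegrable_dot h.grad (0, 1)) (hψ.fderiv (1, 0))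
  simp only [dot, mul_zero, add_zero, mul_one, zero_add] at i1 i2
  have : ∫ x in upper, dot (g x) (rot ψ x)
      = (∫ x in upper, (g x).1 * fderiv ℝ ψ x (0, 1))
        - ∫ x in upper, (g x).2 * fderiv ℝ ψ x (1, 0) := by
    rw [← integral_sub i1 i2]
    refine integral_congr_ae (Eventually.of_forall fun x => ?_)
    simp only [dot, rot]
    ring
  rw [this]
  linarith

/-! ### Weighted integrability of traces -/

/-- The weight `|s|^{-1/2}` near the origin. -/
noncomputable def weight (s : ℝ) : ENNReal :=
  (Icc (-1 : ℝ) 1).indicator (fun s => ENNReal.ofReal (|s| ^ (-(1 / 2) : ℝ))) s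

theorem measurable_weight : Measurable weight := by
  refine Measurable.indicator ?_ measurableSet_Icc
  fun_prop

theorem lintegral_rpow_Ioc (b : ℝ) :
    ∫⁻ s in Ioc 0 b, ENNReal.ofReal (s ^ (-(1 / 2) : ℝ)) < ⊤ := by
  rcases le_total b 0 with hb | hb
  · simp [Ioc_eq_empty_of_le hb]
  have := (intervalIntegral.intervalIntegrable_rpow' (a := 0) (b := b) (r := -(1 / 2))
    (by norm_num)).1
  exact this.lintegral_lt_top

theorem lintegral_weight_lt_top : ∫⁻ s, weight s < ⊤ := by
  simp only [weight]
  rw [lintegral_indicator measurableSet_Icc]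
  have h1 : (Icc (-1 : ℝ) 1) ⊆ Icc (-1) 0 ∪ Ioc 0 1 := by
    intro x hx
    rcases le_or_gt x 0 with h | h
    · exact Or.inl ⟨hx.1, h⟩
    · exact Or.inr ⟨h, hx.2⟩
  refine (lintegral_mono_set h1).trans_lt ((lintegral_union_le _ _ _).trans_lt ?_)
  refine ENNReal.add_lt_top.2 ⟨?_, ?_⟩
  · have : ∫⁻ s in Icc (-1 : ℝ) 0, ENNReal.ofReal (|s| ^ (-(1 / 2) : ℝ))
        = ∫⁻ s in Icc (0 : ℝ) 1, ENNReal.ofReal (|s| ^ (-(1 / 2) : ℝ)) := by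
      have h := (Measure.measurePreserving_neg (volume : Measure ℝ)).setLIntegral_comp_preimage_emb
        (MeasurableEquiv.neg ℝ).measurableEmbedding
        (fun s => ENNReal.ofReal (|s| ^ (-(1 / 2) : ℝ))) (Icc 0 1)
      simpa using h
    rw [this, setLIntegral_congr Ioc_ae_eq_Icc.symm]
    refine lt_of_eq_of_lt (setLIntegral_congr_fun measurableSet_Ioc fun s hs => ?_)
      (lintegral_rpow_Ioc 1)
    simp only [abs_of_pos hs.1]
  · refine lt_of_eq_of_lt (setLIntegral_congr_fun measurableSet_Ioc fun s hs => ?_)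
      (lintegral_rpow_Ioc 1)
    simp only [abs_of_pos hs.1]

/-- The average of the weight along a fan of lines through the point `x`. -/
noncomputable def fanWeight (t₀ : ℝ) (x : ℝ × ℝ) : ENNReal :=
  ∫⁻ σ in Ioo (0 : ℝ) 1, weight (x.1 - σ * x.2 - t₀)

theorem measurable_fanWeight (t₀ : ℝ) : Measurable (fanWeight t₀) := by
  unfold fanWeight
  refine Measurable.lintegral_prod_right'
    (f := fun z : (ℝ × ℝ) × ℝ => weight (z.1.1 - z.2 * z.1.2 - t₀)) ?_
  exact measurable_weight.comp (by fun_prop)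

/-- Homogeneity of |s|^(-1/2). The summand 1 is for the case that y s lies in [-1, 1] but s does
not; then |s|^(-1/2) ≤ 1. -/
theorem weight_mul_le {y s : ℝ} (hy : 0 < y) :
    weight (y * s) ≤ ENNReal.ofReal (y ^ (-(1 / 2) : ℝ)) * (1 + weight s) := by
  unfold weight
  by_cases h : y * s ∈ Icc (-1 : ℝ) 1
  · rw [indicator_of_mem h, abs_mul, abs_of_pos hy, Real.mul_rpow hy.le (abs_nonneg _),
      ENNReal.ofReal_mul (by positivity)]
    gcongr
    by_cases h' : s ∈ Icc (-1 : ℝ) 1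
    · rw [indicator_of_mem h']
      exact le_add_self
    · refine le_add_right ?_
      rw [ENNReal.ofReal_le_one]
      refine Real.rpow_le_one_of_one_le_of_nonpos ?_ (by norm_num)
      by_contra hlt
      exact h' (abs_le.1 (not_le.1 hlt).le)
  · rw [indicator_of_notMem h]
    exact zero_le

/-- Rescaling by the height makes σ run through a unit interval, and the singularity of the weight
is integrable in σ. So the average is bounded by a multiple of y^(-1/2), uniformly in the horizontal
variable. -/
theorem fanWeight_le {t₀ : ℝ} {x : ℝ × ℝ} (hx : 0 < x.2) :
    fanWeight t₀ x ≤ ENNReal.ofReal (x.2 ^ (-(1 / 2) : ℝ)) * (1 + ∫⁻ s, weight s) := by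
  unfold fanWeight
  have h1 : ∀ σ, weight (x.1 - σ * x.2 - t₀)
      ≤ ENNReal.ofReal (x.2 ^ (-(1 / 2) : ℝ)) * (1 + weight ((x.1 - t₀) / x.2 - σ)) := by
    intro σ
    have := weight_mul_le (s := (x.1 - t₀) / x.2 - σ) hx
    rwa [show x.2 * ((x.1 - t₀) / x.2 - σ) = x.1 - σ * x.2 - t₀ by field_simp; ring] at this
  refine (lintegral_mono h1).trans ?_
  have hm : Measurable fun σ => weight ((x.1 - t₀) / x.2 - σ) :=
    measurable_weight.comp (by fun_prop)
  rw [lintegral_const_mul _ (by fun_prop), lintegral_add_left measurable_const]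
  refine mul_le_mul_right (add_le_add (by simp) ?_) _
  refine (setLIntegral_le_lintegral _ _).trans ?_
  rw [lintegral_sub_left_eq_self weight]

theorem lintegral_fanWeight (t₀ y : ℝ) : ∫⁻ t, fanWeight t₀ (t, y) = ∫⁻ s, weight s := by
  unfold fanWeight
  rw [lintegral_lintegral_swap]
  · have : ∀ σ, ∫⁻ t, weight (t - σ * y - t₀) = ∫⁻ s, weight s := by
      intro σ
      simp only [sub_sub]
      exact lintegral_sub_right_eq_self weight _
    simp [this]
  · exact (measurable_weight.comp (by fun_prop)).aemeasurable

theorem restrict_upper : (volume : Measure (ℝ × ℝ)).restrict upper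
    = (volume : Measure ℝ).prod ((volume : Measure ℝ).restrict (Ioi 0)) := by
  have : upper = univ ×ˢ Ioi (0 : ℝ) := by ext; simp [upper]
  rw [this, Measure.volume_eq_prod, ← Measure.prod_restrict, Measure.restrict_univ]

/-- On each horizontal line one factor is bounded by C y^(-1/2), and the other integrates to a
constant independent of y. Averaging is essential here: the square of the weight itself is |s|^(-1),
which is not integrable. -/
theorem lintegral_fanWeight_sq_lt_top (t₀ b : ℝ) :
    ∫⁻ x in upper ∩ {x | x.2 ≤ b}, fanWeight t₀ x * fanWeight t₀ x < ⊤ := by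
  set c := ∫⁻ s, weight s with hc
  have hcf : c < ⊤ := lintegral_weight_lt_top
  have hset : upper ∩ {x | x.2 ≤ b} = univ ×ˢ Ioc (0 : ℝ) b := by ext; simp [upper]
  rw [hset, Measure.volume_eq_prod, ← Measure.prod_restrict, Measure.restrict_univ,
    lintegral_prod_symm' (fun x => fanWeight t₀ x * fanWeight t₀ x)
      ((measurable_fanWeight t₀).mul (measurable_fanWeight t₀))]
  calc ∫⁻ y in Ioc 0 b, ∫⁻ t, fanWeight t₀ (t, y) * fanWeight t₀ (t, y)
      ≤ ∫⁻ y in Ioc 0 b, ENNReal.ofReal (y ^ (-(1 / 2) : ℝ)) * ((1 + c) * c) := by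
        refine setLIntegral_mono' measurableSet_Ioc fun y hy => ?_
        calc ∫⁻ t, fanWeight t₀ (t, y) * fanWeight t₀ (t, y)
            ≤ ∫⁻ t, (ENNReal.ofReal (y ^ (-(1 / 2) : ℝ)) * (1 + c)) * fanWeight t₀ (t, y) := by
              refine lintegral_mono fun t => ?_
              gcongr
              exact fanWeight_le (x := (t, y)) hy.1
          _ = _ := by
              have hm : Measurable fun t => fanWeight t₀ (t, y) :=
                (measurable_fanWeight t₀).comp (by fun_prop)
              rw [lintegral_const_mul _ hm, lintegral_fanWeight, mul_assoc]
    _ = (∫⁻ y in Ioc 0 b, ENNReal.ofReal (y ^ (-(1 / 2) : ℝ))) * ((1 + c) * c) := by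
        rw [lintegral_mul_const _ (by fun_prop)]
    _ < ⊤ := by
        refine ENNReal.mul_lt_top (lintegral_rpow_Ioc b) (ENNReal.mul_lt_top ?_ hcf)
        exact ENNReal.add_lt_top.2 ⟨ENNReal.one_lt_top, hcf⟩

/-- The standard cutoff in the vertical variable: `1` near `[-1, 1]`, `0` off `(-2, 2)`. -/
noncomputable def vcut : ContDiffBump (0 : ℝ) := ⟨1, 2, by norm_num, by norm_num⟩

theorem vcut_zero : vcut 0 = 1 := vcut.one_of_mem_closedBall (by simp [vcut])

theorem vcut_eq_zero {y : ℝ} (hy : 2 ≤ |y|) : vcut y = 0 :=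
  vcut.zero_of_le_dist (by simpa [vcut] using hy)

theorem deriv_vcut_eq_zero {y : ℝ} (hy : |y| < 1) : deriv vcut y = 0 := by
  have : vcut =ᶠ[𝓝 y] fun _ => (1 : ℝ) := by
    filter_upwards [Metric.isOpen_ball.mem_nhds (show y ∈ Metric.ball (0 : ℝ) 1 by simpa using hy)]
      with z hz
    exact vcut.one_of_mem_closedBall (Metric.ball_subset_closedBall hz)
  rw [this.deriv_eq, deriv_const]

theorem deriv_vcut_eq_zero' {y : ℝ} (hy : 2 < |y|) : deriv vcut y = 0 := by
  have : vcut =ᶠ[𝓝 y] fun _ => (0 : ℝ) := by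
    filter_upwards [(isOpen_lt continuous_const continuous_abs).mem_nhds hy] with z hz
    exact vcut_eq_zero hz.le
  rw [this.deriv_eq, deriv_const]

theorem contDiff_vcut : ContDiff ℝ ∞ vcut := vcut.contDiff

theorem continuous_deriv_vcut : Continuous (deriv vcut) :=
  (contDiff_vcut.of_le (m := 1) (by exact_mod_cast le_top)).continuous_deriv le_rfl

theorem exists_deriv_vcut_bound : ∃ C, ∀ y, ‖deriv vcut y‖ ≤ C :=
  vcut.hasCompactSupport.deriv.exists_bound_of_continuous continuous_deriv_vcut

/-- Green's formula for a test function that is constant along lines of slope `(σ, 1)`, up to the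
vertical cutoff. -/
theorem GreenOn.slanted {w : ℝ × ℝ → ℝ} {g : ℝ × ℝ → ℝ × ℝ} {p : ℝ → ℝ}
    (h : GreenOn upper (0, -1) w g p) (σ : ℝ) {η : ℝ → ℝ} (hη : ContDiff ℝ ∞ η)
    (hc : HasCompactSupport η) :
    Integrable (fun x : ℝ × ℝ => (w x * deriv vcut x.2 + dot (g x) (σ, 1) * vcut x.2) *
      η (x.1 - σ * x.2)) (volume.restrict upper) ∧
    ∫ x in upper, (w x * deriv vcut x.2 + dot (g x) (σ, 1) * vcut x.2) * η (x.1 - σ * x.2)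
      = -∫ t, p t * η t := by
  have hK : IsCompact ((fun z : ℝ × ℝ => (z.1 + σ * z.2, z.2)) '' (tsupport η ×ˢ tsupport vcut)) :=
    (hc.isCompact.prod vcut.hasCompactSupport.isCompact).image (by fun_prop)
  have htest : ∀ ρ : ℝ → ℝ, ContDiff ℝ ∞ ρ → tsupport ρ ⊆ tsupport vcut →
      IsTestOn univ (fun x : ℝ × ℝ => ρ x.2 * η (x.1 - σ * x.2)) := by
    intro ρ hρ hs
    refine ⟨(hρ.comp contDiff_snd).mul (hη.comp (by fun_prop)), ?_, subset_univ _⟩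
    refine HasCompactSupport.intro hK fun x hx => ?_
    by_contra hne
    refine hx ⟨(x.1 - σ * x.2, x.2), ⟨?_, ?_⟩, by ext <;> simp⟩
    · exact subset_tsupport η (right_ne_zero_of_mul hne)
    · exact hs (subset_tsupport ρ (left_ne_zero_of_mul hne))
  have hφ := htest vcut contDiff_vcut subset_rfl
  have hφ' := htest (deriv vcut) (contDiff_infty_iff_deriv.1 contDiff_vcut).2
    tsupport_deriv_subset
  -- The factor η(x₁ - σ x₂) is constant in the direction (σ, 1), so only the vertical cutoff is
  -- differentiated.
  have hfd : ∀ x : ℝ × ℝ, fderiv ℝ (fun x : ℝ × ℝ => vcut x.2 * η (x.1 - σ * x.2)) x (σ, 1)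
      = deriv vcut x.2 * η (x.1 - σ * x.2) := by
    intro x
    have h1 : HasFDerivAt (fun x : ℝ × ℝ => vcut x.2)
        (deriv vcut x.2 • ContinuousLinearMap.snd ℝ ℝ ℝ) x :=
      ((contDiff_vcut.differentiable (by simp)).differentiableAt.hasDerivAt.comp_hasFDerivAt x
        hasFDerivAt_snd)
    have h2 : HasFDerivAt (fun x : ℝ × ℝ => η (x.1 - σ * x.2))
        (deriv η (x.1 - σ * x.2) •
          (ContinuousLinearMap.fst ℝ ℝ ℝ - σ • ContinuousLinearMap.snd ℝ ℝ ℝ)) x :=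
      ((hη.differentiable (by simp)).differentiableAt.hasDerivAt.comp_hasFDerivAt x
        (hasFDerivAt_fst.sub (hasFDerivAt_snd.const_mul σ)))
    rw [(h1.fun_mul h2).fderiv]
    simp
    ring
  have hgreen := h.green _ hφ (σ, 1)
  simp only [hfd] at hgreen
  have i1 := locallyIntegrable_mul_test h.fn hφ'
  have i2 := locallyIntegrable_mul_test (locallyIntegrable_dot h.grad (σ, 1)) hφ
  have heq : (fun x : ℝ × ℝ => (w x * deriv vcut x.2 + dot (g x) (σ, 1) * vcut x.2) *
      η (x.1 - σ * x.2)) = fun x => w x * (deriv vcut x.2 * η (x.1 - σ * x.2)) +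
        dot (g x) (σ, 1) * (vcut x.2 * η (x.1 - σ * x.2)) := by ext; ring
  rw [heq]
  refine ⟨i1.add i2, ?_⟩
  rw [integral_add i1 i2, hgreen]
  simp [dot, vcut_zero]

/-- The shear `(t, y) ↦ (t + σ y, y)`. -/
def shear (σ : ℝ) : (ℝ × ℝ) ≃ₜ (ℝ × ℝ) where
  toFun x := (x.1 + σ * x.2, x.2)
  invFun x := (x.1 - σ * x.2, x.2)
  left_inv x := by simp
  right_inv x := by simp
  continuous_toFun := by fun_prop
  continuous_invFun := by fun_prop

theorem shear_apply (σ : ℝ) (x : ℝ × ℝ) : shear σ x = (x.1 + σ * x.2, x.2) := rfl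

theorem measurePreserving_shear (σ : ℝ) :
    MeasurePreserving (shear σ) (volume.restrict upper) (volume.restrict upper) := by
  have h1 : MeasurePreserving (fun x : ℝ × ℝ => (x.1, x.2 + σ * x.1))
      ((volume : Measure ℝ).prod (volume : Measure ℝ)) (volume.prod volume) :=
    (MeasurePreserving.id volume).skew_product (g := fun y t => t + σ * y) (by fun_prop)
      (Eventually.of_forall fun y => (measurePreserving_add_right volume (σ * y)).map_eq)
  have h2 : MeasurePreserving (shear σ) (volume : Measure (ℝ × ℝ)) volume :=
    (Measure.measurePreserving_swap.comp h1).comp Measure.measurePreserving_swap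
  have h3 := h2.restrict_preimage isOpen_upper.measurableSet
  have h4 : shear σ ⁻¹' upper = upper := by ext; simp [upper, shear_apply]
  rwa [h4] at h3

/-- A shear makes the lines of direction (σ, 1) vertical. Testing with η(t) then shows that -p(t) is
the integral of the sheared integrand over the vertical ray above t, for almost every t; absolute
values and the factor f(t) can be put under that integral. -/
theorem GreenOn.lintegral_trace_le {w : ℝ × ℝ → ℝ} {g : ℝ × ℝ → ℝ × ℝ} {p : ℝ → ℝ}
    (h : GreenOn upper (0, -1) w g p) (σ : ℝ) {f : ℝ → ENNReal} (hf : Measurable f) :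
    ∫⁻ t, ‖p t‖ₑ * f t ≤ ∫⁻ x in upper,
      ‖w x * deriv vcut x.2 + dot (g x) (σ, 1) * vcut x.2‖ₑ * f (x.1 - σ * x.2) := by
  set K : ℝ × ℝ → ℝ := fun x => w x * deriv vcut x.2 + dot (g x) (σ, 1) * vcut x.2 with hKdef
  have hKm : AEStronglyMeasurable K (volume.restrict upper) := by
    have h1 := h.fn.aestronglyMeasurable
    have h2 := (locallyIntegrable_dot h.grad (σ, 1)).aestronglyMeasurable
    have h3 : AEStronglyMeasurable (fun x : ℝ × ℝ => deriv vcut x.2) (volume.restrict upper) :=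
      (continuous_deriv_vcut.comp continuous_snd).aestronglyMeasurable
    have h4 : AEStronglyMeasurable (fun x : ℝ × ℝ => vcut x.2) (volume.restrict upper) :=
      (vcut.continuous.comp continuous_snd).aestronglyMeasurable
    exact (h1.mul h3).add (h2.mul h4)
  set J : ℝ × ℝ → ℝ := fun x => K (shear σ x) with hJ
  have hS := measurePreserving_shear σ
  have hSe : MeasurableEmbedding (shear σ) := (shear σ).measurableEmbedding
  have hJm : AEStronglyMeasurable J (volume.prod (volume.restrict (Ioi 0))) := by
    rw [← restrict_upper]
    exact hKm.comp_measurePreserving hS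
  have fact : ∀ η : ℝ → ℝ, ContDiff ℝ ∞ η → HasCompactSupport η →
      Integrable (fun x : ℝ × ℝ => J x * η x.1) (volume.prod (volume.restrict (Ioi 0))) ∧
      ∫ x, J x * η x.1 ∂(volume.prod (volume.restrict (Ioi 0))) = -∫ t, p t * η t := by
    intro η hη hc
    obtain ⟨i, e⟩ := h.slanted σ hη hc
    rw [← restrict_upper]
    have hcomp : (fun x : ℝ × ℝ => J x * η x.1)
        = (fun x : ℝ × ℝ => K x * η (x.1 - σ * x.2)) ∘ shear σ := by
      ext x; simp [hJ, shear_apply]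
    rw [hcomp]
    refine ⟨(hS.integrable_comp_emb hSe).2 i, ?_⟩
    rw [← e]
    exact hS.integral_comp hSe (fun x : ℝ × ℝ => K x * η (x.1 - σ * x.2))
  set P : ℝ → ℝ := fun t => ∫ y in Ioi (0 : ℝ), J (t, y) with hP
  have hPη : ∀ η : ℝ → ℝ, ContDiff ℝ ∞ η → HasCompactSupport η →
      Integrable (fun t => P t * η t) ∧ ∫ t, P t * η t = -∫ t, p t * η t := by
    intro η hη hc
    obtain ⟨i, e⟩ := fact η hη hc
    have h1 : ∀ t, ∫ y in Ioi (0 : ℝ), J (t, y) * η t = P t * η t := fun t =>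
      integral_mul_const _ _
    constructor
    · have := i.integral_prod_left
      simpa only [h1] using this
    · rw [← e, integral_prod _ i]
      simp only [h1]
  -- Integrability of P η is known for every test function η; a bump equal to 1 on a ball gives it
  -- for P on that ball.
  have hPl : LocallyIntegrable P := by
    intro t
    let b : ContDiffBump t := ⟨1, 2, by norm_num, by norm_num⟩
    have hb := (hPη b b.contDiff b.hasCompactSupport).1
    refine ⟨Metric.ball t 1, Metric.ball_mem_nhds t one_pos, ?_⟩
    refine (hb.integrableOn (s := Metric.ball t 1)).congr_fun (fun s hs => ?_)
      Metric.isOpen_ball.measurableSet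
    have : b s = 1 := b.one_of_mem_closedBall (Metric.ball_subset_closedBall hs)
    simp [this]
  have hae : ∀ᵐ t, P t + p t = 0 := by
    refine ae_eq_zero_of_integral_contDiff_smul_eq_zero (hPl.add h.trace) fun η hη hc => ?_
    obtain ⟨i, e⟩ := hPη η hη hc
    have : ∫ t, (P t * η t + p t * η t) = 0 := by
      rw [integral_add i (locallyIntegrable_mul_axis h.trace hη.continuous hc), e]
      ring
    rw [← this]
    refine integral_congr_ae (Eventually.of_forall fun t => ?_)
    simp only [smul_eq_mul]
    ring
  calc ∫⁻ t, ‖p t‖ₑ * f t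
      ≤ ∫⁻ t, ∫⁻ y in Ioi (0 : ℝ), ‖J (t, y)‖ₑ * f t := by
        refine lintegral_mono_ae ?_
        have hJt : ∀ᵐ t, AEStronglyMeasurable (fun y => J (t, y)) (volume.restrict (Ioi 0)) :=
          hJm.prodMk_left
        filter_upwards [hae, hJt] with t ht hm
        rw [lintegral_mul_const'' _ hm.enorm]
        gcongr
        rw [show p t = -P t by linarith, enorm_neg]
        exact enorm_integral_le_lintegral_enorm _
    _ = ∫⁻ x, ‖J x‖ₑ * f x.1 ∂(volume.prod (volume.restrict (Ioi 0))) := by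
        rw [lintegral_prod (fun x : ℝ × ℝ => ‖J x‖ₑ * f x.1)
          (hJm.enorm.mul (hf.comp measurable_fst).aemeasurable)]
    _ = ∫⁻ x in upper, ‖K x‖ₑ * f (x.1 - σ * x.2) := by
        rw [← restrict_upper,
          ← hS.lintegral_comp_emb hSe (fun x => ‖K x‖ₑ * f (x.1 - σ * x.2))]
        refine lintegral_congr fun x => ?_
        simp [hJ, shear_apply]

/-- The estimate along lines holds for every slope in (0, 1), and its left side does not depend on
the slope. Integrating over this interval of length one and exchanging the integrals turns the
weight into its fan average. -/
theorem GreenOn.lintegral_trace_weight_le {w : ℝ × ℝ → ℝ} {g : ℝ × ℝ → ℝ × ℝ} {p : ℝ → ℝ}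
    (h : GreenOn upper (0, -1) w g p) (t₀ : ℝ) :
    ∫⁻ t, ‖p t‖ₑ * weight (t - t₀) ≤ ∫⁻ x in upper,
      (‖w x‖ₑ * ‖deriv vcut x.2‖ₑ + 2 * ‖g x‖ₑ * ‖vcut x.2‖ₑ) * fanWeight t₀ x := by
  have hW : Measurable fun t => weight (t - t₀) := measurable_weight.comp (by fun_prop)
  have hKm : AEMeasurable (fun x : ℝ × ℝ => ‖w x‖ₑ * ‖deriv vcut x.2‖ₑ +
      2 * ‖g x‖ₑ * ‖vcut x.2‖ₑ) (volume.restrict upper) := by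
    have h1 := h.fn.aestronglyMeasurable.enorm
    have h2 := h.grad.aestronglyMeasurable.enorm
    have h3 : Measurable (fun x : ℝ × ℝ => ‖deriv vcut x.2‖ₑ) :=
      (continuous_deriv_vcut.comp continuous_snd).enorm.measurable
    have h4 : Measurable (fun x : ℝ × ℝ => ‖vcut x.2‖ₑ) :=
      (vcut.continuous.comp continuous_snd).enorm.measurable
    exact (h1.mul h3.aemeasurable).add ((h2.const_mul 2).mul h4.aemeasurable)
  have step : ∀ σ ∈ Ioo (0 : ℝ) 1, ∫⁻ t, ‖p t‖ₑ * weight (t - t₀) ≤ ∫⁻ x in upper,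
      (‖w x‖ₑ * ‖deriv vcut x.2‖ₑ + 2 * ‖g x‖ₑ * ‖vcut x.2‖ₑ) *
        weight (x.1 - σ * x.2 - t₀) := by
    intro σ hσ
    refine (h.lintegral_trace_le σ hW).trans (lintegral_mono fun x => ?_)
    gcongr
    refine (enorm_add_le _ _).trans ?_
    rw [enorm_mul, enorm_mul]
    gcongr
    rw [← ofReal_norm, ← ofReal_norm,
      show (2 : ENNReal) = ENNReal.ofReal 2 by simp,
      ← ENNReal.ofReal_mul (by norm_num)]
    refine ENNReal.ofReal_le_ofReal ((abs_dot_le _ _).trans ?_)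
    have : ‖((σ, 1) : ℝ × ℝ)‖ ≤ 1 := by
      rw [Prod.norm_def]
      simp only [Real.norm_eq_abs, abs_one, sup_le_iff, le_refl, and_true]
      rw [abs_of_pos hσ.1]; exact hσ.2.le
    nlinarith [norm_nonneg (g x), norm_nonneg ((σ, 1) : ℝ × ℝ)]
  calc ∫⁻ t, ‖p t‖ₑ * weight (t - t₀)
      = ∫⁻ σ in Ioo (0 : ℝ) 1, ∫⁻ t, ‖p t‖ₑ * weight (t - t₀) := by simp
    _ ≤ ∫⁻ σ in Ioo (0 : ℝ) 1, ∫⁻ x in upper,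
      (‖w x‖ₑ * ‖deriv vcut x.2‖ₑ + 2 * ‖g x‖ₑ * ‖vcut x.2‖ₑ) *
        weight (x.1 - σ * x.2 - t₀) := setLIntegral_mono' measurableSet_Ioo step
    _ = _ := by
      rw [lintegral_lintegral_swap]
      · refine lintegral_congr fun x => ?_
        rw [lintegral_const_mul]
        · rfl
        · exact measurable_weight.comp (by fun_prop)
      · refine AEMeasurable.mul ?_ (measurable_weight.comp (by fun_prop)).aemeasurable
        exact hKm.comp_snd

/-- The term with w lives only at heights between 1 and 2, on a bounded set where the fan average is
bounded, so local integrability suffices. The term with g is handled by ab ≤ a² + b², since g and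
the fan average are both square integrable on the strip. -/
theorem GreenOn.lintegral_trace_weight_lt_top {w : ℝ × ℝ → ℝ} {g : ℝ × ℝ → ℝ × ℝ} {p : ℝ → ℝ}
    (h : GreenOn upper (0, -1) w g p) (hg : MemLp g 2 (volume.restrict upper)) (t₀ : ℝ) :
    ∫⁻ t, ‖p t‖ₑ * weight (t - t₀) < ⊤ := by
  set c := ∫⁻ s, weight s with hc
  have hcf : c < ⊤ := lintegral_weight_lt_top
  obtain ⟨C, hC⟩ := exists_deriv_vcut_bound
  -- The weight forces |x₁ - σ x₂ - t₀| ≤ 1, and 0 ≤ σ x₂ ≤ 2; hence the half-width 3.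
  set box : Set (ℝ × ℝ) := Icc (t₀ - 3) (t₀ + 3) ×ˢ Icc 1 2 with hbox
  have hfan : ∀ x ∈ upper, deriv vcut x.2 ≠ 0 → fanWeight t₀ x ≠ 0 → x ∈ box := by
    intro x hx hd hf
    have h1 : 1 ≤ |x.2| := not_lt.1 fun hlt => hd (deriv_vcut_eq_zero hlt)
    have h2 : |x.2| ≤ 2 := not_lt.1 fun hlt => hd (deriv_vcut_eq_zero' hlt)
    rw [abs_of_pos hx] at h1 h2
    obtain ⟨σ, hσ, hne⟩ : ∃ σ ∈ Ioo (0 : ℝ) 1, weight (x.1 - σ * x.2 - t₀) ≠ 0 := by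
      by_contra hcon
      push Not at hcon
      exact hf (by rw [fanWeight, setLIntegral_congr_fun measurableSet_Ioo hcon]; simp)
    have hm : x.1 - σ * x.2 - t₀ ∈ Icc (-1 : ℝ) 1 := by
      by_contra hn
      exact hne (indicator_of_notMem hn _)
    have h3 : 0 ≤ σ * x.2 := by nlinarith [hσ.1]
    have h4 : σ * x.2 ≤ 2 := by nlinarith [hσ.1, hσ.2]
    exact ⟨⟨by linarith [hm.1], by linarith [hm.2]⟩, h1, h2⟩
  have hle1 : ∀ x ∈ upper, ‖w x‖ₑ * ‖deriv vcut x.2‖ₑ * fanWeight t₀ x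
      ≤ box.indicator (fun x => ‖w x‖ₑ * (ENNReal.ofReal C * (1 + c))) x := by
    intro x hx
    by_cases h0 : deriv vcut x.2 = 0
    · simp [h0]
    by_cases h1 : fanWeight t₀ x = 0
    · simp [h1]
    have hxb := hfan x hx h0 h1
    rw [indicator_of_mem hxb, mul_assoc]
    gcongr
    · rw [← ofReal_norm]
      exact ENNReal.ofReal_le_ofReal (hC _)
    · refine (fanWeight_le hx).trans ?_
      refine mul_le_of_le_one_left zero_le ?_
      rw [ENNReal.ofReal_le_one]
      exact Real.rpow_le_one_of_one_le_of_nonpos hxb.2.1 (by norm_num)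
  have hsq : ∀ a b : ENNReal, a * b ≤ a * a + b * b := by
    intro a b
    rcases le_total a b with hab | hab
    · exact (mul_le_mul_left hab b).trans le_add_self
    · exact (mul_le_mul_right hab a).trans le_self_add
  have hle2 : ∀ x ∈ upper, 2 * ‖g x‖ₑ * ‖vcut x.2‖ₑ * fanWeight t₀ x
      ≤ 2 * (‖g x‖ₑ * ‖g x‖ₑ) +
        2 * {x : ℝ × ℝ | x.2 ≤ 2}.indicator (fun x => fanWeight t₀ x * fanWeight t₀ x) x := by
    intro x hx
    by_cases h2 : x.2 ≤ 2
    · rw [indicator_of_mem (show x ∈ {x : ℝ × ℝ | x.2 ≤ 2} from h2), ← mul_add]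
      have : ‖vcut x.2‖ₑ ≤ 1 := by
        rw [← ofReal_norm, ENNReal.ofReal_le_one, Real.norm_of_nonneg vcut.nonneg]
        exact vcut.le_one
      calc 2 * ‖g x‖ₑ * ‖vcut x.2‖ₑ * fanWeight t₀ x
          ≤ 2 * ‖g x‖ₑ * 1 * fanWeight t₀ x := by gcongr
        _ = 2 * (‖g x‖ₑ * fanWeight t₀ x) := by ring
        _ ≤ _ := by gcongr; exact hsq _ _
    · rw [vcut_eq_zero (by rw [abs_of_pos hx]; exact (not_le.1 h2).le)]
      simp
  have hgl : ∫⁻ x in upper, ‖g x‖ₑ * ‖g x‖ₑ < ⊤ := by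
    have := lintegral_rpow_enorm_lt_top_of_eLpNorm_lt_top (p := 2) (by simp) (by simp) hg.2
    simpa [pow_two] using this
  refine (h.lintegral_trace_weight_le t₀).trans_lt ?_
  have hm1 : AEMeasurable (fun x => ‖w x‖ₑ) (volume.restrict upper) :=
    h.fn.aestronglyMeasurable.enorm
  have hboxm : MeasurableSet box := measurableSet_Icc.prod measurableSet_Icc
  have hhalf : MeasurableSet {x : ℝ × ℝ | x.2 ≤ 2} :=
    (isClosed_le continuous_snd continuous_const).measurableSet
  calc ∫⁻ x in upper, (‖w x‖ₑ * ‖deriv vcut x.2‖ₑ + 2 * ‖g x‖ₑ * ‖vcut x.2‖ₑ) * fanWeight t₀ x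
      ≤ ∫⁻ x in upper, (box.indicator (fun x => ‖w x‖ₑ * (ENNReal.ofReal C * (1 + c))) x +
        (2 * (‖g x‖ₑ * ‖g x‖ₑ) +
        2 * {x : ℝ × ℝ | x.2 ≤ 2}.indicator (fun x => fanWeight t₀ x * fanWeight t₀ x) x)) := by
        refine setLIntegral_mono' isOpen_upper.measurableSet fun x hx => ?_
        rw [add_mul]
        exact add_le_add (hle1 x hx) (hle2 x hx)
    _ < ⊤ := by
        have hms := (measurable_fanWeight t₀).mul (measurable_fanWeight t₀)
        rw [lintegral_add_right', lintegral_add_right']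
        · refine ENNReal.add_lt_top.2 ⟨?_, ENNReal.add_lt_top.2 ⟨?_, ?_⟩⟩
          · rw [lintegral_indicator hboxm, lintegral_mul_const'' _ hm1.restrict]
            refine ENNReal.mul_lt_top ?_ (ENNReal.mul_lt_top ENNReal.ofReal_lt_top
              (ENNReal.add_lt_top.2 ⟨ENNReal.one_lt_top, hcf⟩))
            exact (h.fn.integrableOn_isCompact (isCompact_Icc.prod isCompact_Icc)).2
          · rw [lintegral_const_mul' _ _ (by simp)]
            exact ENNReal.mul_lt_top (by simp) hgl
          · rw [lintegral_const_mul' _ _ (by simp), lintegral_indicator hhalf,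
              Measure.restrict_restrict hhalf, inter_comm]
            exact ENNReal.mul_lt_top (by simp) (lintegral_fanWeight_sq_lt_top t₀ 2)
        · exact ((hms.indicator hhalf).const_mul 2).aemeasurable
        · refine AEMeasurable.add ?_ ((hms.indicator hhalf).const_mul 2).aemeasurable
          have := h.grad.aestronglyMeasurable.enorm
          exact (this.mul this).const_mul 2

/-! ### The principal square root -/

/-- The principal complex square root. -/
noncomputable def csqrt (z : ℂ) : ℂ := z ^ (2⁻¹ : ℂ)

theorem csqrt_sq (z : ℂ) : csqrt z ^ 2 = z := by
  simp [csqrt]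

theorem csqrt_mul_self (z : ℂ) : csqrt z * csqrt z = z := by rw [← pow_two, csqrt_sq]

theorem csqrt_zero : csqrt 0 = 0 := by simp [csqrt]

theorem csqrt_ne_zero {z : ℂ} (hz : z ≠ 0) : csqrt z ≠ 0 := fun h => hz (by
  rw [← csqrt_sq z, h]; simp)

theorem norm_csqrt_sq (z : ℂ) : ‖csqrt z‖ ^ 2 = ‖z‖ := by rw [← norm_pow, csqrt_sq]

theorem norm_csqrt (z : ℂ) : ‖csqrt z‖ = √‖z‖ := by
  rw [← norm_csqrt_sq z, Real.sqrt_sq (norm_nonneg _)]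

theorem csqrt_eq_exp {z : ℂ} (hz : z ≠ 0) : csqrt z = Complex.exp (Complex.log z * 2⁻¹) := by
  rw [csqrt, Complex.cpow_def_of_ne_zero hz]

theorem csqrt_re {z : ℂ} (hz : z ≠ 0) :
    (csqrt z).re = Real.exp (Real.log ‖z‖ / 2) * Real.cos (z.arg / 2) := by
  rw [csqrt_eq_exp hz, Complex.exp_re]
  congr 2 <;> simp [Complex.log_re, Complex.log_im, div_eq_mul_inv]

theorem csqrt_im {z : ℂ} (hz : z ≠ 0) :
    (csqrt z).im = Real.exp (Real.log ‖z‖ / 2) * Real.sin (z.arg / 2) := by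
  rw [csqrt_eq_exp hz, Complex.exp_im]
  congr 2 <;> simp [Complex.log_re, Complex.log_im, div_eq_mul_inv]

theorem csqrt_re_nonneg (z : ℂ) : 0 ≤ (csqrt z).re := by
  rcases eq_or_ne z 0 with rfl | hz
  · simp [csqrt_zero]
  rw [csqrt_re hz]
  have h1 := Complex.neg_pi_lt_arg z
  have h2 := Complex.arg_le_pi z
  exact mul_nonneg (Real.exp_pos _).le (Real.cos_nonneg_of_mem_Icc ⟨by linarith, by linarith⟩)

theorem csqrt_im_nonneg {z : ℂ} (h : 0 ≤ z.im) : 0 ≤ (csqrt z).im := by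
  rcases eq_or_ne z 0 with rfl | hz
  · simp [csqrt_zero]
  rw [csqrt_im hz]
  have h1 := Complex.arg_nonneg_iff.2 h
  have h2 := Complex.arg_le_pi z
  exact mul_nonneg (Real.exp_pos _).le
    (Real.sin_nonneg_of_nonneg_of_le_pi (by linarith) (by linarith))

theorem csqrt_im_nonpos {z : ℂ} (h : z.im < 0) : (csqrt z).im ≤ 0 := by
  have hz : z ≠ 0 := by rintro rfl; simp at h
  rw [csqrt_im hz]
  have h1 := Complex.arg_neg_iff.2 h
  have h2 := Complex.neg_pi_lt_arg z
  exact mul_nonpos_of_nonneg_of_nonpos (Real.exp_pos _).le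
    (Real.sin_nonpos_of_nonpos_of_neg_pi_le (by linarith) (by linarith))

theorem csqrt_ofReal_nonneg {t : ℝ} (ht : 0 ≤ t) : csqrt t = (√t : ℝ) := by
  have h := csqrt_sq (t : ℂ)
  have h1 := csqrt_re_nonneg (t : ℂ)
  have hre := congrArg Complex.re h
  have him := congrArg Complex.im h
  simp only [pow_two, Complex.mul_re, Complex.mul_im, Complex.ofReal_re, Complex.ofReal_im]
    at hre him
  have hb : (csqrt t).im = 0 := by
    by_contra hb
    have : (csqrt t).re = 0 := by
      have : (csqrt t).re * (csqrt t).im = 0 := by linarith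
      exact (mul_eq_zero.1 this).resolve_right hb
    have : 0 < (csqrt t).im * (csqrt t).im := mul_self_pos.2 hb
    nlinarith
  apply Complex.ext
  · rw [Complex.ofReal_re, eq_comm, Real.sqrt_eq_iff_mul_self_eq ht h1]
    rw [hb] at hre; linarith
  · simp [hb]

theorem csqrt_ofReal_nonpos {t : ℝ} (ht : t ≤ 0) : csqrt t = (√(-t) : ℝ) * Complex.I := by
  have h := csqrt_sq (t : ℂ)
  have h1 : 0 ≤ (csqrt (t : ℂ)).im := csqrt_im_nonneg (by simp)
  have hre := congrArg Complex.re h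
  have him := congrArg Complex.im h
  simp only [pow_two, Complex.mul_re, Complex.mul_im, Complex.ofReal_re, Complex.ofReal_im]
    at hre him
  have hb : (csqrt t).re = 0 := by
    by_contra hb
    have : (csqrt t).im = 0 := by
      have : (csqrt t).re * (csqrt t).im = 0 := by linarith
      exact (mul_eq_zero.1 this).resolve_left hb
    have : 0 < (csqrt t).re * (csqrt t).re := mul_self_pos.2 hb
    nlinarith
  have him : (csqrt t).im = √(-t) := by
    rw [eq_comm, Real.sqrt_eq_iff_mul_self_eq (by linarith) h1]
    rw [hb] at hre; linarith
  apply Complex.ext <;> simp [hb, him]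

theorem hasDerivAt_csqrt {z : ℂ} (hz : z ∈ Complex.slitPlane) :
    HasDerivAt csqrt (1 / (2 * csqrt z)) z := by
  have h := (hasDerivAt_id z).cpow_const (c := 2⁻¹) hz
  have hz0 := Complex.slitPlane_ne_zero hz
  refine (h.congr_deriv ?_)
  have h0 := csqrt_ne_zero hz0
  rw [id, mul_one, Complex.cpow_sub _ _ hz0, Complex.cpow_one, ← csqrt]
  nth_rw 2 [← csqrt_mul_self z]
  field_simp

theorem csqrt_conj {z : ℂ} (hz : z ∈ Complex.slitPlane) :
    csqrt (starRingEnd ℂ z) = starRingEnd ℂ (csqrt z) := by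
  have h := Complex.conj_cpow z (2⁻¹ : ℂ) (Complex.slitPlane_arg_ne_pi hz)
  simpa [csqrt, map_ofNat] using h

/-- The closed upper half-plane in `ℂ`. -/
def closedUpper : Set ℂ := {z | 0 ≤ z.im}

/-- The argument π on the cut belongs to the upper side, so the principal root is continuous up to
the axis from above but not from below. The lower half-plane is therefore always treated by
conjugation. -/
theorem continuousOn_csqrt : ContinuousOn csqrt closedUpper := by
  intro z hz
  rcases eq_or_ne z 0 with rfl | h0
  · refine ContinuousAt.continuousWithinAt ?_
    rw [ContinuousAt, csqrt_zero, tendsto_zero_iff_norm_tendsto_zero]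
    simp only [norm_csqrt]
    have : Continuous fun z : ℂ => √‖z‖ := by fun_prop
    simpa using this.tendsto 0
  by_cases hs : z ∈ Complex.slitPlane
  · exact (hasDerivAt_csqrt hs).continuousAt.continuousWithinAt
  · rw [Complex.mem_slitPlane_iff, not_or, not_lt, not_not] at hs
    have hre : z.re < 0 := lt_of_le_of_ne hs.1 fun h => h0 (Complex.ext h hs.2)
    have h1 := Complex.continuousWithinAt_log_of_re_neg_of_im_zero hre hs.2
    have h2 : ContinuousWithinAt (fun z => Complex.exp (Complex.log z * 2⁻¹)) closedUpper z :=
      (h1.mul continuousWithinAt_const).cexp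
    refine h2.congr_of_eventuallyEq ?_ (csqrt_eq_exp h0)
    filter_upwards [mem_nhdsWithin_of_mem_nhds (isOpen_ne.mem_nhds h0)] with y hy
    exact csqrt_eq_exp hy

/-! ### The conformal map `E = √z - √(z-1)` -/

/-- `√z - √(z - 1)`. -/
noncomputable def jk (z : ℂ) : ℂ := csqrt z - csqrt (z - 1)

/-- The derivative of `jk`. -/
noncomputable def djk (z : ℂ) : ℂ := -jk z / (2 * csqrt z * csqrt (z - 1))

theorem jk_mul (z : ℂ) : jk z * (csqrt z + csqrt (z - 1)) = 1 := by
  have h1 := csqrt_mul_self z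
  have h2 := csqrt_mul_self (z - 1)
  unfold jk
  linear_combination h1 - h2

theorem jk_ne_zero (z : ℂ) : jk z ≠ 0 := left_ne_zero_of_mul (by rw [jk_mul]; exact one_ne_zero)

theorem jk_inv (z : ℂ) : (jk z)⁻¹ = csqrt z + csqrt (z - 1) :=
  inv_eq_of_mul_eq_one_right (jk_mul z)

theorem jk_add_inv (z : ℂ) : (jk z + (jk z)⁻¹) / 2 = csqrt z := by
  rw [jk_inv, jk]; ring

/-- The roots of z and z - 1 lie in the same closed quadrant, so their scalar product is nonnegative
and |√z + √(z-1)|² ≥ |z| + |z-1|. The product of `jk` with this sum is 1. -/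
theorem norm_jk_sq_mul_le (z : ℂ) : ‖jk z‖ ^ 2 * (‖z‖ + ‖z - 1‖) ≤ 1 := by
  have h : ‖z‖ + ‖z - 1‖ ≤ ‖csqrt z + csqrt (z - 1)‖ ^ 2 := by
    rw [← norm_csqrt_sq z, ← norm_csqrt_sq (z - 1)]
    simp only [← Complex.normSq_eq_norm_sq, Complex.normSq_apply, Complex.add_re, Complex.add_im]
    have h1 := mul_nonneg (csqrt_re_nonneg z) (csqrt_re_nonneg (z - 1))
    have h2 : 0 ≤ (csqrt z).im * (csqrt (z - 1)).im := by
      rcases le_or_gt 0 z.im with hz | hz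
      · exact mul_nonneg (csqrt_im_nonneg hz) (csqrt_im_nonneg (by simpa using hz))
      · exact mul_nonneg_of_nonpos_of_nonpos (csqrt_im_nonpos hz)
          (csqrt_im_nonpos (by simpa using hz))
    nlinarith
  calc ‖jk z‖ ^ 2 * (‖z‖ + ‖z - 1‖) ≤ ‖jk z‖ ^ 2 * ‖csqrt z + csqrt (z - 1)‖ ^ 2 := by gcongr
    _ = 1 := by rw [← mul_pow, ← norm_mul, jk_mul]; simp

theorem one_le_norm_add (z : ℂ) : 1 ≤ ‖z‖ + ‖z - 1‖ := by
  calc (1 : ℝ) = ‖z - (z - 1)‖ := by simp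
    _ ≤ _ := norm_sub_le _ _

theorem norm_jk_le_one (z : ℂ) : ‖jk z‖ ≤ 1 := by
  have h1 := norm_jk_sq_mul_le z
  have h2 := one_le_norm_add z
  have h3 : ‖jk z‖ ^ 2 ≤ 1 := by nlinarith [sq_nonneg ‖jk z‖]
  nlinarith [norm_nonneg (jk z)]

theorem mem_slitPlane_of_sub_one {z : ℂ} (hz : z - 1 ∈ Complex.slitPlane) :
    z ∈ Complex.slitPlane := by
  rw [Complex.mem_slitPlane_iff] at *
  simp only [Complex.sub_re, Complex.one_re, Complex.sub_im, Complex.one_im, sub_zero] at hz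
  rcases hz with h | h
  · left; linarith
  · right; exact h

theorem hasDerivAt_jk {z : ℂ} (hz : z - 1 ∈ Complex.slitPlane) : HasDerivAt jk (djk z) z := by
  have hz' := mem_slitPlane_of_sub_one hz
  have h1 := hasDerivAt_csqrt hz'
  have h2 : HasDerivAt (fun z => csqrt (z - 1)) (1 / (2 * csqrt (z - 1))) z :=
    HasDerivAt.comp_sub_const z 1 (hasDerivAt_csqrt hz)
  refine (h1.sub h2).congr_deriv ?_
  have h3 := csqrt_ne_zero (Complex.slitPlane_ne_zero hz)
  have h4 := csqrt_ne_zero (Complex.slitPlane_ne_zero hz')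
  rw [djk, jk]
  field_simp
  ring

theorem jk_conj {z : ℂ} (hz : z - 1 ∈ Complex.slitPlane) :
    jk (starRingEnd ℂ z) = starRingEnd ℂ (jk z) := by
  have h2 := csqrt_conj hz
  rw [map_sub, map_one] at h2
  rw [jk, jk, csqrt_conj (mem_slitPlane_of_sub_one hz), h2, map_sub]

theorem djk_conj {z : ℂ} (hz : z - 1 ∈ Complex.slitPlane) :
    djk (starRingEnd ℂ z) = starRingEnd ℂ (djk z) := by
  have h2 := csqrt_conj hz
  rw [map_sub, map_one] at h2
  rw [djk, djk, csqrt_conj (mem_slitPlane_of_sub_one hz), h2, jk_conj hz]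
  simp [map_ofNat]

theorem continuousOn_csqrt_sub : ContinuousOn (fun z => csqrt (z - 1)) closedUpper :=
  continuousOn_csqrt.comp (by fun_prop) fun z hz => by simpa [closedUpper] using hz

theorem continuousOn_jk : ContinuousOn jk closedUpper :=
  continuousOn_csqrt.sub continuousOn_csqrt_sub

theorem continuousOn_djk : ContinuousOn djk (closedUpper ∩ {z | z ≠ 0 ∧ z ≠ 1}) := by
  refine ContinuousOn.div (continuousOn_jk.mono inter_subset_left).neg
    ((continuousOn_const.mul (continuousOn_csqrt.mono inter_subset_left)).mul
      (continuousOn_csqrt_sub.mono inter_subset_left)) fun z hz => ?_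
  exact mul_ne_zero (mul_ne_zero two_ne_zero (csqrt_ne_zero hz.2.1))
    (csqrt_ne_zero (sub_ne_zero.2 hz.2.2))

/-! ### The odd polynomial -/

/-- Coefficients of the polynomial `half`. -/
noncomputable def hcoef (m i : ℕ) : ℝ := ((2 * m + 1).choose (m - i) : ℝ) / 4 ^ m

/-- The odd polynomial `L` with `L(X) + L(1/X) = 2 ((X + 1/X)/2)^(2m+1)`. -/
noncomputable def half (m : ℕ) (X : ℂ) : ℂ :=
  ∑ i ∈ Finset.range (m + 1), (hcoef m i : ℂ) * X ^ (2 * i + 1)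

/-- The derivative of `half`. -/
noncomputable def dhalf (m : ℕ) (X : ℂ) : ℂ :=
  ∑ i ∈ Finset.range (m + 1), (hcoef m i : ℂ) * ((2 * i + 1 : ℕ) * X ^ (2 * i))

theorem hcoef_pos (m i : ℕ) : 0 < hcoef m i := by
  unfold hcoef
  have : 0 < (2 * m + 1).choose (m - i) := Nat.choose_pos (by omega)
  positivity

theorem hasDerivAt_half (m : ℕ) (X : ℂ) : HasDerivAt (half m) (dhalf m X) X := by
  unfold half dhalf
  refine HasDerivAt.fun_sum fun i _ => ?_
  exact (hasDerivAt_pow (2 * i + 1) X).const_mul _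

/-- Expand (X + 1/X)^(2m+1) by the binomial theorem and split the sum in the middle: one half
carries the positive odd powers, the other the negative ones, with the same coefficients by
symmetry. -/
theorem half_add_inv (m : ℕ) {X : ℂ} (hX : X ≠ 0) :
    half m X + half m X⁻¹ = 2 * ((X + X⁻¹) / 2) ^ (2 * m + 1) := by
  have h2 : (2 : ℂ) * ((X + X⁻¹) / 2) ^ (2 * m + 1) = (X + X⁻¹) ^ (2 * m + 1) / 4 ^ m := by
    rw [div_pow, pow_succ 2, pow_mul 2]; norm_num; field_simp
  rw [h2, add_pow, show 2 * m + 1 + 1 = (m + 1) + (m + 1) by ring, Finset.sum_range_add, add_div,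
    add_comm (half m X), half, half]
  congr 1
  · rw [← Finset.sum_range_reflect, Finset.sum_div]
    refine Finset.sum_congr rfl fun i hi => ?_
    have hi' : i ≤ m := Nat.lt_succ_iff.1 (Finset.mem_range.1 hi)
    rw [show m + 1 - 1 - i = m - i by omega, hcoef, show m - (m - i) = i by omega]
    have hp : X ^ i * X⁻¹ ^ (2 * m + 1 - i) = X⁻¹ ^ (2 * (m - i) + 1) := by
      rw [show 2 * m + 1 - i = i + (2 * (m - i) + 1) by omega, pow_add X⁻¹ i, ← mul_assoc,
        ← mul_pow, mul_inv_cancel₀ hX, one_pow, one_mul]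
    rw [hp]
    push_cast
    ring
  · rw [Finset.sum_div]
    refine Finset.sum_congr rfl fun i hi => ?_
    have hi' : i ≤ m := Nat.lt_succ_iff.1 (Finset.mem_range.1 hi)
    have hp : X ^ (m + 1 + i) * X⁻¹ ^ (m - i) = X ^ (2 * i + 1) := by
      rw [show m + 1 + i = (2 * i + 1) + (m - i) by omega, pow_add, mul_assoc, ← mul_pow,
        mul_inv_cancel₀ hX, one_pow, mul_one]
    rw [hcoef, ← Nat.choose_symm (show m + 1 + i ≤ 2 * m + 1 by omega),
      show 2 * m + 1 - (m + 1 + i) = m - i by omega, hp]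
    push_cast
    ring

/-- The derivative of `half_add_inv`, multiplied by X. -/
theorem dhalf_sub_inv (m : ℕ) {X : ℂ} (hX : X ≠ 0) :
    X * dhalf m X - X⁻¹ * dhalf m X⁻¹
      = (2 * m + 1 : ℕ) * ((X + X⁻¹) / 2) ^ (2 * m) * (X - X⁻¹) := by
  have h1 : HasDerivAt (fun X => half m X + half m X⁻¹)
      (dhalf m X + dhalf m X⁻¹ * (-(X ^ 2)⁻¹)) X :=
    (hasDerivAt_half m X).add ((hasDerivAt_half m X⁻¹).comp X (hasDerivAt_inv hX))
  have h2 : HasDerivAt (fun X : ℂ => 2 * ((X + X⁻¹) / 2) ^ (2 * m + 1))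
      (2 * ((2 * m + 1 : ℕ) * ((X + X⁻¹) / 2) ^ (2 * m) * ((1 + -(X ^ 2)⁻¹) / 2))) X :=
    ((((hasDerivAt_id X).add (hasDerivAt_inv hX)).div_const 2).pow (2 * m + 1)).const_mul 2
  have h3 : (fun X : ℂ => 2 * ((X + X⁻¹) / 2) ^ (2 * m + 1))
      =ᶠ[𝓝 X] fun X => half m X + half m X⁻¹ := by
    filter_upwards [isOpen_ne.mem_nhds hX] with Y hY
    exact (half_add_inv m hY).symm
  have h4 := h1.unique (h2.congr_of_eventuallyEq h3.symm)
  have h5 : X * (dhalf m X + dhalf m X⁻¹ * (-(X ^ 2)⁻¹))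
      = X * dhalf m X - X⁻¹ * dhalf m X⁻¹ := by
    field_simp
    ring
  rw [← h5, h4]
  field_simp
  ring

theorem half_conj (m : ℕ) (X : ℂ) : half m (starRingEnd ℂ X) = starRingEnd ℂ (half m X) := by
  simp [half]

theorem dhalf_conj (m : ℕ) (X : ℂ) : dhalf m (starRingEnd ℂ X) = starRingEnd ℂ (dhalf m X) := by
  simp [dhalf, map_ofNat]

theorem half_neg (m : ℕ) (X : ℂ) : half m (-X) = -half m X := by
  simp only [half, ← Finset.sum_neg_distrib]
  refine Finset.sum_congr rfl fun i _ => ?_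
  rw [Odd.neg_pow ⟨i, rfl⟩]; ring

theorem dhalf_neg (m : ℕ) (X : ℂ) : dhalf m (-X) = dhalf m X := by
  simp only [dhalf]
  refine Finset.sum_congr rfl fun i _ => ?_
  rw [Even.neg_pow ⟨i, by ring⟩]

/-- A common bound for `half` and its derivative on the unit disk. -/
noncomputable def hbound (m : ℕ) : ℝ := ∑ i ∈ Finset.range (m + 1), hcoef m i * (2 * i + 1 : ℕ)

theorem hbound_pos (m : ℕ) : 0 < hbound m := by
  refine Finset.sum_pos (fun i _ => ?_) ⟨0, by simp⟩
  have := hcoef_pos m i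
  positivity

theorem norm_dhalf_le (m : ℕ) {X : ℂ} (hX : ‖X‖ ≤ 1) : ‖dhalf m X‖ ≤ hbound m := by
  refine norm_sum_le_of_le _ fun i _ => ?_
  rw [norm_mul, norm_mul, Complex.norm_real, norm_pow, Real.norm_of_nonneg (hcoef_pos m i).le,
    Complex.norm_natCast]
  have := pow_le_one₀ (n := 2 * i) (norm_nonneg X) hX
  have := hcoef_pos m i
  calc hcoef m i * ((2 * i + 1 : ℕ) * ‖X‖ ^ (2 * i)) ≤ hcoef m i * ((2 * i + 1 : ℕ) * 1) := by
        gcongr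
    _ = _ := by ring

theorem norm_half_le (m : ℕ) {X : ℂ} (hX : ‖X‖ ≤ 1) : ‖half m X‖ ≤ hbound m * ‖X‖ := by
  rw [hbound, Finset.sum_mul]
  refine norm_sum_le_of_le _ fun i _ => ?_
  rw [norm_mul, Complex.norm_real, norm_pow, Real.norm_of_nonneg (hcoef_pos m i).le]
  have h1 := pow_le_one₀ (n := 2 * i) (norm_nonneg X) hX
  have h2 := hcoef_pos m i
  have h3 : (1 : ℝ) ≤ (2 * i + 1 : ℕ) := by exact_mod_cast Nat.le_add_left 1 _
  calc hcoef m i * ‖X‖ ^ (2 * i + 1) = hcoef m i * 1 * (‖X‖ ^ (2 * i) * ‖X‖) := by ring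
    _ ≤ hcoef m i * (2 * i + 1 : ℕ) * (1 * ‖X‖) := by gcongr
    _ = _ := by ring

theorem dhalf_ofReal_ne_zero (m : ℕ) (r : ℝ) : dhalf m r ≠ 0 := by
  have : dhalf m r =
      ((∑ i ∈ Finset.range (m + 1), hcoef m i * ((2 * i + 1 : ℕ) * r ^ (2 * i)) : ℝ) : ℂ) := by
    simp [dhalf]
  rw [this, Complex.ofReal_ne_zero]
  refine ne_of_gt ?_
  refine Finset.sum_pos' (fun i _ => ?_) ⟨0, by simp, ?_⟩
  · have := hcoef_pos m i
    have : 0 ≤ r ^ (2 * i) := by rw [pow_mul]; positivity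
    positivity
  · simpa using hcoef_pos m 0

/-! ### The holomorphic function `F` -/

/-- The holomorphic function whose real and imaginary parts solve the two boundary problems. -/
noncomputable def hol (m : ℕ) (z : ℂ) : ℂ := half m (jk z)

/-- The derivative of `hol`. -/
noncomputable def dhol (m : ℕ) (z : ℂ) : ℂ := dhalf m (jk z) * djk z

theorem hasDerivAt_hol (m : ℕ) {z : ℂ} (hz : z - 1 ∈ Complex.slitPlane) :
    HasDerivAt (hol m) (dhol m z) z :=
  (hasDerivAt_half m (jk z)).comp z (hasDerivAt_jk hz)

theorem continuous_half (m : ℕ) : Continuous (half m) := by unfold half; fun_prop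

theorem continuous_dhalf (m : ℕ) : Continuous (dhalf m) := by unfold dhalf; fun_prop

theorem continuousOn_hol (m : ℕ) : ContinuousOn (hol m) closedUpper :=
  (continuous_half m).comp_continuousOn continuousOn_jk

theorem continuousOn_dhol (m : ℕ) :
    ContinuousOn (dhol m) (closedUpper ∩ {z | z ≠ 0 ∧ z ≠ 1}) :=
  ((continuous_dhalf m).comp_continuousOn (continuousOn_jk.mono inter_subset_left)).mul
    continuousOn_djk

theorem hol_conj (m : ℕ) {z : ℂ} (hz : z - 1 ∈ Complex.slitPlane) :
    hol m (starRingEnd ℂ z) = starRingEnd ℂ (hol m z) := by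
  rw [hol, hol, jk_conj hz, half_conj]

theorem dhol_conj (m : ℕ) {z : ℂ} (hz : z - 1 ∈ Complex.slitPlane) :
    dhol m (starRingEnd ℂ z) = starRingEnd ℂ (dhol m z) := by
  rw [dhol, dhol, jk_conj hz, djk_conj hz, dhalf_conj, map_mul]

/-- The bound for `‖dhol‖²` up to a constant. -/
noncomputable def dbound (z : ℂ) : ℝ := (‖z‖⁻¹ + ‖z - 1‖⁻¹) / (‖z‖ + ‖z - 1‖) ^ 2

theorem norm_hol_le (m : ℕ) (z : ℂ) : ‖hol m z‖ ≤ hbound m :=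
  (norm_half_le m (norm_jk_le_one z)).trans
    (mul_le_of_le_one_right (hbound_pos m).le (norm_jk_le_one z))

theorem norm_hol_sq_mul_le (m : ℕ) (z : ℂ) :
    ‖hol m z‖ ^ 2 * (‖z‖ + ‖z - 1‖) ≤ hbound m ^ 2 := by
  have h1 := norm_half_le m (norm_jk_le_one z)
  calc ‖hol m z‖ ^ 2 * (‖z‖ + ‖z - 1‖) ≤ (hbound m * ‖jk z‖) ^ 2 * (‖z‖ + ‖z - 1‖) := by
        gcongr; exact h1
    _ = hbound m ^ 2 * (‖jk z‖ ^ 2 * (‖z‖ + ‖z - 1‖)) := by ring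
    _ ≤ hbound m ^ 2 * 1 := by gcongr; exact norm_jk_sq_mul_le z
    _ = _ := mul_one _

theorem norm_djk_sq (z : ℂ) : ‖djk z‖ ^ 2 = ‖jk z‖ ^ 2 / (4 * ‖z‖ * ‖z - 1‖) := by
  rw [djk, norm_div, norm_neg, norm_mul, norm_mul, div_pow, mul_pow, mul_pow, norm_csqrt_sq,
    norm_csqrt_sq]
  norm_num

/-- With a = |z| and b = |z-1| one has |E'|² ≤ 1/(4ab(a+b)), and 1/(ab(a+b)) = (1/a + 1/b)/(a+b)².
This form separates the two singularities and shows the decay of order |z|^(-3). -/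
theorem norm_dhol_sq_le (m : ℕ) (z : ℂ) : ‖dhol m z‖ ^ 2 ≤ hbound m ^ 2 * dbound z := by
  have hs : 0 < ‖z‖ + ‖z - 1‖ := by linarith [one_le_norm_add z]
  have h0 : 0 ≤ dbound z := by unfold dbound; positivity
  have hE : ‖jk z‖ ^ 2 ≤ 1 / (‖z‖ + ‖z - 1‖) := by
    rw [le_div_iff₀ hs]; exact norm_jk_sq_mul_le z
  have h1 : ‖djk z‖ ^ 2 ≤ dbound z := by
    rw [norm_djk_sq]
    -- At the two branch points division by zero makes the left side zero.
    rcases eq_or_ne z 0 with rfl | hz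
    · simpa using h0
    rcases eq_or_ne z 1 with rfl | hz1
    · simpa using h0
    have hp : 0 < ‖z‖ := norm_pos_iff.2 hz
    have hq : 0 < ‖z - 1‖ := norm_pos_iff.2 (sub_ne_zero.2 hz1)
    calc ‖jk z‖ ^ 2 / (4 * ‖z‖ * ‖z - 1‖) ≤ (1 / (‖z‖ + ‖z - 1‖)) / (1 * ‖z‖ * ‖z - 1‖) := by
          gcongr; norm_num
      _ = dbound z := by unfold dbound; field_simp; ring
  rw [dhol, norm_mul, mul_pow]
  gcongr
  exact norm_dhalf_le m (norm_jk_le_one z)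

/-! ### Boundary values of `hol` on the axis -/

theorem sqrt_pow_eq_rpow {t : ℝ} (ht : 0 ≤ t) (k : ℕ) : √t ^ k = t ^ ((k : ℝ) / 2) := by
  rw [Real.sqrt_eq_rpow, ← Real.rpow_mul_natCast ht]
  congr 1
  ring

theorem csqrt_ofReal_sub_one_of_le {t : ℝ} (ht : t ≤ 1) :
    csqrt ((t : ℂ) - 1) = (√(1 - t) : ℝ) * Complex.I := by
  have := csqrt_ofReal_nonpos (t := t - 1) (by linarith)
  rw [neg_sub] at this
  rw [← this]; push_cast; rfl

theorem csqrt_ofReal_sub_one_of_ge {t : ℝ} (ht : 1 ≤ t) :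
    csqrt ((t : ℂ) - 1) = (√(t - 1) : ℝ) := by
  have := csqrt_ofReal_nonneg (t := t - 1) (by linarith)
  rw [← this]; push_cast; rfl

theorem jk_ofReal_of_ge {t : ℝ} (ht : 1 ≤ t) : jk t = (√t - √(t - 1) : ℝ) := by
  rw [jk, csqrt_ofReal_nonneg (by linarith), csqrt_ofReal_sub_one_of_ge ht]
  push_cast; rfl

theorem jk_ofReal_of_mem {t : ℝ} (h0 : 0 ≤ t) (h1 : t ≤ 1) :
    jk t = (√t : ℝ) - (√(1 - t) : ℝ) * Complex.I := by
  rw [jk, csqrt_ofReal_nonneg h0, csqrt_ofReal_sub_one_of_le h1]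

theorem jk_inv_ofReal_of_mem {t : ℝ} (h0 : 0 ≤ t) (h1 : t ≤ 1) :
    (jk t)⁻¹ = starRingEnd ℂ (jk t) := by
  rw [jk_inv, jk_ofReal_of_mem h0 h1, csqrt_ofReal_nonneg h0, csqrt_ofReal_sub_one_of_le h1]
  simp

theorem jk_ofReal_of_nonpos {t : ℝ} (ht : t ≤ 0) :
    jk t = (√(-t) - √(1 - t) : ℝ) * Complex.I := by
  rw [jk, csqrt_ofReal_nonpos ht, csqrt_ofReal_sub_one_of_le (by linarith)]
  push_cast; ring

theorem half_ofReal_im (m : ℕ) (r : ℝ) : (half m r).im = 0 := by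
  rw [← Complex.conj_eq_iff_im, ← half_conj, Complex.conj_ofReal]

theorem dhalf_ofReal_im (m : ℕ) (r : ℝ) : (dhalf m r).im = 0 := by
  rw [← Complex.conj_eq_iff_im, ← dhalf_conj, Complex.conj_ofReal]

theorem conj_mul_I (r : ℝ) : starRingEnd ℂ ((r : ℂ) * Complex.I) = -((r : ℂ) * Complex.I) := by
  simp

theorem half_mul_I_re (m : ℕ) (r : ℝ) : (half m (r * Complex.I)).re = 0 := by
  have h := half_conj m (r * Complex.I)
  rw [conj_mul_I, half_neg] at h
  have := congrArg Complex.re h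
  simp only [Complex.neg_re, Complex.conj_re] at this
  linarith

theorem dhalf_mul_I_im (m : ℕ) (r : ℝ) : (dhalf m (r * Complex.I)).im = 0 := by
  rw [← Complex.conj_eq_iff_im, ← dhalf_conj, conj_mul_I, dhalf_neg]

theorem hol_im_of_ge (m : ℕ) {t : ℝ} (ht : 1 ≤ t) : (hol m t).im = 0 := by
  rw [hol, jk_ofReal_of_ge ht, half_ofReal_im]

theorem hol_re_of_nonpos (m : ℕ) {t : ℝ} (ht : t ≤ 0) : (hol m t).re = 0 := by
  rw [hol, jk_ofReal_of_nonpos ht, half_mul_I_re]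

/-- On [0, 1] the value E lies on the unit circle, so 1/E is its conjugate. As L has real
coefficients, L(E) + L(1/E) is 2 Re F, while (E + 1/E)/2 = √t. -/
theorem hol_re_of_mem (m : ℕ) {t : ℝ} (h0 : 0 ≤ t) (h1 : t ≤ 1) :
    (hol m t).re = t ^ (((2 * m + 1 : ℕ) : ℝ) / 2) := by
  have h := half_add_inv m (jk_ne_zero t)
  rw [jk_add_inv, jk_inv_ofReal_of_mem h0 h1, half_conj, csqrt_ofReal_nonneg h0,
    ← Complex.ofReal_pow, sqrt_pow_eq_rpow h0] at h
  have := congrArg Complex.re h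
  simp only [Complex.add_re, Complex.conj_re, Complex.mul_re, Complex.re_ofNat, Complex.ofReal_re,
    Complex.im_ofNat, Complex.ofReal_im] at this
  rw [hol]
  linarith

theorem dhol_im_of_gt (m : ℕ) {t : ℝ} (ht : 1 < t) : (dhol m t).im = 0 := by
  have h : djk t = ((-(√t - √(t - 1)) / (2 * √t * √(t - 1)) : ℝ) : ℂ) := by
    rw [djk, jk_ofReal_of_ge ht.le, csqrt_ofReal_nonneg (by linarith),
      csqrt_ofReal_sub_one_of_ge ht.le]
    push_cast; rfl
  rw [dhol, h, jk_ofReal_of_ge ht.le, Complex.mul_im, dhalf_ofReal_im, Complex.ofReal_im]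
  ring

theorem dhol_re_of_neg (m : ℕ) {t : ℝ} (ht : t < 0) : (dhol m t).re = 0 := by
  have h : djk t = (((√(-t) - √(1 - t)) / (2 * √(-t) * √(1 - t)) : ℝ) : ℂ) * Complex.I := by
    rw [djk, jk_ofReal_of_nonpos ht.le, csqrt_ofReal_nonpos ht.le,
      csqrt_ofReal_sub_one_of_le (by linarith)]
    have h1 : ((√(-t) : ℝ) : ℂ) ≠ 0 :=
      Complex.ofReal_ne_zero.2 (Real.sqrt_pos.2 (by linarith)).ne'
    have h2 : ((√(1 - t) : ℝ) : ℂ) ≠ 0 :=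
      Complex.ofReal_ne_zero.2 (Real.sqrt_pos.2 (by linarith)).ne'
    push_cast
    field_simp
    rw [Complex.I_sq]
    ring
  rw [dhol, h, jk_ofReal_of_nonpos ht.le, Complex.mul_re, dhalf_mul_I_im, Complex.re_ofReal_mul,
    Complex.I_re]
  ring

/-- This is the derivative of t^(k/2), but differentiability of `hol` is only available off the
crack. Instead, 1/E being the conjugate of E, `dhalf_sub_inv` gives the imaginary part of E L'(E),
and the factor i in √(t-1) turns it into the real part of F'. -/
theorem dhol_re_of_mem (m : ℕ) {t : ℝ} (h0 : 0 < t) (h1 : t < 1) :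
    (dhol m t).re
      = ((2 * m + 1 : ℕ) : ℝ) / 2 * t ^ (((2 * m + 1 : ℕ) : ℝ) / 2 - 1) := by
  have h := dhalf_sub_inv m (jk_ne_zero t)
  have hs : 0 < √t := Real.sqrt_pos.2 h0
  have hr : 0 < √(1 - t) := Real.sqrt_pos.2 (by linarith)
  rw [jk_add_inv, jk_inv_ofReal_of_mem h0.le h1.le, dhalf_conj, ← map_mul, Complex.sub_conj,
    Complex.sub_conj, csqrt_ofReal_nonneg h0.le] at h
  have him : (jk t).im = -√(1 - t) := by
    rw [jk_ofReal_of_mem h0.le h1.le]; simp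
  have key : (jk t * dhalf m (jk t)).im = -((2 * m + 1 : ℕ) : ℝ) * √t ^ (2 * m) * √(1 - t) := by
    have := congrArg Complex.im h
    rw [him, ← Complex.ofReal_pow, ← Complex.ofReal_natCast] at this
    simp only [Complex.mul_im, Complex.mul_re, Complex.ofReal_re, Complex.ofReal_im, Complex.I_re,
      Complex.I_im, mul_zero, mul_one, zero_mul, add_zero, sub_zero] at this
    simp only [Complex.mul_im]
    linarith
  have hd : dhol m t = ((1 / (2 * √t * √(1 - t)) : ℝ) : ℂ) *
      (Complex.I * (jk t * dhalf m (jk t))) := by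
    rw [dhol, djk, csqrt_ofReal_nonneg h0.le, csqrt_ofReal_sub_one_of_le h1.le]
    have h1 : ((√t : ℝ) : ℂ) ≠ 0 := Complex.ofReal_ne_zero.2 hs.ne'
    have h2 : ((√(1 - t) : ℝ) : ℂ) ≠ 0 := Complex.ofReal_ne_zero.2 hr.ne'
    push_cast
    field_simp
    rw [Complex.I_sq]
    ring
  rw [hd, Complex.re_ofReal_mul, Complex.I_mul_re, key, Real.rpow_sub h0, Real.rpow_one,
    ← sqrt_pow_eq_rpow h0.le]
  have e : √t ^ (2 * m + 1) / t = √t ^ (2 * m) / √t := by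
    rw [div_eq_div_iff h0.ne' hs.ne', pow_succ, mul_assoc, Real.mul_self_sqrt h0.le]
  rw [e]
  field_simp

/-! ### The plane -/

/-- The plane as complex numbers. -/
def toC (x : ℝ × ℝ) : ℂ := ⟨x.1, x.2⟩

theorem toC_axis (t : ℝ) : toC (t, 0) = t := rfl

theorem toC_refl (x : ℝ × ℝ) : toC (refl x) = starRingEnd ℂ (toC x) := rfl

theorem coe_equivRealProdCLM_symm : ⇑Complex.equivRealProdCLM.symm = toC := by
  funext x
  rw [Complex.equivRealProdCLM_symm_apply]
  apply Complex.ext <;> simp [toC]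

theorem continuous_toC : Continuous toC := by
  rw [← coe_equivRealProdCLM_symm]; exact Complex.equivRealProdCLM.symm.continuous

theorem toC_sub_one_mem {x : ℝ × ℝ} (hx : x ∈ crackᶜ) : toC x - 1 ∈ Complex.slitPlane := by
  rw [Complex.mem_slitPlane_iff]
  simp only [toC, Complex.sub_re, Complex.one_re, Complex.sub_im, Complex.one_im, sub_zero]
  by_contra h
  push Not at h
  exact hx ⟨by linarith [h.1], h.2⟩

/-- The harmonic function `Re (β F)`. -/
noncomputable def fn (m : ℕ) (β : ℂ) (x : ℝ × ℝ) : ℝ := (β * hol m (toC x)).re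

/-- The gradient of `fn`. -/
noncomputable def gd (m : ℕ) (β : ℂ) (x : ℝ × ℝ) : ℝ × ℝ :=
  ((β * dhol m (toC x)).re, -(β * dhol m (toC x)).im)

theorem hasFDerivAt_fn (m : ℕ) (β : ℂ) {x : ℝ × ℝ} (hx : x ∈ crackᶜ) :
    HasFDerivAt (fn m β) (dotL (gd m β x)) x := by
  have h1 := ((hasDerivAt_hol m (toC_sub_one_mem hx)).const_mul β).hasFDerivAt.restrictScalars ℝ
  have h2 : HasFDerivAt toC (Complex.equivRealProdCLM.symm : (ℝ × ℝ) →L[ℝ] ℂ) x := by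
    rw [← coe_equivRealProdCLM_symm]; exact Complex.equivRealProdCLM.symm.hasFDerivAt
  have h3 := (Complex.reCLM.hasFDerivAt.comp x (h1.comp x h2))
  refine h3.congr_fderiv ?_
  ext <;> simp [dotL_apply, dot, gd]

/-! ### Square integrability of the gradient -/

theorem weight_eq {t : ℝ} (ht : |t| ≤ 1) : weight t = ENNReal.ofReal (√|t|)⁻¹ := by
  have h : t ∈ Icc (-1 : ℝ) 1 := abs_le.1 ht
  rw [weight, indicator_of_mem h, Real.rpow_neg (abs_nonneg t), Real.sqrt_eq_rpow]

theorem integrable_inv_sqrt_mul : Integrable (fun t : ℝ => (√|t|)⁻¹ * (1 + |t|)⁻¹) := by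
  refine ⟨by fun_prop, ?_⟩
  have h1 : Integrable (fun t : ℝ => (1 + ‖t‖) ^ (-(3 / 2) : ℝ)) :=
    integrable_one_add_norm (by norm_num)
  have hle : ∀ t : ℝ, ‖(√|t|)⁻¹ * (1 + |t|)⁻¹‖ₑ
      ≤ weight t + ENNReal.ofReal (2 * (1 + ‖t‖) ^ (-(3 / 2) : ℝ)) := by
    intro t
    have h0 : 0 ≤ (√|t|)⁻¹ * (1 + |t|)⁻¹ := by positivity
    rw [← ofReal_norm, Real.norm_of_nonneg h0]
    rcases le_or_gt |t| 1 with ht | ht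
    · refine le_add_right ?_
      rw [weight_eq ht]
      refine ENNReal.ofReal_le_ofReal (mul_le_of_le_one_right (by positivity) ?_)
      exact inv_le_one_of_one_le₀ (by linarith [abs_nonneg t])
    · refine le_add_left (ENNReal.ofReal_le_ofReal ?_)
      have hp : 0 < 1 + |t| := by linarith
      have h3 : √(1 + |t|) ≤ 2 * √|t| := by
        rw [show (2 : ℝ) * √|t| = √(4 * |t|) by
          rw [Real.sqrt_mul (by norm_num), show (4 : ℝ) = 2 ^ 2 by norm_num, Real.sqrt_sq]
          norm_num]
        exact Real.sqrt_le_sqrt (by linarith)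
      have h4 : (1 + ‖t‖) ^ (-(3 / 2) : ℝ) = (√(1 + |t|))⁻¹ * (1 + |t|)⁻¹ := by
        rw [Real.norm_eq_abs, show (-(3 / 2) : ℝ) = -(1 / 2) + -1 by norm_num, Real.rpow_add hp,
          Real.rpow_neg_one, Real.rpow_neg hp.le, Real.sqrt_eq_rpow]
      rw [h4, ← mul_assoc]
      gcongr
      have h5 : 0 < √(1 + |t|) := Real.sqrt_pos.2 hp
      have h6 : 0 < √|t| := Real.sqrt_pos.2 (by linarith)
      rw [inv_eq_one_div, inv_eq_one_div, mul_one_div, div_le_div_iff₀ h6 h5]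
      linarith
  refine (lintegral_mono hle).trans_lt ?_
  rw [lintegral_add_left measurable_weight]
  exact ENNReal.add_lt_top.2 ⟨lintegral_weight_lt_top, (h1.const_mul 2).lintegral_lt_top⟩

theorem ae_fst_ne (a : ℝ) : ∀ᵐ x : ℝ × ℝ, x.1 ≠ a := by
  rw [ae_iff]
  have : {x : ℝ × ℝ | ¬x.1 ≠ a} = {a} ×ˢ univ := by ext; simp
  rw [this, Measure.volume_eq_prod, Measure.prod_prod]
  simp

theorem ae_snd_ne : ∀ᵐ x : ℝ × ℝ, x.2 ≠ 0 := by
  rw [ae_iff]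
  simpa using volume_axis

/-- Both |Re z| and |Im z| are at most |z|, so the bound splits into a product of functions of one
variable, and integrability over the plane follows from that on the line. -/
theorem inv_norm_div_sq_le {z : ℂ} {s : ℝ} (h1 : z.re ≠ 0) (h2 : z.im ≠ 0) (hs1 : 1 ≤ s)
    (hs : ‖z‖ ≤ s) : ‖z‖⁻¹ / s ^ 2
      ≤ 4 * (((√|z.re|)⁻¹ * (1 + |z.re|)⁻¹) * ((√|z.im|)⁻¹ * (1 + |z.im|)⁻¹)) := by
  have hr := Complex.abs_re_le_norm z
  have hi := Complex.abs_im_le_norm z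
  have hr0 : 0 < |z.re| := abs_pos.2 h1
  have hi0 : 0 < |z.im| := abs_pos.2 h2
  have hsr : 0 < √|z.re| := Real.sqrt_pos.2 hr0
  have hsi : 0 < √|z.im| := Real.sqrt_pos.2 hi0
  have hprod : √|z.re| * √|z.im| ≤ ‖z‖ := by
    calc √|z.re| * √|z.im| ≤ √‖z‖ * √‖z‖ := by gcongr
      _ = ‖z‖ := Real.mul_self_sqrt (norm_nonneg _)
  have hsq : (1 + |z.re|) * (1 + |z.im|) ≤ 4 * s ^ 2 := by
    calc (1 + |z.re|) * (1 + |z.im|) ≤ (s + s) * (s + s) := by gcongr <;> linarith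
      _ = _ := by ring
  calc ‖z‖⁻¹ / s ^ 2 ≤ (√|z.re| * √|z.im|)⁻¹ / ((1 + |z.re|) * (1 + |z.im|) / 4) := by
        gcongr
        linarith
    _ = _ := by field_simp

theorem measurable_dbound : Measurable fun x => dbound (toC x) := by
  have h1 : Measurable fun x => ‖toC x‖ := continuous_toC.norm.measurable
  have h2 : Measurable fun x => ‖toC x - 1‖ := (continuous_toC.sub continuous_const).norm.measurable
  exact (h1.inv.add h2.inv).div ((h1.add h2).pow_const 2)

theorem dbound_nonneg (z : ℂ) : 0 ≤ dbound z := by unfold dbound; positivity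

theorem integrable_dbound : Integrable fun x => dbound (toC x) := by
  set f : ℝ → ℝ := fun t => (√|t|)⁻¹ * (1 + |t|)⁻¹ with hf
  have h1 : Integrable (fun x : ℝ × ℝ => f x.1 * f x.2) :=
    integrable_inv_sqrt_mul.mul_prod integrable_inv_sqrt_mul
  have h2 : Integrable (fun x : ℝ × ℝ => f (x.1 - 1) * f x.2) :=
    (integrable_inv_sqrt_mul.comp_sub_right 1).mul_prod integrable_inv_sqrt_mul
  refine ((h1.const_mul 4).add (h2.const_mul 4)).mono' measurable_dbound.aestronglyMeasurable ?_
  filter_upwards [ae_fst_ne 0, ae_fst_ne 1, ae_snd_ne] with x hx0 hx1 hx2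
  rw [Real.norm_of_nonneg (dbound_nonneg _), dbound, add_div]
  have hs := one_le_norm_add (toC x)
  refine add_le_add ?_ ?_
  · exact inv_norm_div_sq_le (z := toC x) hx0 hx2 hs (by linarith [norm_nonneg (toC x - 1)])
  · have := inv_norm_div_sq_le (z := toC x - 1) (s := ‖toC x‖ + ‖toC x - 1‖)
      (by simpa [toC, sub_eq_zero] using hx1) (by simpa [toC] using hx2) hs
      (by linarith [norm_nonneg (toC x)])
    simpa [toC] using this

/-- A square integrable majorant of `dhol`. -/
noncomputable def dmaj (m : ℕ) (x : ℝ × ℝ) : ℝ := hbound m * √(dbound (toC x))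

theorem dmaj_nonneg (m : ℕ) (x : ℝ × ℝ) : 0 ≤ dmaj m x :=
  mul_nonneg (hbound_pos m).le (Real.sqrt_nonneg _)

theorem memLp_dmaj (m : ℕ) : MemLp (dmaj m) 2 := by
  have hm : AEStronglyMeasurable (dmaj m) :=
    (measurable_dbound.sqrt.const_mul _).aestronglyMeasurable
  rw [memLp_two_iff_integrable_sq hm]
  refine (integrable_dbound.const_mul (hbound m ^ 2)).congr (Eventually.of_forall fun x => ?_)
  simp only [dmaj, mul_pow, Real.sq_sqrt (dbound_nonneg _)]

theorem norm_dhol_le (m : ℕ) (x : ℝ × ℝ) : ‖dhol m (toC x)‖ ≤ dmaj m x := by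
  refine abs_le_of_sq_le_sq' ?_ (dmaj_nonneg m x) |>.2
  rw [dmaj, mul_pow, Real.sq_sqrt (dbound_nonneg _)]
  exact norm_dhol_sq_le m _

theorem norm_gd_le' (m : ℕ) (β : ℂ) (x : ℝ × ℝ) : ‖gd m β x‖ ≤ ‖β‖ * ‖dhol m (toC x)‖ := by
  rw [← norm_mul, gd, Prod.norm_def]
  refine sup_le (Complex.abs_re_le_norm _) ?_
  rw [norm_neg]
  exact Complex.abs_im_le_norm _

theorem norm_gd_le (m : ℕ) (β : ℂ) (x : ℝ × ℝ) : ‖gd m β x‖ ≤ ‖β‖ * dmaj m x :=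
  (norm_gd_le' m β x).trans (by gcongr; exact norm_dhol_le m x)

theorem measurable_csqrt : Measurable csqrt := measurable_id.pow_const _

theorem measurable_jk : Measurable jk :=
  measurable_csqrt.sub (measurable_csqrt.comp (measurable_id.sub_const 1))

theorem measurable_djk : Measurable djk :=
  measurable_jk.neg.div ((measurable_csqrt.const_mul 2).mul
    (measurable_csqrt.comp (measurable_id.sub_const 1)))

theorem measurable_hol (m : ℕ) : Measurable (hol m) :=
  (continuous_half m).measurable.comp measurable_jk

theorem measurable_dhol (m : ℕ) : Measurable (dhol m) :=
  ((continuous_dhalf m).measurable.comp measurable_jk).mul measurable_djk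

theorem measurable_fn (m : ℕ) (β : ℂ) : Measurable (fn m β) :=
  Complex.measurable_re.comp (((measurable_hol m).comp continuous_toC.measurable).const_mul β)

theorem measurable_gd (m : ℕ) (β : ℂ) : Measurable (gd m β) := by
  have h := ((measurable_dhol m).comp continuous_toC.measurable).const_mul β
  exact (Complex.measurable_re.comp h).prodMk (Complex.measurable_im.comp h).neg

theorem memLp_gd (m : ℕ) (β : ℂ) : MemLp (gd m β) 2 :=
  ((memLp_dmaj m).const_mul ‖β‖).mono (measurable_gd m β).aestronglyMeasurable
    (Eventually.of_forall fun x => (norm_gd_le m β x).trans (Real.le_norm_self _))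

theorem norm_fn_le' (m : ℕ) (β : ℂ) (x : ℝ × ℝ) : ‖fn m β x‖ ≤ ‖β‖ * ‖hol m (toC x)‖ := by
  rw [← norm_mul]; exact Complex.abs_re_le_norm _

theorem norm_fn_le (m : ℕ) (β : ℂ) (x : ℝ × ℝ) : ‖fn m β x‖ ≤ ‖β‖ * hbound m :=
  (norm_fn_le' m β x).trans (by gcongr; exact norm_hol_le m _)

theorem locallyIntegrable_fn (m : ℕ) (β : ℂ) : LocallyIntegrable (fn m β) := by
  refine (locallyIntegrable_const (‖β‖ * hbound m)).mono
    (measurable_fn m β).aestronglyMeasurable (Eventually.of_forall fun x => ?_)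
  exact (norm_fn_le m β x).trans (Real.le_norm_self _)

theorem locallyIntegrable_gd (m : ℕ) (β : ℂ) : LocallyIntegrable (gd m β) :=
  (memLp_gd m β).locallyIntegrable (by norm_num)

theorem continuousOn_fn (m : ℕ) (β : ℂ) : ContinuousOn (fn m β) {x | 0 ≤ x.2} :=
  Complex.continuous_re.comp_continuousOn (continuousOn_const.mul
    ((continuousOn_hol m).comp continuous_toC.continuousOn fun _ hx => hx))

theorem toC_ne_of_ne {x : ℝ × ℝ} {a : ℝ} (h : x ≠ (a, 0)) : toC x ≠ a := fun h' => h (by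
  have h1 := congrArg Complex.re h'
  have h2 := congrArg Complex.im h'
  exact Prod.ext h1 h2)

theorem continuousOn_gd (m : ℕ) (β : ℂ) :
    ContinuousOn (gd m β) ({x | 0 ≤ x.2} ∩ {x | x ≠ (0, 0) ∧ x ≠ (1, 0)}) := by
  have h : ContinuousOn (fun x => β * dhol m (toC x))
      ({x | 0 ≤ x.2} ∩ {x | x ≠ (0, 0) ∧ x ≠ (1, 0)}) :=
    continuousOn_const.mul ((continuousOn_dhol m).comp continuous_toC.continuousOn fun x hx =>
      ⟨hx.1, by simpa using toC_ne_of_ne hx.2.1, by simpa using toC_ne_of_ne hx.2.2⟩)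
  exact (Complex.continuous_re.comp_continuousOn h).prodMk
    (Complex.continuous_im.comp_continuousOn h).neg

/-! ### Classical functions: weak gradients and traces -/

theorem hasFDerivAt_mul_test {U : Set (ℝ × ℝ)} {u : ℝ × ℝ → ℝ} {g : ℝ × ℝ → ℝ × ℝ}
    (hu : ∀ x ∈ U, HasFDerivAt u (dotL (g x)) x) {φ : ℝ × ℝ → ℝ} {V : Set (ℝ × ℝ)}
    (hφ : IsTestOn V φ) {x : ℝ × ℝ} (hx : x ∈ U) :
    HasFDerivAt (fun x => u x * φ x) (u x • fderiv ℝ φ x + φ x • dotL (g x)) x :=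
  (hu x hx).mul hφ.differentiable.differentiableAt.hasFDerivAt

theorem hasWeakGrad_of_hasFDerivAt {U : Set (ℝ × ℝ)}
    {u : ℝ × ℝ → ℝ} {g : ℝ × ℝ → ℝ × ℝ} (hu : ∀ x ∈ U, HasFDerivAt u (dotL (g x)) x)
    (hul : LocallyIntegrableOn u U) (hgl : LocallyIntegrableOn g U) : HasWeakGrad U u g := by
  refine ⟨hul, hgl, fun φ hφ e => ?_⟩
  rw [setIntegral_mul_test _ (hφ.fderiv e), setIntegral_mul_test _ hφ]
  have i1 := locallyIntegrableOn_mul_test hul (hφ.fderiv e)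
  have i2 := locallyIntegrableOn_mul_test (locallyIntegrableOn_dot hgl e) hφ
  have i3 := locallyIntegrableOn_mul_test hul hφ
  have hd : ∀ x, HasFDerivAt (fun x => u x * φ x) (u x • fderiv ℝ φ x + φ x • dotL (g x)) x := by
    intro x
    by_cases hx : x ∈ U
    · exact hasFDerivAt_mul_test hu hφ hx
    · have hx' : x ∉ tsupport φ := fun h => hx (hφ.2.2 h)
      have h0 : φ =ᶠ[𝓝 x] fun _ => 0 := by
        filter_upwards [(isClosed_tsupport φ).isOpen_compl.mem_nhds hx'] with y hy
        exact image_eq_zero_of_notMem_tsupport hy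
      have h1 : (fun x => u x * φ x) =ᶠ[𝓝 x] fun _ => 0 := by
        filter_upwards [h0] with y hy
        rw [hy, mul_zero]
      rw [h0.fderiv_eq, h0.eq_of_nhds]
      simpa using (hasFDerivAt_const (0 : ℝ) x).congr_of_eventuallyEq h1
  have hfd : ∀ x, fderiv ℝ (fun x => u x * φ x) x e
      = u x * fderiv ℝ φ x e + dot (g x) e * φ x := by
    intro x
    rw [(hd x).fderiv]
    simp [dotL_apply, dot_comm e]
    ring
  -- Integration by parts against the constant 1: the derivative of the compactly supported product
  -- u φ has integral zero.
  have key := integral_mul_fderiv_eq_neg_fderiv_mul_of_integrable (μ := volume) (𝕜 := ℝ)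
    (f := fun _ : ℝ × ℝ => (1 : ℝ)) (g := fun x => u x * φ x) (v := e) (by simp)
    (by simp only [hfd, one_mul]; exact i1.add i2) (by simpa using i3)
    (fun x _ => differentiableAt_const _) (fun x _ => (hd x).differentiableAt)
  simp only [hfd, one_mul, fderiv_fun_const, Pi.zero_apply, zero_apply,
    zero_mul, integral_zero, neg_zero] at key
  rw [integral_add i1 i2] at key
  linarith

/-- The fundamental theorem of calculus on horizontal lines gives zero, on vertical rays the
boundary value. Continuity of u up to the axis and local integrability of g are enough, so the
gradient may be singular at 0 and 1. -/
theorem greenOn_of_hasFDerivAt {u : ℝ × ℝ → ℝ} {g : ℝ × ℝ → ℝ × ℝ}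
    (hu : ∀ x ∈ upper, HasFDerivAt u (dotL (g x)) x) (hc : ContinuousOn u {x | 0 ≤ x.2})
    (hul : LocallyIntegrable u (volume.restrict upper))
    (hgl : LocallyIntegrable g (volume.restrict upper)) :
    GreenOn upper (0, -1) u g (fun t => u (t, 0)) := by
  have hcu : Continuous (fun t : ℝ => u (t, 0)) :=
    hc.comp_continuous (by fun_prop) (fun t => le_refl (0 : ℝ))
  refine ⟨hcu.locallyIntegrable, hul, hgl, fun φ hφ e => ?_⟩
  have i1 : ∀ e, Integrable (fun x => u x * fderiv ℝ φ x e) (volume.restrict upper) := fun e =>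
    locallyIntegrable_mul_test hul (hφ.fderiv e)
  have i2 : ∀ e, Integrable (fun x => dot (g x) e * φ x) (volume.restrict upper) := fun e =>
    locallyIntegrable_mul_test (locallyIntegrable_dot hgl e) hφ
  set D : ℝ × ℝ → ℝ × ℝ → ℝ := fun e x => u x * fderiv ℝ φ x e + dot (g x) e * φ x with hD
  have iD : ∀ e, Integrable (D e) (volume.restrict upper) := fun e => (i1 e).add (i2 e)
  have hfd : ∀ x ∈ upper, HasFDerivAt (fun x => u x * φ x)
      (u x • fderiv ℝ φ x + φ x • dotL (g x)) x := fun x hx => hasFDerivAt_mul_test hu hφ hx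
  have happ : ∀ x e, (u x • fderiv ℝ φ x + φ x • dotL (g x)) e = D e x := by
    intro x e
    simp [hD, dotL_apply, dot_comm e]
    ring
  have hzero : ∀ (K : ℝ → ℝ × ℝ) (π : ℝ × ℝ → ℝ), Continuous π → (∀ s, π (K s) = s) →
      ∀ᶠ s in cocompact ℝ, u (K s) * φ (K s) = 0 := by
    intro K π hπ hK
    filter_upwards [(hφ.2.1.isCompact.image hπ).compl_mem_cocompact] with s hs
    rw [image_eq_zero_of_notMem_tsupport (fun h => hs ⟨K s, h, hK s⟩), mul_zero]
  have hH : ∀ y : ℝ, ∀ᶠ s in cocompact ℝ, u (s, y) * φ (s, y) = 0 := fun y =>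
    hzero (fun s => (s, y)) Prod.fst continuous_fst fun _ => rfl
  have hV : ∀ t : ℝ, ∀ᶠ s in cocompact ℝ, u (t, s) * φ (t, s) = 0 := fun t =>
    hzero (fun s => (t, s)) Prod.snd continuous_snd fun _ => rfl
  have I1 : ∫ x in upper, D (1, 0) x = 0 := by
    have hi := iD (1, 0)
    rw [restrict_upper] at hi ⊢
    rw [integral_prod_symm _ hi]
    have hae : ∀ᵐ y ∂(volume.restrict (Ioi (0 : ℝ))), ∫ t, D (1, 0) (t, y) = 0 := by
      filter_upwards [hi.prod_left_ae, ae_restrict_mem measurableSet_Ioi] with y hy hy0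
      have hder : ∀ t, HasDerivAt (fun t => u (t, y) * φ (t, y)) (D (1, 0) (t, y)) t := by
        intro t
        have h1 : HasDerivAt (fun s : ℝ => (s, y)) ((1 : ℝ), (0 : ℝ)) t :=
          (hasDerivAt_id t).prodMk (hasDerivAt_const t y)
        have := (hfd (t, y) hy0).comp_hasDerivAt t h1
        rwa [happ] at this
      rw [integral_of_hasDerivAt_of_tendsto (m := 0) (n := 0) hder hy, sub_zero]
      · refine tendsto_const_nhds.congr' ?_
        filter_upwards [atBot_le_cocompact (hH y)] with s hs using hs.symm
      · refine tendsto_const_nhds.congr' ?_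
        filter_upwards [atTop_le_cocompact (hH y)] with s hs using hs.symm
    rw [integral_congr_ae hae, integral_zero]
  have I2 : ∫ x in upper, D (0, 1) x = -∫ t, u (t, 0) * φ (t, 0) := by
    have hi := iD (0, 1)
    rw [restrict_upper] at hi ⊢
    rw [integral_prod _ hi, ← integral_neg]
    refine integral_congr_ae ?_
    filter_upwards [hi.prod_right_ae] with t ht
    have hder : ∀ y ∈ Ioi (0 : ℝ),
        HasDerivAt (fun y => u (t, y) * φ (t, y)) (D (0, 1) (t, y)) y := by
      intro y hy
      have h1 : HasDerivAt (fun s : ℝ => (t, s)) ((0 : ℝ), (1 : ℝ)) y :=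
        (hasDerivAt_const y t).prodMk (hasDerivAt_id y)
      have := (hfd (t, y) hy).comp_hasDerivAt y h1
      rwa [happ] at this
    have hcont : ContinuousWithinAt (fun y => u (t, y) * φ (t, y)) (Ici 0) 0 := by
      refine ContinuousWithinAt.mul ?_
        (hφ.continuous.comp (by fun_prop : Continuous fun y : ℝ => (t, y))).continuousWithinAt
      exact (hc (t, 0) (le_refl (0 : ℝ))).comp
        (by fun_prop : Continuous fun y : ℝ => (t, y)).continuousWithinAt fun y hy => hy
    rw [integral_Ioi_of_hasDerivAt_of_tendsto hcont hder ht (m := 0), zero_sub]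
    refine tendsto_const_nhds.congr' ?_
    filter_upwards [atTop_le_cocompact (hV t)] with s hs using hs.symm
  have hlin : ∀ x, D e x = e.1 * D (1, 0) x + e.2 * D (0, 1) x := by
    intro x
    rw [← happ, ← happ, ← happ]
    have : e = e.1 • ((1 : ℝ), (0 : ℝ)) + e.2 • ((0 : ℝ), (1 : ℝ)) := by ext <;> simp
    conv_lhs => rw [this, map_add, map_smul, map_smul]
    simp only [smul_eq_mul]
  have hsum : (∫ x in upper, u x * fderiv ℝ φ x e) + ∫ x in upper, dot (g x) e * φ x
      = -(e.2 * ∫ t, u (t, 0) * φ (t, 0)) := by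
    rw [← integral_add (i1 e) (i2 e)]
    calc ∫ x in upper, D e x = ∫ x in upper, (e.1 * D (1, 0) x + e.2 * D (0, 1) x) := by
          simp only [hlin]
      _ = _ := by
          rw [integral_add ((iD _).const_mul _) ((iD _).const_mul _), integral_const_mul,
            integral_const_mul, I1, I2]
          ring
  simp only [dot, zero_mul, neg_mul, one_mul, zero_add] at hsum ⊢
  linarith

/-! ### Fields with weighted traces -/

/-- A square integrable field `g` on the upper half-plane with boundary values `p` of its
potential: all that is left of a function of class `H¹` in the limit formulas below. -/
structure RotTrace (g : ℝ × ℝ → ℝ × ℝ) (p : ℝ → ℝ) : Prop where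
  memLp : MemLp g 2 (volume.restrict upper)
  trace : LocallyIntegrable p
  weighted : ∀ (t₀ : ℝ) (a : ℝ → ℝ), Continuous a → HasCompactSupport a →
    Integrable (fun t => p t * a t * (√|t - t₀|)⁻¹)
  rot_eq : ∀ ψ : ℝ × ℝ → ℝ, IsTestOn univ ψ →
    ∫ x in upper, dot (g x) (rot ψ x) = ∫ t : ℝ, p t * fderiv ℝ ψ (t, 0) (1, 0)

/-- Within distance 1 of t₀ the hypothesis applies; farther away the factor is at most 1. -/
theorem integrable_weighted {p : ℝ → ℝ} (hp : LocallyIntegrable p) {t₀ : ℝ}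
    (h : ∫⁻ t, ‖p t‖ₑ * weight (t - t₀) < ⊤) {a : ℝ → ℝ} (ha : Continuous a)
    (hc : HasCompactSupport a) : Integrable (fun t => p t * a t * (√|t - t₀|)⁻¹) := by
  obtain ⟨C, hC⟩ := hc.exists_bound_of_continuous ha
  have hpa := locallyIntegrable_mul_axis hp ha hc
  refine ⟨hpa.aestronglyMeasurable.mul (by fun_prop), ?_⟩
  have hle : ∀ t, ‖p t * a t * (√|t - t₀|)⁻¹‖ₑ
      ≤ ENNReal.ofReal C * (‖p t‖ₑ * weight (t - t₀)) + ‖p t * a t‖ₑ := by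
    intro t
    have h0 : 0 ≤ (√|t - t₀|)⁻¹ := by positivity
    rw [enorm_mul, Real.enorm_of_nonneg h0]
    rcases le_or_gt |t - t₀| 1 with ht | ht
    · refine le_add_right ?_
      rw [weight_eq ht, enorm_mul]
      have : ‖a t‖ₑ ≤ ENNReal.ofReal C := by
        rw [← ofReal_norm]; exact ENNReal.ofReal_le_ofReal (hC t)
      calc ‖p t‖ₑ * ‖a t‖ₑ * ENNReal.ofReal (√|t - t₀|)⁻¹
          ≤ ‖p t‖ₑ * ENNReal.ofReal C * ENNReal.ofReal (√|t - t₀|)⁻¹ := by gcongr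
        _ = _ := by ring
    · refine le_add_left (mul_le_of_le_one_right zero_le ?_)
      rw [ENNReal.ofReal_le_one]
      exact inv_le_one_of_one_le₀ (Real.one_le_sqrt.2 ht.le)
  refine (lintegral_mono hle).trans_lt ?_
  rw [lintegral_add_right' _ hpa.aestronglyMeasurable.enorm, lintegral_const_mul' _ _ (by simp)]
  exact ENNReal.add_lt_top.2 ⟨ENNReal.mul_lt_top (by simp) h, hpa.2⟩

theorem GreenOn.rotTrace {w : ℝ × ℝ → ℝ} {g : ℝ × ℝ → ℝ × ℝ} {p : ℝ → ℝ}
    (h : GreenOn upper (0, -1) w g p) (hg : MemLp g 2 (volume.restrict upper)) : RotTrace g p :=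
  ⟨hg, h.trace, fun t₀ _ ha hc =>
    integrable_weighted h.trace (h.lintegral_trace_weight_lt_top hg t₀) ha hc,
    fun _ hψ => h.integral_dot_rot hψ⟩

theorem continuous_rot {ψ : ℝ × ℝ → ℝ} (hψ : IsTestOn univ ψ) : Continuous (rot ψ) :=
  (hψ.fderiv (0, 1)).continuous.prodMk (hψ.fderiv (1, 0)).continuous.neg

theorem hasCompactSupport_rot {ψ : ℝ × ℝ → ℝ} (hψ : IsTestOn univ ψ) :
    HasCompactSupport (rot ψ) := by
  refine HasCompactSupport.intro hψ.2.1.isCompact fun x hx => ?_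
  have h : ∀ e, fderiv ℝ ψ x e = 0 := fun e => by
    have : x ∉ tsupport fun x => fderiv ℝ ψ x e := fun h =>
      hx (tsupport_fderiv_apply_subset ℝ e h)
    exact image_eq_zero_of_notMem_tsupport (f := fun x => fderiv ℝ ψ x e) this
  simp [rot, h]

theorem memLp_rot {ψ : ℝ × ℝ → ℝ} (hψ : IsTestOn univ ψ) : MemLp (rot ψ) 2 :=
  (continuous_rot hψ).memLp_of_hasCompactSupport (hasCompactSupport_rot hψ)

theorem integrable_dot {g h : ℝ × ℝ → ℝ × ℝ} {μ : Measure (ℝ × ℝ)} (hg : MemLp g 2 μ)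
    (hh : MemLp h 2 μ) : Integrable (fun x => dot (g x) (h x)) μ := by
  have h1 := (hg.fst).integrable_mul hh.fst
  have h2 := (hg.snd).integrable_mul hh.snd
  exact h1.add h2

theorem RotTrace.sub {g g' : ℝ × ℝ → ℝ × ℝ} {p p' : ℝ → ℝ} (h : RotTrace g p)
    (h' : RotTrace g' p') : RotTrace (g - g') (p - p') := by
  refine ⟨h.memLp.sub h'.memLp, h.trace.sub h'.trace, fun t₀ a ha hc => ?_, fun ψ hψ => ?_⟩
  · refine ((h.weighted t₀ a ha hc).sub (h'.weighted t₀ a ha hc)).congr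
      (Eventually.of_forall fun t => ?_)
    simp only [Pi.sub_apply]
    ring
  · have hr := (memLp_rot hψ).restrict upper
    have hc : Continuous fun t : ℝ => fderiv ℝ ψ (t, 0) (1, 0) :=
      (hψ.fderiv (1, 0)).continuous.comp (by fun_prop)
    have hcs : HasCompactSupport fun t : ℝ => fderiv ℝ ψ (t, 0) (1, 0) := by
      refine HasCompactSupport.intro ((hψ.fderiv (1, 0)).2.1.isCompact.image continuous_fst)
        fun t ht => ?_
      exact image_eq_zero_of_notMem_tsupport (f := fun x => fderiv ℝ ψ x (1, 0))
        fun hx => ht ⟨(t, 0), hx, rfl⟩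
    have e1 : ∫ x in upper, dot ((g - g') x) (rot ψ x)
        = (∫ x in upper, dot (g x) (rot ψ x))
          - ∫ x in upper, dot (g' x) (rot ψ x) := by
      rw [← integral_sub (integrable_dot h.memLp hr) (integrable_dot h'.memLp hr)]
      simp only [Pi.sub_apply, dot_sub_left]
    rw [e1, h.rot_eq ψ hψ, h'.rot_eq ψ hψ, ← integral_sub (locallyIntegrable_mul_axis h.trace hc hcs)
      (locallyIntegrable_mul_axis h'.trace hc hcs)]
    refine integral_congr_ae (Eventually.of_forall fun t => ?_)
    simp only [Pi.sub_apply]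
    ring

/-! ### Testing with the conjugate harmonic function -/

/-- The conjugate of `fn m β`: its rotated gradient is `gd m β`. -/
noncomputable def cj (m : ℕ) (β : ℂ) : ℝ × ℝ → ℝ := fn m (-Complex.I * β)

theorem cj_eq (m : ℕ) (β : ℂ) (x : ℝ × ℝ) : cj m β x = (β * hol m (toC x)).im := by
  simp [cj, fn, mul_assoc]

theorem contDiffAt_fn (m : ℕ) (β : ℂ) {x : ℝ × ℝ} (hx : x ∈ upper) :
    ContDiffAt ℝ ∞ (fn m β) x := by
  have hopen : IsOpen {z : ℂ | z - 1 ∈ Complex.slitPlane} :=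
    Complex.isOpen_slitPlane.preimage (by fun_prop)
  have hd : DifferentiableOn ℂ (hol m) {z : ℂ | z - 1 ∈ Complex.slitPlane} := fun z hz =>
    (hasDerivAt_hol m hz).differentiableAt.differentiableWithinAt
  have h1 : ContDiffAt ℂ ∞ (hol m) (toC x) :=
    (hd.contDiffOn hopen).contDiffAt (hopen.mem_nhds (toC_sub_one_mem (upper_subset hx)))
  have h2 : ContDiff ℝ ∞ toC := by
    rw [← coe_equivRealProdCLM_symm]; exact Complex.equivRealProdCLM.symm.contDiff
  have h3 : ContDiffAt ℝ ∞ (fun x => hol m (toC x)) x :=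
    (h1.restrict_scalars ℝ).comp x h2.contDiffAt
  exact Complex.reCLM.contDiff.contDiffAt.comp x (contDiffAt_const.mul h3)

/-- A smooth cutoff that is `1` above height `-ε/4` and `0` below height `-ε/2`. -/
noncomputable def below (ε y : ℝ) : ℝ := Real.smoothTransition (2 + 4 * y / ε)

theorem below_eq_one {ε y : ℝ} (hε : 0 < ε) (hy : -(ε / 4) ≤ y) : below ε y = 1 := by
  refine Real.smoothTransition.one_of_one_le ?_
  rw [← sub_le_iff_le_add', le_div_iff₀ hε]
  linarith

theorem below_eq_zero {ε y : ℝ} (hε : 0 < ε) (hy : y ≤ -(ε / 2)) : below ε y = 0 := by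
  refine Real.smoothTransition.zero_of_nonpos ?_
  rw [← le_neg_iff_add_nonpos_left, div_le_iff₀ hε]
  linarith

theorem contDiff_below (ε : ℝ) : ContDiff ℝ ∞ (fun x : ℝ × ℝ => below ε x.2) :=
  Real.smoothTransition.contDiff.comp (by fun_prop)

/-- The shifted and cut conjugate function. -/
noncomputable def shifted (m : ℕ) (β : ℂ) (χ : ℝ × ℝ → ℝ) (ε : ℝ) (x : ℝ × ℝ) : ℝ :=
  χ x * (below ε x.2 * cj m β (x.1, x.2 + ε))

/-- The upward shift makes the conjugate function smooth for heights above -ε, hence across the axis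
and its singular points; `below` removes it before the shifted crack is reached. -/
theorem isTestOn_shifted (m : ℕ) (β : ℂ) {χ : ℝ × ℝ → ℝ} (hχ : IsTestOn univ χ) {ε : ℝ}
    (hε : 0 < ε) : IsTestOn univ (shifted m β χ ε) := by
  refine ⟨hχ.1.mul (contDiff_iff_contDiffAt.2 fun x => ?_), hχ.2.1.mul_right, subset_univ _⟩
  rcases lt_or_ge (-ε) x.2 with hx | hx
  · refine (contDiff_below ε).contDiffAt.mul ?_
    have h1 : ContDiffAt ℝ ∞ (cj m β) ((fun x : ℝ × ℝ => (x.1, x.2 + ε)) x) :=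
      contDiffAt_fn m _ (show 0 < x.2 + ε by linarith)
    exact h1.comp x (by fun_prop)
  · have : (fun x : ℝ × ℝ => below ε x.2 * cj m β (x.1, x.2 + ε)) =ᶠ[𝓝 x] fun _ => 0 := by
      filter_upwards [(isOpen_lt continuous_snd continuous_const).mem_nhds
        (show x.2 < -(ε / 2) by linarith)] with y hy
      rw [below_eq_zero hε (le_of_lt hy), zero_mul]
    exact contDiffAt_const.congr_of_eventuallyEq this

theorem hasFDerivAt_shifted (m : ℕ) (β : ℂ) {χ : ℝ × ℝ → ℝ} (hχ : IsTestOn univ χ) {ε : ℝ}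
    (hε : 0 < ε) {x : ℝ × ℝ} (hx : 0 ≤ x.2) :
    HasFDerivAt (shifted m β χ ε) (χ x • dotL (gd m (-Complex.I * β) (x.1, x.2 + ε)) +
      cj m β (x.1, x.2 + ε) • fderiv ℝ χ x) x := by
  have h1 : HasFDerivAt (cj m β) (dotL (gd m (-Complex.I * β) (x.1, x.2 + ε)))
      ((fun x : ℝ × ℝ => x + (0, ε)) x) := by
    have hup : (x.1, x.2 + ε) ∈ upper := show 0 < x.2 + ε by linarith
    have := hasFDerivAt_fn m (-Complex.I * β) (upper_subset hup)
    have he : x + (0, ε) = (x.1, x.2 + ε) := by simp [Prod.add_def]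
    simp only [he]
    exact this
  have h2 : HasFDerivAt (fun x : ℝ × ℝ => cj m β (x.1, x.2 + ε))
      (dotL (gd m (-Complex.I * β) (x.1, x.2 + ε))) x := by
    have := h1.comp x ((hasFDerivAt_id x).add_const (0, ε))
    rw [ContinuousLinearMap.comp_id] at this
    refine this.congr_of_eventuallyEq (Eventually.of_forall fun y => ?_)
    simp [Prod.add_def]
  refine (hχ.differentiable.differentiableAt.hasFDerivAt.mul h2).congr_of_eventuallyEq ?_
  filter_upwards [(isOpen_lt continuous_const continuous_snd).mem_nhds
    (show -(ε / 4) < x.2 by linarith)] with y hy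
  simp only [shifted, Pi.mul_apply]
  rw [below_eq_one hε (le_of_lt hy), one_mul]

/-- The rotated gradient of `χ * cj m β`, as a formula. -/
noncomputable def rotCut (m : ℕ) (β : ℂ) (χ : ℝ × ℝ → ℝ) (x y : ℝ × ℝ) : ℝ × ℝ :=
  cj m β y • rot χ x + χ x • gd m β y

/-- The tangential derivative of `χ * cj m β` on the axis, as a formula. -/
noncomputable def tanCut (m : ℕ) (β : ℂ) (χ : ℝ × ℝ → ℝ) (x y : ℝ × ℝ) : ℝ :=
  cj m β y * fderiv ℝ χ x (1, 0) + χ x * (β * dhol m (toC y)).im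

theorem rot_shifted (m : ℕ) (β : ℂ) {χ : ℝ × ℝ → ℝ} (hχ : IsTestOn univ χ) {ε : ℝ}
    (hε : 0 < ε) {x : ℝ × ℝ} (hx : 0 ≤ x.2) :
    rot (shifted m β χ ε) x = rotCut m β χ x (x.1, x.2 + ε) := by
  rw [rot, (hasFDerivAt_shifted m β hχ hε hx).fderiv]
  ext <;> simp [rotCut, rot, dotL_apply, dot, gd, mul_assoc] <;> ring

theorem tan_shifted (m : ℕ) (β : ℂ) {χ : ℝ × ℝ → ℝ} (hχ : IsTestOn univ χ) {ε : ℝ}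
    (hε : 0 < ε) (t : ℝ) :
    fderiv ℝ (shifted m β χ ε) (t, 0) (1, 0) = tanCut m β χ (t, 0) (t, ε) := by
  rw [(hasFDerivAt_shifted m β hχ hε (x := (t, 0)) (le_refl (0 : ℝ))).fderiv]
  simp [tanCut, dotL_apply, dot, gd, mul_assoc]
  ring

/-- Moving up from the closed half-plane increases the distance to both branch points, so the
unshifted bound dominates all shifts. The branch points are excluded because the inverse of zero is
zero there and the inequality would fail. -/
theorem dbound_shift_le {x : ℝ × ℝ} (hx : 0 ≤ x.2) (h0 : x ≠ (0, 0)) (h1 : x ≠ (1, 0)) {ε : ℝ}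
    (hε : 0 ≤ ε) : dbound (toC (x.1, x.2 + ε)) ≤ dbound (toC x) := by
  have key : ∀ a : ℝ, ‖toC x - a‖ ≤ ‖toC (x.1, x.2 + ε) - a‖ := by
    intro a
    rw [← sq_le_sq₀ (norm_nonneg _) (norm_nonneg _)]
    simp only [← Complex.normSq_eq_norm_sq, Complex.normSq_apply, toC, Complex.sub_re,
      Complex.sub_im, Complex.ofReal_re, Complex.ofReal_im, sub_zero]
    nlinarith
  have k0 : ‖toC x‖ ≤ ‖toC (x.1, x.2 + ε)‖ := by simpa using key 0
  have k1 : ‖toC x - 1‖ ≤ ‖toC (x.1, x.2 + ε) - 1‖ := by simpa using key 1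
  have p0 : 0 < ‖toC x‖ := norm_pos_iff.2 (by simpa using toC_ne_of_ne h0)
  have p1 : 0 < ‖toC x - 1‖ := norm_pos_iff.2 (sub_ne_zero.2 (by simpa using toC_ne_of_ne h1))
  unfold dbound
  gcongr

theorem dmaj_shift_le (m : ℕ) {x : ℝ × ℝ} (hx : 0 ≤ x.2) (h0 : x ≠ (0, 0)) (h1 : x ≠ (1, 0))
    {ε : ℝ} (hε : 0 ≤ ε) : dmaj m (x.1, x.2 + ε) ≤ dmaj m x := by
  unfold dmaj
  have := (hbound_pos m).le
  gcongr
  exact dbound_shift_le hx h0 h1 hε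

/-- These are the singularities for which the traces have to be integrable against |t - t₀|^(-1/2),
with t₀ = 0 and t₀ = 1. -/
theorem dmaj_axis_le (m : ℕ) (t : ℝ) :
    dmaj m (t, 0) ≤ hbound m * ((√|t - 0|)⁻¹ + (√|t - 1|)⁻¹) := by
  unfold dmaj
  have := (hbound_pos m).le
  gcongr
  have hn : ‖toC (t, 0)‖ = |t - 0| := by rw [toC_axis, Complex.norm_real, sub_zero]; rfl
  have hn1 : ‖toC (t, 0) - 1‖ = |t - 1| := by
    rw [toC_axis, ← Complex.ofReal_one, ← Complex.ofReal_sub, Complex.norm_real]; rfl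
  have hs := one_le_norm_add (toC (t, 0))
  have hd : dbound (toC (t, 0)) ≤ |t - 0|⁻¹ + |t - 1|⁻¹ := by
    rw [dbound, hn, hn1] at *
    refine div_le_self (by positivity) (one_le_pow₀ hs)
  refine (Real.sqrt_le_sqrt hd).trans ?_
  rw [← Real.sqrt_inv, ← Real.sqrt_inv]
  refine Real.sqrt_le_iff.2 ⟨by positivity, ?_⟩
  have e1 := Real.sq_sqrt (show 0 ≤ |t - 0|⁻¹ by positivity)
  have e2 := Real.sq_sqrt (show 0 ≤ |t - 1|⁻¹ by positivity)
  have e3 : 0 ≤ √(|t - 0|⁻¹) * √(|t - 1|⁻¹) := by positivity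
  nlinarith

/-- The sequence of vertical shifts that tends to zero. -/
noncomputable def eps (n : ℕ) : ℝ := 1 / ((n : ℝ) + 1)

theorem eps_pos (n : ℕ) : 0 < eps n := by unfold eps; positivity

theorem tendsto_shift (x : ℝ × ℝ) {S : Set (ℝ × ℝ)} (hS : ∀ n, (x.1, x.2 + eps n) ∈ S) :
    Tendsto (fun n => (x.1, x.2 + eps n)) atTop (𝓝[S] x) := by
  refine tendsto_nhdsWithin_iff.2 ⟨?_, Eventually.of_forall hS⟩
  have : Tendsto eps atTop (𝓝 0) := tendsto_one_div_add_atTop_nhds_zero_nat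
  have h2 := (tendsto_const_nhds (x := x.1)).prodMk_nhds ((tendsto_const_nhds (x := x.2)).add this)
  simpa using h2

theorem tendsto_cj_shift (m : ℕ) (β : ℂ) {x : ℝ × ℝ} (hx : 0 ≤ x.2) :
    Tendsto (fun n => cj m β (x.1, x.2 + eps n)) atTop (𝓝 (cj m β x)) :=
  (continuousOn_fn m _ x hx).tendsto.comp
    (tendsto_shift x fun n => add_nonneg hx (eps_pos n).le)

theorem tendsto_gd_shift (m : ℕ) (β : ℂ) {x : ℝ × ℝ} (hx : 0 ≤ x.2) (h0 : x ≠ (0, 0))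
    (h1 : x ≠ (1, 0)) :
    Tendsto (fun n => gd m β (x.1, x.2 + eps n)) atTop (𝓝 (gd m β x)) := by
  refine (continuousOn_gd m β x ⟨hx, h0, h1⟩).tendsto.comp (tendsto_shift x fun n => ?_)
  have hp : 0 < x.2 + eps n := add_pos_of_nonneg_of_pos hx (eps_pos n)
  refine ⟨hp.le, ?_, ?_⟩
  · exact fun h => hp.ne' (congrArg Prod.snd h)
  · exact fun h => hp.ne' (congrArg Prod.snd h)

theorem upper_ne {x : ℝ × ℝ} (hx : x ∈ upper) (a : ℝ) : x ≠ (a, 0) := by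
  rintro rfl; exact axis_notMem_upper a hx

theorem norm_cj_le (m : ℕ) (β : ℂ) (x : ℝ × ℝ) : ‖cj m β x‖ ≤ ‖β‖ * hbound m := by
  have := norm_fn_le m (-Complex.I * β) x
  rwa [norm_mul, norm_neg, Complex.norm_I, one_mul] at this

theorem ae_ne_real (a : ℝ) : ∀ᵐ t : ℝ, t ≠ a := by simp [ae_iff]

theorem aestronglyMeasurable_mul_tanCut {p : ℝ → ℝ} (hp : LocallyIntegrable p) (m : ℕ) (β : ℂ)
    {χ : ℝ × ℝ → ℝ} (hχ : IsTestOn univ χ) (ε : ℝ) :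
    AEStronglyMeasurable (fun t => p t * tanCut m β χ (t, 0) (t, ε)) := by
  have hcax : Continuous fun t : ℝ => χ (t, 0) := hχ.continuous.comp (by fun_prop)
  have hcax' : Continuous fun t : ℝ => fderiv ℝ χ (t, 0) (1, 0) :=
    (hχ.fderiv (1, 0)).continuous.comp (by fun_prop)
  have hs : Measurable fun t : ℝ => (t, ε) := by fun_prop
  have h1 : Measurable fun t : ℝ => cj m β (t, ε) := (measurable_fn m _).comp hs
  have h2 : Measurable fun t : ℝ => (β * dhol m (toC (t, ε))).im :=
    Complex.measurable_im.comp
      (((measurable_dhol m).comp (continuous_toC.measurable.comp hs)).const_mul β)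
  exact hp.aestronglyMeasurable.mul ((h1.mul hcax'.measurable).add
    (hcax.measurable.mul h2)).aestronglyMeasurable

/-- One bound serves all shifts: raising the point does not increase the majorant of F', and its
inverse square root singularities on the axis are absorbed by the weighted integrability of p. -/
theorem RotTrace.exists_tanCut_bound {g : ℝ × ℝ → ℝ × ℝ} {p : ℝ → ℝ} (h : RotTrace g p) (m : ℕ)
    (β : ℂ) {χ : ℝ × ℝ → ℝ} (hχ : IsTestOn univ χ) :
    ∃ B : ℝ → ℝ, Integrable B ∧ ∀ ε, 0 ≤ ε →
      ∀ᵐ t, ‖p t * tanCut m β χ (t, 0) (t, ε)‖ ≤ B t := by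
  have hb := (hbound_pos m).le
  have hcax : Continuous fun t : ℝ => χ (t, 0) := hχ.continuous.comp (by fun_prop)
  have hcsax : HasCompactSupport fun t : ℝ => χ (t, 0) :=
    HasCompactSupport.intro (hχ.2.1.isCompact.image continuous_fst) fun t ht =>
      image_eq_zero_of_notMem_tsupport fun hx => ht ⟨(t, 0), hx, rfl⟩
  have hφ := hχ.fderiv (1, 0)
  have hcax' : Continuous fun t : ℝ => fderiv ℝ χ (t, 0) (1, 0) :=
    hφ.continuous.comp (by fun_prop)
  have hcsax' : HasCompactSupport fun t : ℝ => fderiv ℝ χ (t, 0) (1, 0) :=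
    HasCompactSupport.intro (hφ.2.1.isCompact.image continuous_fst) fun t ht =>
      image_eq_zero_of_notMem_tsupport (f := fun x => fderiv ℝ χ x (1, 0))
        fun hx => ht ⟨(t, 0), hx, rfl⟩
  refine ⟨fun t => ‖β‖ * hbound m * ‖p t * fderiv ℝ χ (t, 0) (1, 0)‖ + ‖β‖ * hbound m *
    (‖p t * χ (t, 0) * (√|t - 0|)⁻¹‖ + ‖p t * χ (t, 0) * (√|t - 1|)⁻¹‖),
    ((locallyIntegrable_mul_axis h.trace hcax' hcsax').norm.const_mul _).add
      (((h.weighted 0 _ hcax hcsax).norm.add (h.weighted 1 _ hcax hcsax).norm).const_mul _),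
    fun ε hε => ?_⟩
  filter_upwards [ae_ne_real 0, ae_ne_real 1] with t ht0 ht1
  have hcj := norm_cj_le m β (t, ε)
  have hd : ‖(β * dhol m (toC (t, ε))).im‖
      ≤ ‖β‖ * (hbound m * ((√|t - 0|)⁻¹ + (√|t - 1|)⁻¹)) := by
    refine (Complex.abs_im_le_norm _).trans ?_
    rw [norm_mul]
    gcongr
    refine (norm_dhol_le m _).trans (le_trans ?_ (dmaj_axis_le m t))
    have := dmaj_shift_le m (x := (t, 0)) (le_refl (0 : ℝ)) (by simpa using ht0)
      (by simpa using ht1) hε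
    simpa using this
  have hr0 : ‖(√|t - 0|)⁻¹‖ = (√|t - 0|)⁻¹ := Real.norm_of_nonneg (by positivity)
  have hr1 : ‖(√|t - 1|)⁻¹‖ = (√|t - 1|)⁻¹ := Real.norm_of_nonneg (by positivity)
  rw [norm_mul]
  calc ‖p t‖ * ‖tanCut m β χ (t, 0) (t, ε)‖
      ≤ ‖p t‖ * (‖β‖ * hbound m * ‖fderiv ℝ χ (t, 0) (1, 0)‖ +
        ‖χ (t, 0)‖ * (‖β‖ * (hbound m * ((√|t - 0|)⁻¹ + (√|t - 1|)⁻¹)))) := by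
        gcongr
        refine (norm_add_le _ _).trans ?_
        rw [norm_mul, norm_mul]
        gcongr
    _ = _ := by
        rw [norm_mul, norm_mul, norm_mul, norm_mul, norm_mul, hr0, hr1]
        ring

theorem RotTrace.integrable_tanCut {g : ℝ × ℝ → ℝ × ℝ} {p : ℝ → ℝ} (h : RotTrace g p) (m : ℕ)
    (β : ℂ) {χ : ℝ × ℝ → ℝ} (hχ : IsTestOn univ χ) :
    Integrable (fun t => p t * tanCut m β χ (t, 0) (t, 0)) := by
  obtain ⟨B, hB, hle⟩ := h.exists_tanCut_bound m β hχ
  exact hB.mono' (aestronglyMeasurable_mul_tanCut h.trace m β hχ 0) (hle 0 le_rfl)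

/-- The rotation identity tested with `χ * cj m β`. -/
theorem RotTrace.cut {g : ℝ × ℝ → ℝ × ℝ} {p : ℝ → ℝ} (h : RotTrace g p) (m : ℕ) (β : ℂ)
    {χ : ℝ × ℝ → ℝ} (hχ : IsTestOn univ χ) :
    ∫ x in upper, dot (g x) (rotCut m β χ x x) = ∫ t : ℝ, p t * tanCut m β χ (t, 0) (t, 0) := by
  obtain ⟨C, hC⟩ := hχ.bound
  have hC0 : 0 ≤ C := (norm_nonneg _).trans (hC 0)
  have hb := (hbound_pos m).le
  have lim1 : Tendsto (fun n => ∫ x in upper, dot (g x) (rotCut m β χ x (x.1, x.2 + eps n)))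
      atTop (𝓝 (∫ x in upper, dot (g x) (rotCut m β χ x x))) := by
    refine tendsto_integral_of_dominated_convergence
      (fun x => 2 * (‖β‖ * hbound m) * (‖g x‖ * ‖rot χ x‖) + 2 * (C * ‖β‖) * (‖g x‖ * dmaj m x))
      (fun n => ?_) ?_ (fun n => ?_) ?_
    · have hm : Measurable fun x : ℝ × ℝ => rotCut m β χ x (x.1, x.2 + eps n) := by
        have hs : Measurable fun x : ℝ × ℝ => (x.1, x.2 + eps n) := by fun_prop
        exact (((measurable_fn m _).comp hs).smul (continuous_rot hχ).measurable).add
          (hχ.continuous.measurable.smul ((measurable_gd m β).comp hs))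
      have hg := h.memLp.aestronglyMeasurable
      have hm' : AEStronglyMeasurable (fun x : ℝ × ℝ => rotCut m β χ x (x.1, x.2 + eps n))
        (volume.restrict upper) := hm.aestronglyMeasurable
      exact (hg.fst.mul hm'.fst).add (hg.snd.mul hm'.snd)
    · have hr := ((memLp_rot hχ).restrict upper).norm
      have hd := (memLp_dmaj m).restrict upper
      exact ((h.memLp.norm.integrable_mul hr).const_mul _).add
        ((h.memLp.norm.integrable_mul hd).const_mul _)
    · filter_upwards [ae_restrict_mem isOpen_upper.measurableSet] with x hx
      have hcj := norm_cj_le m β (x.1, x.2 + eps n)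
      have hgd : ‖gd m β (x.1, x.2 + eps n)‖ ≤ ‖β‖ * dmaj m x :=
        (norm_gd_le m β _).trans (by
          gcongr
          exact dmaj_shift_le m (le_of_lt hx) (upper_ne hx 0) (upper_ne hx 1) (eps_pos n).le)
      have hn : ‖rotCut m β χ x (x.1, x.2 + eps n)‖
          ≤ ‖β‖ * hbound m * ‖rot χ x‖ + C * (‖β‖ * dmaj m x) := by
        refine (norm_add_le _ _).trans ?_
        rw [norm_smul, norm_smul]
        gcongr
        exact hC x
      refine (abs_dot_le _ _).trans ?_
      calc 2 * (‖g x‖ * ‖rotCut m β χ x (x.1, x.2 + eps n)‖)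
          ≤ 2 * (‖g x‖ * (‖β‖ * hbound m * ‖rot χ x‖ + C * (‖β‖ * dmaj m x))) := by gcongr
        _ = _ := by ring
    · filter_upwards [ae_restrict_mem isOpen_upper.measurableSet] with x hx
      have t1 := tendsto_cj_shift m β (le_of_lt hx : 0 ≤ x.2)
      have t2 := tendsto_gd_shift m β (le_of_lt hx : 0 ≤ x.2) (upper_ne hx 0) (upper_ne hx 1)
      have t3 : Tendsto (fun n => rotCut m β χ x (x.1, x.2 + eps n)) atTop
          (𝓝 (rotCut m β χ x x)) := (t1.smul_const _).add (t2.const_smul _)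
      have : Continuous (dot (g x)) := by unfold dot; fun_prop
      exact (this.tendsto _).comp t3
  obtain ⟨B, hB, hle⟩ := h.exists_tanCut_bound m β hχ
  have lim2 : Tendsto (fun n => ∫ t, p t * tanCut m β χ (t, 0) (t, eps n))
      atTop (𝓝 (∫ t, p t * tanCut m β χ (t, 0) (t, 0))) := by
    refine tendsto_integral_of_dominated_convergence B
      (fun n => aestronglyMeasurable_mul_tanCut h.trace m β hχ _) hB
      (fun n => hle _ (eps_pos n).le) ?_
    · filter_upwards [ae_ne_real 0, ae_ne_real 1] with t ht0 ht1
      have t1 := tendsto_cj_shift m β (x := (t, 0)) (le_refl (0 : ℝ))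
      have t2 := tendsto_gd_shift m β (x := (t, 0)) (le_refl (0 : ℝ)) (by simpa using ht0)
        (by simpa using ht1)
      have t3 := ((continuous_snd.tendsto _).comp t2).neg
      simp only [Function.comp_def, gd, neg_neg, zero_add] at t1 t3
      exact ((t1.mul_const _).add (t3.const_mul _)).const_mul _
  -- For each shift both integrals agree by the rotation identity; hence so do their limits.
  refine tendsto_nhds_unique lim1 (lim2.congr fun n => ?_)
  have := h.rot_eq _ (isTestOn_shifted m β hχ (eps_pos n))
  simp only [tan_shifted m β hχ (eps_pos n)] at this
  rw [← this]
  refine setIntegral_congr_fun isOpen_upper.measurableSet fun x hx => ?_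
  simp only [rot_shifted m β hχ (eps_pos n) (le_of_lt hx : 0 ≤ x.2)]

/-! ### Removing the cutoff -/

/-- A cutoff at distance `n + 1`. -/
noncomputable def bigCut (n : ℕ) (x : ℝ × ℝ) : ℝ := vcut (x.1 / (n + 1)) * vcut (x.2 / (n + 1))

theorem isTestOn_bigCut (n : ℕ) : IsTestOn univ (bigCut n) := by
  have hn : (0 : ℝ) < n + 1 := by positivity
  refine ⟨(contDiff_vcut.comp (by fun_prop)).mul (contDiff_vcut.comp (by fun_prop)), ?_,
    subset_univ _⟩
  refine HasCompactSupport.intro (K := Icc (-(2 * (n + 1) : ℝ)) (2 * (n + 1)) ×ˢ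
    Icc (-(2 * (n + 1) : ℝ)) (2 * (n + 1))) (isCompact_Icc.prod isCompact_Icc) fun x hx => ?_
  have key : ∀ s : ℝ, s ∉ Icc (-(2 * (n + 1) : ℝ)) (2 * (n + 1)) → vcut (s / (n + 1)) = 0 := by
    intro s hs
    refine vcut_eq_zero ?_
    rw [abs_div, abs_of_pos hn, le_div_iff₀ hn]
    by_contra hlt
    exact hs (abs_le.1 (not_le.1 hlt).le)
  rw [mem_prod, not_and_or] at hx
  rcases hx with h | h
  · rw [bigCut, key _ h, zero_mul]
  · rw [bigCut, key _ h, mul_zero]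

theorem rot_bigCut (n : ℕ) (x : ℝ × ℝ) : rot (bigCut n) x =
    (vcut (x.1 / (n + 1)) * (deriv vcut (x.2 / (n + 1)) / (n + 1)),
      -(deriv vcut (x.1 / (n + 1)) / (n + 1) * vcut (x.2 / (n + 1)))) := by
  have hv : ∀ s : ℝ, HasDerivAt vcut (deriv vcut s) s := fun s =>
    (contDiff_vcut.differentiable (by simp)).differentiableAt.hasDerivAt
  have h1 : HasFDerivAt (fun x : ℝ × ℝ => vcut (x.1 / (n + 1)))
      (deriv vcut (x.1 / (n + 1)) • (((n : ℝ) + 1)⁻¹ • ContinuousLinearMap.fst ℝ ℝ ℝ)) x := by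
    refine (hv _).comp_hasFDerivAt x ?_
    simpa [div_eq_inv_mul] using (hasFDerivAt_fst (𝕜 := ℝ) (p := x)).const_mul ((n : ℝ) + 1)⁻¹
  have h2 : HasFDerivAt (fun x : ℝ × ℝ => vcut (x.2 / (n + 1)))
      (deriv vcut (x.2 / (n + 1)) • (((n : ℝ) + 1)⁻¹ • ContinuousLinearMap.snd ℝ ℝ ℝ)) x := by
    refine (hv _).comp_hasFDerivAt x ?_
    simpa [div_eq_inv_mul] using (hasFDerivAt_snd (𝕜 := ℝ) (p := x)).const_mul ((n : ℝ) + 1)⁻¹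
  have h3 : HasFDerivAt (bigCut n) _ x := h1.mul h2
  rw [rot, h3.fderiv]
  refine Prod.ext ?_ ?_
  · simp [div_eq_mul_inv]
  · simp [div_eq_mul_inv, -mul_eq_mul_left_iff]
    ring

theorem vcut_eq_one {s : ℝ} (hs : |s| ≤ 1) : vcut s = 1 :=
  vcut.one_of_mem_closedBall (by simpa [vcut] using hs)

theorem norm_le_of_div {n : ℕ} {x : ℝ × ℝ} (hx : ‖x‖ < n + 1) :
    |x.1 / ((n : ℝ) + 1)| < 1 ∧ |x.2 / ((n : ℝ) + 1)| < 1 := by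
  have hn : (0 : ℝ) < n + 1 := by positivity
  have h1 : |x.1| ≤ ‖x‖ := norm_fst_le x
  have h2 : |x.2| ≤ ‖x‖ := norm_snd_le x
  rw [abs_div, abs_div, abs_of_pos hn, div_lt_one hn, div_lt_one hn]
  exact ⟨by linarith, by linarith⟩

theorem bigCut_eq_one {n : ℕ} {x : ℝ × ℝ} (hx : ‖x‖ < n + 1) : bigCut n x = 1 := by
  obtain ⟨h1, h2⟩ := norm_le_of_div hx
  rw [bigCut, vcut_eq_one h1.le, vcut_eq_one h2.le, mul_one]

theorem rot_bigCut_eq_zero {n : ℕ} {x : ℝ × ℝ} (hx : ‖x‖ < n + 1) : rot (bigCut n) x = 0 := by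
  obtain ⟨h1, h2⟩ := norm_le_of_div hx
  rw [rot_bigCut, deriv_vcut_eq_zero h1, deriv_vcut_eq_zero h2]
  simp

theorem abs_vcut_le (s : ℝ) : |vcut s| ≤ 1 := by
  rw [abs_of_nonneg vcut.nonneg]; exact vcut.le_one

/-- The derivative is of order 1/(n+1) and vanishes for ‖x‖ > 2(n+1). -/
theorem exists_rot_bigCut_bound : ∃ C, 0 ≤ C ∧ ∀ n x, ‖rot (bigCut n) x‖ * ‖x‖ ≤ C := by
  obtain ⟨C, hC⟩ := exists_deriv_vcut_bound
  have hC0 : 0 ≤ C := (norm_nonneg _).trans (hC 0)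
  refine ⟨2 * C, by positivity, fun n x => ?_⟩
  have hn : (0 : ℝ) < n + 1 := by positivity
  have hz : ∀ a b : ℝ, 2 * ((n : ℝ) + 1) < |a| ∨ 2 * ((n : ℝ) + 1) < |b| →
      vcut (a / (n + 1)) * (deriv vcut (b / (n + 1)) / (n + 1)) = 0 := by
    intro a b hab
    rcases hab with h | h
    · rw [vcut_eq_zero, zero_mul]
      rw [abs_div, abs_of_pos hn, le_div_iff₀ hn]; exact h.le
    · rw [deriv_vcut_eq_zero']
      · simp
      rw [abs_div, abs_of_pos hn, lt_div_iff₀ hn]; exact h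
  by_cases hx : 2 * ((n : ℝ) + 1) < ‖x‖
  · have h12 : 2 * ((n : ℝ) + 1) < |x.1| ∨ 2 * ((n : ℝ) + 1) < |x.2| := by
      rw [Prod.norm_def] at hx
      exact lt_sup_iff.1 hx
    rw [rot_bigCut, hz _ _ h12, mul_comm (deriv vcut (x.1 / _) / _), hz _ _ h12.symm]
    simpa using by positivity
  · have hle : ‖rot (bigCut n) x‖ ≤ C / (n + 1) := by
      have hb : ∀ a b : ℝ, |vcut (a / (n + 1)) * (deriv vcut (b / (n + 1)) / (n + 1))|
          ≤ C / (n + 1) := by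
        intro a b
        rw [abs_mul, abs_div, abs_of_pos hn]
        calc _ ≤ 1 * (C / (n + 1)) := by
              gcongr
              · exact abs_vcut_le _
              · exact hC _
          _ = _ := one_mul _
      rw [rot_bigCut, Prod.norm_def]
      refine sup_le (hb _ _) ?_
      rw [norm_neg, mul_comm]
      exact hb _ _
    calc ‖rot (bigCut n) x‖ * ‖x‖ ≤ C / (n + 1) * (2 * (n + 1)) := by
          gcongr
          exact not_lt.1 hx
      _ = _ := by field_simp

theorem norm_toC_le (x : ℝ × ℝ) : ‖toC x‖ ≤ 2 * ‖x‖ := by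
  have h1 : |x.1| ≤ ‖x‖ := norm_fst_le x
  have h2 : |x.2| ≤ ‖x‖ := norm_snd_le x
  have := Complex.norm_le_abs_re_add_abs_im (toC x)
  simp only [toC] at this ⊢
  linarith

theorem le_norm_toC (x : ℝ × ℝ) : ‖x‖ ≤ ‖toC x‖ := by
  rw [Prod.norm_def]
  exact sup_le (Complex.abs_re_le_norm (toC x)) (Complex.abs_im_le_norm (toC x))

/-- The term with the derivative of the cutoff is dominated by the gradient majorant. -/
theorem exists_norm_cj_smul_rot_le (m : ℕ) (β : ℂ) : ∃ C, 0 ≤ C ∧ ∀ n x,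
    ‖cj m β x • rot (bigCut n) x‖ ≤ C * dmaj m x := by
  obtain ⟨C, hC0, hC⟩ := exists_rot_bigCut_bound
  refine ⟨4 * (‖β‖ * C), by positivity, fun n x => ?_⟩
  have hdm := dmaj_nonneg m x
  rcases lt_or_ge ‖x‖ 1 with hx | hx
  · rw [rot_bigCut_eq_zero (by linarith [(Nat.cast_nonneg n : (0 : ℝ) ≤ n)]), smul_zero, norm_zero]
    positivity
  have hb := hbound_pos m
  set z := toC x with hz
  have hz1 : 1 ≤ ‖z‖ := hx.trans (le_norm_toC x)
  have hz2 : ‖z‖ ≤ 2 * ‖x‖ := norm_toC_le x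
  have hz3 : ‖z‖ + ‖z - 1‖ ≤ 3 * ‖z‖ := by
    have := norm_sub_le z 1
    rw [norm_one] at this
    linarith
  have hS : 0 < ‖z‖ + ‖z - 1‖ := by linarith [one_le_norm_add z]
  have hhol : ‖hol m z‖ ≤ hbound m / √(‖z‖ + ‖z - 1‖) := by
    rw [le_div_iff₀ (Real.sqrt_pos.2 hS)]
    refine abs_le_of_sq_le_sq' ?_ hb.le |>.2
    rw [mul_pow, Real.sq_sqrt hS.le]
    exact norm_hol_sq_mul_le m z
  have hdb : 1 / (√(‖z‖ + ‖z - 1‖) * ‖x‖) ≤ 4 * √(dbound z) := by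
    have h1 : ‖z‖⁻¹ / (‖z‖ + ‖z - 1‖) ^ 2 ≤ dbound z := by
      unfold dbound
      gcongr
      simp
    rw [show (4 : ℝ) * √(dbound z) = √(16 * dbound z) by
      rw [Real.sqrt_mul (by norm_num), show (16 : ℝ) = 4 ^ 2 by norm_num, Real.sqrt_sq]
      norm_num]
    refine Real.le_sqrt_of_sq_le (le_trans ?_ (mul_le_mul_of_nonneg_left h1 (by norm_num)))
    have hx0 : 0 < ‖x‖ := by linarith
    have hz0 : 0 < ‖z‖ := by linarith
    rw [div_pow, mul_pow, Real.sq_sqrt hS.le, one_pow, mul_div_assoc', inv_eq_one_div,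
      mul_one_div, div_div, div_le_div_iff₀ (by positivity) (by positivity)]
    have : ‖z‖ * (‖z‖ + ‖z - 1‖) ≤ 16 * ‖x‖ ^ 2 := by nlinarith
    nlinarith
  have hcj : ‖cj m β x‖ ≤ ‖β‖ * ‖hol m z‖ := by
    have := norm_fn_le' m (-Complex.I * β) x
    rwa [norm_mul, norm_neg, Complex.norm_I, one_mul] at this
  have hr : ‖rot (bigCut n) x‖ ≤ C / ‖x‖ := by
    rw [le_div_iff₀ (by linarith)]; exact hC n x
  rw [norm_smul]
  calc ‖cj m β x‖ * ‖rot (bigCut n) x‖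
      ≤ (‖β‖ * (hbound m / √(‖z‖ + ‖z - 1‖))) * (C / ‖x‖) := by
        gcongr
        exact hcj.trans (by gcongr)
    _ = ‖β‖ * C * hbound m * (1 / (√(‖z‖ + ‖z - 1‖) * ‖x‖)) := by field_simp
    _ ≤ ‖β‖ * C * hbound m * (4 * √(dbound z)) := by gcongr
    _ = _ := by rw [dmaj]; ring

/-- On the volume side dominated convergence applies, the majorant of F' being square integrable.
The axis integral is kept as a sequence; it is evaluated only after both half-planes are added, when
the contributions away from [0, 1] cancel. -/
theorem RotTrace.tendsto_cut {g : ℝ × ℝ → ℝ × ℝ} {p : ℝ → ℝ} (h : RotTrace g p) (m : ℕ) (β : ℂ) :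
    Tendsto (fun n => ∫ t, p t * tanCut m β (bigCut n) (t, 0) (t, 0)) atTop
      (𝓝 (∫ x in upper, dot (g x) (gd m β x))) := by
  obtain ⟨C, hC0, hC⟩ := exists_norm_cj_smul_rot_le m β
  simp only [← h.cut m β (isTestOn_bigCut _)]
  refine tendsto_integral_of_dominated_convergence
    (fun x => 2 * (C + ‖β‖) * (‖g x‖ * dmaj m x)) (fun n => ?_) ?_ (fun n => ?_) ?_
  · have hm : Measurable fun x : ℝ × ℝ => rotCut m β (bigCut n) x x :=
      ((measurable_fn m _).smul (continuous_rot (isTestOn_bigCut n)).measurable).add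
        ((isTestOn_bigCut n).continuous.measurable.smul (measurable_gd m β))
    have hg := h.memLp.aestronglyMeasurable
    have hm' : AEStronglyMeasurable (fun x : ℝ × ℝ => rotCut m β (bigCut n) x x)
      (volume.restrict upper) := hm.aestronglyMeasurable
    exact (hg.fst.mul hm'.fst).add (hg.snd.mul hm'.snd)
  · exact (h.memLp.norm.integrable_mul ((memLp_dmaj m).restrict upper)).const_mul _
  · refine Eventually.of_forall fun x => ?_
    have hb1 : ‖bigCut n x‖ ≤ 1 := by
      rw [bigCut, norm_mul]
      exact mul_le_one₀ (abs_vcut_le _) (norm_nonneg _) (abs_vcut_le _)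
    have hdm := dmaj_nonneg m x
    have hn : ‖rotCut m β (bigCut n) x x‖ ≤ C * dmaj m x + 1 * (‖β‖ * dmaj m x) := by
      refine (norm_add_le _ _).trans (add_le_add (hC n x) ?_)
      rw [norm_smul]
      gcongr
      exact norm_gd_le m β x
    refine (abs_dot_le _ _).trans ?_
    calc 2 * (‖g x‖ * ‖rotCut m β (bigCut n) x x‖)
        ≤ 2 * (‖g x‖ * (C * dmaj m x + 1 * (‖β‖ * dmaj m x))) := by gcongr
      _ = _ := by ring
  · refine Eventually.of_forall fun x => ?_
    refine tendsto_const_nhds.congr' ?_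
    obtain ⟨N, hN⟩ := exists_nat_gt ‖x‖
    filter_upwards [eventually_ge_atTop N] with n hn
    have hn' : ‖x‖ < n + 1 := by
      have : (N : ℝ) ≤ n := by exact_mod_cast hn
      linarith
    rw [rotCut, rot_bigCut_eq_zero hn', bigCut_eq_one hn', smul_zero, zero_add, one_smul]

/-! ### Orthogonality -/

/-- F' commutes with conjugation off the crack, so reflection amounts to conjugating β, that is, to
changing the sign of c. -/
theorem refl_gd_refl (m : ℕ) (β : ℂ) {x : ℝ × ℝ} (hx : x ∈ upper) :
    refl (gd m β (refl x)) = gd m (starRingEnd ℂ β) x := by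
  have h := dhol_conj m (toC_sub_one_mem (upper_subset hx))
  rw [gd, toC_refl, h, gd, ← Complex.conj_conj β, ← map_mul]
  simp [refl]
  ring

theorem integral_dot_gd_lower {g : ℝ × ℝ → ℝ × ℝ} (m : ℕ) (β : ℂ) :
    ∫ x in lower, dot (g x) (gd m β x)
      = ∫ x in upper, dot (refl (g (refl x))) (gd m (starRingEnd ℂ β) x) := by
  rw [← setIntegral_refl, refl_preimage_lower]
  refine setIntegral_congr_fun isOpen_upper.measurableSet fun x hx => ?_
  simp only [← refl_gd_refl m β hx, dot_refl_left, refl_refl]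

theorem tanCut_axis (m : ℕ) (s c : ℝ) (χ : ℝ × ℝ → ℝ) (t : ℝ) :
    tanCut m (s - c * Complex.I) χ (t, 0) (t, 0)
      = (s * (hol m t).im - c * (hol m t).re) * fderiv ℝ χ (t, 0) (1, 0)
        + χ (t, 0) * (s * (dhol m t).im - c * (dhol m t).re) := by
  rw [tanCut, cj_eq, toC_axis]
  simp
  ring

/-- The Euler-Lagrange equation. Add the axis integrals from both sides, with c replaced by -c
below. For t < 1, q = -p leaves the multiple -2c p of Re F and Re F', which vanish for t < 0 and
give the weight on (0, 1), where the cutoff is 1. For t > 1, p = q leaves a multiple of Im F and Im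
F', which vanish. -/
theorem integral_dot_gd {g : ℝ × ℝ → ℝ × ℝ} {p q : ℝ → ℝ} (m : ℕ) (s c : ℝ)
    (hg : MemLp g 2) (hp : RotTrace g p) (hq : RotTrace (fun x => refl (g (refl x))) q)
    (hsum : ∀ᵐ t : ℝ, t ≤ 1 → p t + q t = 0) (hdiff : ∀ᵐ t : ℝ, 1 < t → p t = q t) :
    ∫ x, dot (g x) (gd m (s - c * Complex.I) x) = -(((2 * m + 1 : ℕ) : ℝ) * c *
      ∫ t in Icc (0 : ℝ) 1, t ^ (((2 * m + 1 : ℕ) : ℝ) / 2 - 1) * p t) := by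
  have hconj : starRingEnd ℂ ((s : ℂ) - c * Complex.I) = (s : ℂ) - (-c : ℝ) * Complex.I := by
    simp
  rw [integral_eq_upper_add_lower (integrable_dot hg (memLp_gd m _)), integral_dot_gd_lower, hconj]
  refine tendsto_nhds_unique ((hp.tendsto_cut m _).add (hq.tendsto_cut m _))
    (tendsto_const_nhds.congr' ?_)
  filter_upwards [eventually_ge_atTop 1] with n hn
  have hn1 : (1 : ℝ) ≤ n := by exact_mod_cast hn
  have hχ := isTestOn_bigCut n
  rw [← integral_add (hp.integrable_tanCut m _ hχ) (hq.integrable_tanCut m _ hχ),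
    ← integral_const_mul, ← integral_neg, ← integral_indicator measurableSet_Icc]
  refine integral_congr_ae ?_
  filter_upwards [hsum, hdiff, ae_ne_real 0, ae_ne_real 1] with t h1 h2 ht0 ht1
  simp only [tanCut_axis]
  rcases lt_or_gt_of_ne ht1 with ht | ht
  · have hq' : q t = -p t := by linarith [h1 ht.le]
    rcases lt_or_gt_of_ne ht0 with h0 | h0
    · rw [indicator_of_notMem (fun h => absurd h.1 (not_le.2 h0)), hol_re_of_nonpos m h0.le,
        dhol_re_of_neg m h0, hq']
      ring
    · have hnorm : ‖((t, 0) : ℝ × ℝ)‖ < n + 1 := by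
        rw [Prod.norm_def]
        simp only [norm_zero, Real.norm_eq_abs]
        rw [abs_of_pos h0, sup_eq_left.2 h0.le]
        linarith
      have hd : fderiv ℝ (bigCut n) (t, 0) (1, 0) = 0 := by
        have := congrArg Prod.snd (rot_bigCut_eq_zero hnorm)
        simpa [rot] using this
      rw [indicator_of_mem (show t ∈ Icc (0 : ℝ) 1 from ⟨h0.le, ht.le⟩), hd, bigCut_eq_one hnorm,
        dhol_re_of_mem m h0 ht, hq']
      ring
  · rw [indicator_of_notMem (fun h => absurd h.2 (not_le.2 ht)), hol_im_of_ge m ht.le,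
      dhol_im_of_gt m ht, h2 ht]
    ring

/-! ### Admissible functions -/

theorem memLp_refl {g : ℝ × ℝ → ℝ × ℝ} (hg : MemLp g 2) :
    MemLp (fun x => refl (g (refl x))) 2 := by
  have h := hg.comp_measurePreserving measurePreserving_refl
  refine h.mono ?_ (Eventually.of_forall fun x => by simp [norm_refl])
  have hc : Continuous refl := by rw [← coe_reflL]; exact reflL.continuous
  exact hc.comp_aestronglyMeasurable h.aestronglyMeasurable

/-- What the variational argument needs to know about an element of `XTilde`. -/
structure Admissible (g : ℝ × ℝ → ℝ × ℝ) (p q : ℝ → ℝ) : Prop where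
  memLp : MemLp g 2
  above : RotTrace g p
  below : RotTrace (fun x => refl (g (refl x))) q
  left : ∀ᵐ t : ℝ, t ≤ 0 → p t + q t = 0
  right : ∀ᵐ t : ℝ, 1 < t → p t = q t

/-- By uniqueness of weak gradients and traces, the data named in the energy inherit what `XTilde`
asserts of some gradient and some traces. -/
theorem admissible_of_mem {v : ℝ × ℝ → ℝ} {g : ℝ × ℝ → ℝ × ℝ} {p q : ℝ → ℝ} (hv : v ∈ XTilde)
    (hg : HasWeakGrad crackᶜ v g) (hp : IsUpperTrace v p) (hq : IsLowerTrace v q) :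
    Admissible g p q := by
  obtain ⟨-, -, ⟨g', hg', hm'⟩, p', q', hp', hq', hsum⟩ := hv
  have hgg := hg'.ae_eq isClosed_crack.isOpen_compl hg
  rw [restrict_crack_compl] at hm' hgg
  have hm : MemLp g 2 := hm'.ae_eq hgg
  have gp := IsTrace.greenOn isOpen_upper axis_notMem_upper upper_subset hp hg
  have gq := IsTrace.greenOn isOpen_lower axis_notMem_lower lower_subset hq hg
  have gp' := IsTrace.greenOn isOpen_upper axis_notMem_upper upper_subset hp' hg
  have gq' := IsTrace.greenOn isOpen_lower axis_notMem_lower lower_subset hq' hg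
  have ep := gp.trace_unique (by simp [dot]) gp'
  have eq := gq.trace_unique (by simp [dot]) gq'
  refine ⟨hm, gp.rotTrace (hm.restrict _), gq.refl_lower.rotTrace ((memLp_refl hm).restrict _), ?_,
    traces_agree hg gp gq⟩
  rw [ae_restrict_iff' measurableSet_Iic] at hsum
  filter_upwards [hsum, ep, eq] with t h1 h2 h3 ht
  rw [h2, h3]
  exact h1 ht

/-- The weight equals t^m t^(-1/2), so `weighted` applies with t₀ = 0. The factor `vcut` only
supplies compact support and is 1 on [0, 1]. -/
theorem integrableOn_rpow_mul {g : ℝ × ℝ → ℝ × ℝ} {p : ℝ → ℝ} (h : RotTrace g p) (m : ℕ) :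
    IntegrableOn (fun t => t ^ (((2 * m + 1 : ℕ) : ℝ) / 2 - 1) * p t) (Icc 0 1) := by
  have h1 := h.weighted 0 (fun t => t ^ m * vcut t) ((continuous_pow m).mul vcut.continuous)
    vcut.hasCompactSupport.mul_left
  rw [integrableOn_Icc_iff_integrableOn_Ioc]
  refine h1.integrableOn.congr_fun (fun t ht => ?_) measurableSet_Ioc
  have hv : vcut t = 1 := vcut_eq_one (by rw [abs_of_pos ht.1]; exact ht.2)
  simp only [sub_zero, abs_of_pos ht.1, hv, mul_one]
  rw [Real.rpow_sub ht.1, Real.rpow_one, ← sqrt_pow_eq_rpow ht.1.le]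
  have hs : 0 < √t := Real.sqrt_pos.2 ht.1
  have e : √t ^ (2 * m + 1) / t = t ^ m * (√t)⁻¹ := by
    rw [pow_succ, pow_mul, Real.sq_sqrt ht.1.le, mul_div_assoc]
    congr 1
    rw [div_eq_iff ht.1.ne', ← div_eq_inv_mul, eq_div_iff hs.ne', Real.mul_self_sqrt ht.1.le]
  rw [e]
  ring

/-! ### The minimiser -/

theorem fn_axis (m : ℕ) (s c t : ℝ) :
    fn m (s - c * Complex.I) (t, 0) = s * (hol m t).re + c * (hol m t).im := by
  rw [fn, toC_axis]
  simp

theorem conj_sub_mul_I (s c : ℝ) :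
    starRingEnd ℂ ((s : ℂ) - c * Complex.I) = (s : ℂ) - (-c : ℝ) * Complex.I := by
  simp

theorem hasWeakGrad_fn (m : ℕ) (β : ℂ) : HasWeakGrad crackᶜ (fn m β) (gd m β) :=
  hasWeakGrad_of_hasFDerivAt (fun _ hx => hasFDerivAt_fn m β hx)
    ((locallyIntegrable_fn m β).locallyIntegrableOn _)
    ((locallyIntegrable_gd m β).locallyIntegrableOn _)

theorem locallyIntegrable_restrict {E : Type*} [NormedAddCommGroup E] {f : ℝ × ℝ → E}
    (hf : LocallyIntegrable f) (s : Set (ℝ × ℝ)) : LocallyIntegrable f (volume.restrict s) := by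
  intro x
  obtain ⟨u, hu, hi⟩ := hf x
  exact ⟨u, hu, hi.mono_measure Measure.restrict_le_self⟩

theorem greenOn_fn (m : ℕ) (β : ℂ) :
    GreenOn upper (0, -1) (fn m β) (gd m β) (fun t => fn m β (t, 0)) :=
  greenOn_of_hasFDerivAt (fun _ hx => hasFDerivAt_fn m β (upper_subset hx)) (continuousOn_fn m β)
    (locallyIntegrable_restrict (locallyIntegrable_fn m β) _) (locallyIntegrable_restrict (locallyIntegrable_gd m β) _)

theorem isUpperTrace_fn (m : ℕ) (β : ℂ) : IsUpperTrace (fn m β) (fun t => fn m β (t, 0)) :=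
  (greenOn_fn m β).isTrace

theorem fn_conj_refl (m : ℕ) (β : ℂ) {x : ℝ × ℝ} (hx : x ∈ crackᶜ) :
    fn m (starRingEnd ℂ β) (refl x) = fn m β x := by
  rw [fn, toC_refl, hol_conj m (toC_sub_one_mem hx), ← map_mul, Complex.conj_re, fn]

theorem isLowerTrace_fn (m : ℕ) (β : ℂ) :
    IsLowerTrace (fn m β) (fun t => fn m (starRingEnd ℂ β) (t, 0)) := by
  have h := (greenOn_fn m (starRingEnd ℂ β)).refl_upper
  refine ⟨h.trace, locallyIntegrable_restrict (locallyIntegrable_fn m β) _, _, h.grad, fun φ hφ e => ?_⟩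
  rw [← h.green φ hφ e]
  refine setIntegral_congr_fun isOpen_lower.measurableSet fun x hx => ?_
  simp only [fn_conj_refl m β (lower_subset hx)]

theorem memLp_fn_disk (m : ℕ) (β : ℂ) (r : ℝ) :
    MemLp (fn m β) 2 (volume.restrict (disk r \ crack)) := by
  have hb : disk r \ crack ⊆ Icc (-|r|) |r| ×ˢ Icc (-|r|) |r| := by
    rintro x ⟨hx, -⟩
    have hx : x.1 ^ 2 + x.2 ^ 2 < r ^ 2 := hx
    exact ⟨abs_le.1 (sq_le_sq.1 (by nlinarith [sq_nonneg x.2])),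
      abs_le.1 (sq_le_sq.1 (by nlinarith [sq_nonneg x.1]))⟩
  have hfin : volume (disk r \ crack) < ⊤ :=
    (measure_mono hb).trans_lt (isCompact_Icc.prod isCompact_Icc).measure_lt_top
  have : IsFiniteMeasure (volume.restrict (disk r \ crack)) := ⟨by simpa using hfin⟩
  exact MemLp.of_bound (measurable_fn m β).aestronglyMeasurable (‖β‖ * hbound m)
    (Eventually.of_forall (norm_fn_le m β))

theorem fn_mem_XTilde (m : ℕ) (s c : ℝ) : fn m (s - c * Complex.I) ∈ XTilde := by
  refine ⟨locallyIntegrable_fn m _, fun r _ => ⟨memLp_fn_disk m _ r, gd m _,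
    (hasWeakGrad_fn m _).mono (fun x hx => hx.2), (memLp_gd m _).restrict _⟩,
    ⟨gd m _, hasWeakGrad_fn m _, (memLp_gd m _).restrict _⟩, _, _, isUpperTrace_fn m _,
    isLowerTrace_fn m _, ?_⟩
  filter_upwards [ae_restrict_mem measurableSet_Iic] with t ht
  rw [conj_sub_mul_I, fn_axis, fn_axis, hol_re_of_nonpos m ht]
  ring

theorem admissible_fn (m : ℕ) (s c : ℝ) : Admissible (gd m (s - c * Complex.I))
    (fun t => fn m (s - c * Complex.I) (t, 0))
    (fun t => fn m (starRingEnd ℂ (s - c * Complex.I)) (t, 0)) :=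
  admissible_of_mem (fn_mem_XTilde m s c) (hasWeakGrad_fn m _) (isUpperTrace_fn m _)
    (isLowerTrace_fn m _)

theorem fn_axis_add (m : ℕ) (s c : ℝ) {t : ℝ} (h0 : 0 ≤ t) (h1 : t ≤ 1) :
    fn m (s - c * Complex.I) (t, 0) + fn m (starRingEnd ℂ (s - c * Complex.I)) (t, 0)
      = 2 * t ^ (((2 * m + 1 : ℕ) : ℝ) / 2) * s := by
  rw [conj_sub_mul_I, fn_axis, fn_axis, hol_re_of_mem m h0 h1]
  ring

/-- Half the Dirichlet integral of `hol`. -/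
noncomputable def dirichlet (m : ℕ) : ℝ := (1 / 2 : ℝ) * ∫ x, ‖dhol m (toC x)‖ ^ 2

theorem dot_gd_self (m : ℕ) (β : ℂ) (x : ℝ × ℝ) :
    dot (gd m β x) (gd m β x) = ‖β‖ ^ 2 * ‖dhol m (toC x)‖ ^ 2 := by
  rw [← mul_pow, ← norm_mul, ← Complex.normSq_eq_norm_sq, Complex.normSq_apply, dot, gd]
  ring

theorem integral_dot_gd_self (m : ℕ) (β : ℂ) :
    ∫ x, dot (gd m β x) (gd m β x) = ‖β‖ ^ 2 * (2 * dirichlet m) := by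
  simp only [dot_gd_self, integral_const_mul, dirichlet]
  ring

theorem dirichlet_pos (m : ℕ) : 0 < dirichlet m := by
  have hint : Integrable fun x => ‖dhol m (toC x)‖ ^ 2 := by
    have := integrable_dot (memLp_gd m 1) (memLp_gd m 1)
    simpa only [dot_gd_self, norm_one, one_pow, one_mul] using this
  refine mul_pos (by norm_num)
    ((integral_pos_iff_support_of_nonneg (fun x => by positivity) hint).2 ?_)
  -- At a real point to the right of 1 the value E is real, so L'(E) is a sum of nonnegative terms
  -- with positive constant term. Continuity from above spreads nonvanishing to a nonempty open set.
  have h2 : gd m 1 (2, 0) ≠ 0 := by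
    have hne : dhol m (toC (2, 0)) ≠ 0 := by
      rw [toC_axis, dhol, djk]
      have h1 : csqrt ((2 : ℝ) : ℂ) ≠ 0 := csqrt_ne_zero (by norm_num)
      have h2 : csqrt (((2 : ℝ) : ℂ) - 1) ≠ 0 := csqrt_ne_zero (by norm_num)
      refine mul_ne_zero ?_ (div_ne_zero (neg_ne_zero.2 (jk_ne_zero _))
        (mul_ne_zero (mul_ne_zero two_ne_zero h1) h2))
      rw [jk_ofReal_of_ge (by norm_num)]
      exact dhalf_ofReal_ne_zero m _
    intro h
    have := dot_gd_self m 1 (2, 0)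
    rw [h] at this
    rw [norm_one, one_pow, one_mul, show dot (0 : ℝ × ℝ) 0 = 0 by simp [dot]] at this
    exact hne (by simpa using this.symm)
  have hcont : ContinuousWithinAt (gd m 1) upper (2, 0) := by
    refine (continuousOn_gd m 1 (2, 0) ⟨le_refl (0 : ℝ), by simp, by simp⟩).mono fun x hx =>
      ⟨(le_of_lt hx : (0 : ℝ) ≤ x.2), upper_ne hx 0, upper_ne hx 1⟩
  have hev : ∀ᶠ x in 𝓝[upper] (2, 0), gd m 1 x ≠ 0 := hcont.eventually_ne h2
  obtain ⟨U, hU, h2U, hsub⟩ := mem_nhdsWithin.1 hev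
  have ht := tendsto_shift (2, 0) (S := upper) fun n => show 0 < (0 : ℝ) + eps n by
    simpa using eps_pos n
  obtain ⟨n, hn⟩ := (ht.eventually (inter_mem (mem_nhdsWithin_of_mem_nhds (hU.mem_nhds h2U))
    self_mem_nhdsWithin)).exists
  refine ((hU.inter isOpen_upper).measure_pos volume ⟨_, hn⟩).trans_le (measure_mono fun x hx => ?_)
  have hx0 : gd m 1 x ≠ 0 := hsub hx
  simp only [Function.mem_support]
  intro h0
  have h1 : dhol m (toC x) = 0 := by simpa using h0
  exact hx0 (by simp [gd, h1])

/-- Apply `integral_dot_gd` with s = 0 and c = 1 to Im F itself: it is odd under reflection, so its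
two traces cancel, and the left side is its own Dirichlet integral. -/
theorem integral_rpow_mul_im (m : ℕ) : ((2 * m + 1 : ℕ) : ℝ) *
    ∫ t in Icc (0 : ℝ) 1, t ^ (((2 * m + 1 : ℕ) : ℝ) / 2 - 1) * (hol m t).im
      = -(2 * dirichlet m) := by
  have h := admissible_fn m 0 1
  have key := integral_dot_gd m 0 1 h.memLp h.above h.below (Eventually.of_forall fun t _ => by
    rw [conj_sub_mul_I, fn_axis, fn_axis]; ring) h.right
  rw [integral_dot_gd_self] at key
  simp only [fn_axis] at key
  have hn : ‖((0 : ℝ) : ℂ) - ((1 : ℝ) : ℂ) * Complex.I‖ = 1 := by simp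
  rw [hn] at key
  simp only [zero_mul, zero_add, one_mul, one_pow, mul_one] at key
  linarith

/-- The part of Re F contributes k ∫ t^(k-1) = 1, the part of Im F is `integral_rpow_mul_im`. -/
theorem integral_rpow_mul_fn (m : ℕ) (s c : ℝ) : ((2 * m + 1 : ℕ) : ℝ) *
    ∫ t in Icc (0 : ℝ) 1, t ^ (((2 * m + 1 : ℕ) : ℝ) / 2 - 1) * fn m (s - c * Complex.I) (t, 0)
      = s - c * (2 * dirichlet m) := by
  set k : ℝ := ((2 * m + 1 : ℕ) : ℝ) with hk
  have hk1 : 1 ≤ k := by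
    rw [hk]; exact_mod_cast Nat.le_add_left 1 _
  have i1 : IntegrableOn (fun t : ℝ => t ^ (k - 1)) (Icc (0 : ℝ) 1) := by
    rw [integrableOn_Icc_iff_integrableOn_Ioc]
    exact (intervalIntegral.intervalIntegrable_rpow' (a := 0) (b := 1) (by linarith)).1
  have i2 : IntegrableOn (fun t : ℝ => t ^ (k / 2 - 1) * (hol m t).im) (Icc (0 : ℝ) 1) := by
    have := integrableOn_rpow_mul (admissible_fn m 0 1).above m
    simpa only [fn_axis, zero_mul, zero_add, one_mul] using this
  have e1 : ∫ t in Icc (0 : ℝ) 1, t ^ (k - 1) = 1 / k := by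
    rw [integral_Icc_eq_integral_Ioc, ← intervalIntegral.integral_of_le zero_le_one,
      integral_rpow (Or.inl (by linarith))]
    simp [Real.zero_rpow (show k ≠ 0 by linarith)]
  have e2 : ∫ t in Icc (0 : ℝ) 1, t ^ (k / 2 - 1) * fn m (s - c * Complex.I) (t, 0)
      = ∫ t in Icc (0 : ℝ) 1, (s * t ^ (k - 1) + c * (t ^ (k / 2 - 1) * (hol m t).im)) := by
    rw [integral_Icc_eq_integral_Ioc, integral_Icc_eq_integral_Ioc]
    refine setIntegral_congr_fun measurableSet_Ioc fun t ht => ?_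
    have : t ^ (k - 1) = t ^ (k / 2 - 1) * t ^ (k / 2) := by
      rw [← Real.rpow_add ht.1]; congr 1; ring
    simp only [fn_axis]
    rw [hol_re_of_mem m ht.1.le ht.2, this]
    ring
  rw [e2, integral_add (i1.const_mul s) (i2.const_mul c), integral_const_mul, integral_const_mul,
    e1]
  have := integral_rpow_mul_im m
  rw [← hk] at this
  have hk0 : k ≠ 0 := by linarith
  calc k * (s * (1 / k) + c * ∫ t in Icc (0 : ℝ) 1, t ^ (k / 2 - 1) * (hol m t).im)
      = s + c * (k * ∫ t in Icc (0 : ℝ) 1, t ^ (k / 2 - 1) * (hol m t).im) := by field_simp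
    _ = _ := by rw [this]; ring

theorem norm_sin_sub_cos (ζ : ℝ) :
    ‖((Real.sin ζ : ℝ) : ℂ) - ((Real.cos ζ : ℝ) : ℂ) * Complex.I‖ ^ 2 = 1 := by
  rw [← Complex.normSq_eq_norm_sq, Complex.normSq_apply]
  simp only [Complex.sub_re, Complex.sub_im, Complex.re_ofReal_mul, Complex.im_ofReal_mul,
    Complex.ofReal_re, Complex.ofReal_im, Complex.I_re, Complex.I_im]
  linarith [Real.sin_sq_add_cos_sq ζ]

/-- The minimum is attained at `fn` and equals `-A cos 2ζ`, `A` being `dirichlet m`. -/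
theorem isLeast_energyValues (m : ℕ) (ζ : ℝ) :
    IsLeast (energyValues (2 * m + 1) ζ) (-(dirichlet m * Real.cos (2 * ζ))) := by
  set s := Real.sin ζ with hs
  set c := Real.cos ζ with hc
  set β : ℂ := (s : ℂ) - (c : ℂ) * Complex.I with hβ
  have hβn : ‖β‖ ^ 2 = 1 := norm_sin_sub_cos ζ
  have hu : Admissible (gd m β) (fun t => fn m β (t, 0))
    (fun t => fn m (starRingEnd ℂ β) (t, 0)) := admissible_fn m s c
  -- Since |β| = 1 the right side is A + c(s - 2Ac) - cs = A(1 - 2c²).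
  have hval : -(dirichlet m * Real.cos (2 * ζ)) = (1 / 2 : ℝ) * (∫ x, dot (gd m β x) (gd m β x))
      + ((2 * m + 1 : ℕ) : ℝ) * c * (∫ t in Icc (0 : ℝ) 1,
        t ^ (((2 * m + 1 : ℕ) : ℝ) / 2 - 1) * fn m β (t, 0)) - c * s := by
    have h := integral_rpow_mul_fn m s c
    rw [integral_dot_gd_self, hβn, mul_right_comm, h, Real.cos_two_mul]
    ring
  constructor
  · refine ⟨fn m β, fn_mem_XTilde m s c, gd m β, _, _, hasWeakGrad_fn m β, isUpperTrace_fn m β,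
      isLowerTrace_fn m β, ?_, ?_⟩
    · filter_upwards [ae_restrict_mem measurableSet_Icc] with t ht
      exact fn_axis_add m s c ht.1 ht.2
    · rw [restrict_crack_compl, hval]
  · rintro E ⟨v, hv, g, p, q, hg, hp, hq, hpq, rfl⟩
    have ha := admissible_of_mem hv hg hp hq
    have hbelow : RotTrace (fun x => refl ((g - gd m β) (refl x)))
        (q - fun t => fn m (starRingEnd ℂ β) (t, 0)) := by
      have := ha.below.sub hu.below
      refine cast (congrArg₂ RotTrace ?_ rfl) this
      funext x
      ext <;> simp [refl]
      ring
    -- On S₁ both functions have the same sum of traces, on Γ₀ both sums vanish.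
    have hsum : ∀ᵐ t : ℝ, t ≤ 1 → (p - fun t => fn m β (t, 0)) t +
        (q - fun t => fn m (starRingEnd ℂ β) (t, 0)) t = 0 := by
      rw [ae_restrict_iff' measurableSet_Icc] at hpq
      filter_upwards [hpq, ha.left, hu.left] with t h1 h2 h3 ht
      simp only [Pi.sub_apply]
      rcases le_total t 0 with h0 | h0
      · linarith [h2 h0, h3 h0]
      · linarith [h1 ⟨h0, ht⟩, fn_axis_add m s c h0 ht]
    have hdiff : ∀ᵐ t : ℝ, 1 < t → (p - fun t => fn m β (t, 0)) t =
        (q - fun t => fn m (starRingEnd ℂ β) (t, 0)) t := by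
      filter_upwards [ha.right, hu.right] with t h1 h2 ht
      simp only [Pi.sub_apply]
      rw [h1 ht, h2 ht]
    have hd : MemLp (g - gd m β) 2 := ha.memLp.sub hu.memLp
    have orth := integral_dot_gd m s c hd (ha.above.sub hu.above) hbelow hsum hdiff
    have eint : ∫ t in Icc (0 : ℝ) 1, t ^ (((2 * m + 1 : ℕ) : ℝ) / 2 - 1) *
          (p - fun t => fn m β (t, 0)) t
        = (∫ t in Icc (0 : ℝ) 1, t ^ (((2 * m + 1 : ℕ) : ℝ) / 2 - 1) * p t)
          - ∫ t in Icc (0 : ℝ) 1, t ^ (((2 * m + 1 : ℕ) : ℝ) / 2 - 1) * fn m β (t, 0) := by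
      rw [← integral_sub (integrableOn_rpow_mul ha.above m) (integrableOn_rpow_mul hu.above m)]
      simp only [Pi.sub_apply, mul_sub]
    rw [eint] at orth
    -- Expanding the square around the minimiser, `orth` cancels the cross term against the change
    -- of the boundary term, and a nonnegative square remains.
    have esq : ∫ x, dot (g x) (g x) = (∫ x, dot (gd m β x) (gd m β x))
        + 2 * (∫ x, dot ((g - gd m β) x) (gd m β x))
        + ∫ x, dot ((g - gd m β) x) ((g - gd m β) x) := by
      rw [← integral_const_mul, ← integral_add (integrable_dot hu.memLp hu.memLp)
        ((integrable_dot hd hu.memLp).const_mul 2), ← integral_add _ (integrable_dot hd hd)]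
      · refine integral_congr_ae (Eventually.of_forall fun x => ?_)
        simp only [dot, Pi.sub_apply, Prod.fst_sub, Prod.snd_sub]
        ring
      · exact (integrable_dot hu.memLp hu.memLp).add ((integrable_dot hd hu.memLp).const_mul 2)
    have hpos : 0 ≤ ∫ x, dot ((g - gd m β) x) ((g - gd m β) x) :=
      integral_nonneg fun x => add_nonneg (mul_self_nonneg _) (mul_self_nonneg _)
    rw [restrict_crack_compl, hval, esq, orth]
    linarith

/-! ### The closed formula and its consequences -/

theorem G_eq (m : ℕ) (ζ : ℝ) : G (2 * m + 1) ζ = -(dirichlet m * Real.cos (2 * ζ)) :=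
  (isLeast_energyValues m ζ).csInf_eq

theorem strictMonoOn_G (m : ℕ) : StrictMonoOn (G (2 * m + 1)) (Icc 0 (Real.pi / 2)) := by
  intro a ha b hb hab
  rw [G_eq, G_eq, neg_lt_neg_iff]
  refine mul_lt_mul_of_pos_left ?_ (dirichlet_pos m)
  exact Real.strictAntiOn_cos ⟨by linarith [ha.1], by linarith [ha.2]⟩
    ⟨by linarith [hb.1], by linarith [hb.2]⟩ (by linarith)

end SlitPlane

theorem lemma4p1 (k : ℕ) (hk : Odd k) :
    (∀ ζ : ℝ, IsLeast (SlitPlane.energyValues k ζ) (SlitPlane.G k ζ)) ∧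
    Continuous (SlitPlane.G k) ∧
    (SlitPlane.G k 0 < 0 ∧ 0 < SlitPlane.G k (Real.pi / 2)) ∧
    (∀ ζ : ℝ, SlitPlane.G k (ζ + Real.pi) = SlitPlane.G k ζ) ∧
    (∀ ζ : ℝ, SlitPlane.G k (Real.pi - ζ) = SlitPlane.G k ζ) ∧
    StrictMonoOn (SlitPlane.G k) (Set.Ioo (Real.pi / 4) (Real.pi / 2)) ∧
    (∀ I : Set ℝ, I.OrdConnected → I ⊆ Set.Ioo 0 (Real.pi / 2) →
      (∀ ζ ∈ I, 0 < SlitPlane.G k ζ) → StrictMonoOn (SlitPlane.G k) I) := by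
  obtain ⟨m, rfl⟩ := hk
  have hA := SlitPlane.dirichlet_pos m
  have hmono := SlitPlane.strictMonoOn_G m
  have hG := SlitPlane.G_eq m
  refine ⟨fun ζ => ?_, ?_, ⟨?_, ?_⟩, fun ζ => ?_, fun ζ => ?_, ?_, fun I _ hI _ => ?_⟩
  · rw [hG]; exact SlitPlane.isLeast_energyValues m ζ
  · rw [show SlitPlane.G (2 * m + 1) = _ from funext hG]; fun_prop
  · rw [hG]; simpa using hA
  · rw [hG, show 2 * (Real.pi / 2) = Real.pi by ring, Real.cos_pi]; linarith
  · rw [hG, hG, show 2 * (ζ + Real.pi) = 2 * ζ + 2 * Real.pi by ring, Real.cos_add_two_pi]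
  · rw [hG, hG, show 2 * (Real.pi - ζ) = 2 * Real.pi - 2 * ζ by ring, Real.cos_two_pi_sub]
  · refine hmono.mono fun x hx => ⟨?_, hx.2.le⟩
    linarith [hx.1, Real.pi_pos]
  · exact hmono.mono fun x hx => ⟨(hI hx).1.le, (hI hx).2.le⟩
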